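/- **Proposition (Non-Pinwheel).** *Setting.* The prototile is the right triangle with side lengths $1, 2, \sqrt5$. In a triangle with legs in the ratio $1:2$ use the affine coordinates in which the right-angled corner is $(0,0)$, the other end of the short leg is $(5,0)$ and the other end of the long leg is $(0,10)$. The non-pinwheel substitution inflates a tile by the factor $\sqrt5$ and dissects it into the five tiles with corners (right angle, end of short leg, end of long leg) $$\begin{gathered}(2,1),(0,0),(0,5);\qquad (0,5),(2,6),(2,1);\qquad (2,6),(0,5),(0,10);\\ (4,2),(2,1),(2,6);\qquad (4,2),(5,0),(0,0).\end{gathered}$$ A non-pinwheel tiling is a set $\mathcal T$ of such triangles that covers the plane, whose different members have disjoint interiors, and each finite subset of which is congruent to a part of some $n$-fold substitution of the prototile ($n \ge 0$). The graph $G_{\mathcal T}$ has as vertices the corners of all tiles; two different vertices are adjacent if the segment between them lies in the union of the tile boundaries and contains no vertex in between. For a labelling $l$ of the edges, the sum of a vertex $u$ is $s_l(u)=\sum_{uv\in E}l(uv)$; $l$ is a solution to the 1-2-3 problem if it takes values in $\{1,2,3\}$ and $s_l(u)\ne s_l(v)$ whenever $uv$ is an edge. The rectangle supertile is the $\sqrt5\times2\sqrt5$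 rectangle $[0,5]\times[0,10]$ (in units of $1/\sqrt5$) made of 10 tiles, namely the dissections of the two triangles with corners $(0,0),(5,0),(0,10)$ and $(5,10),(0,10),(5,0)$. Colour its external vertices $(0,0),(0,10),(5,5)$ blue and $(5,0),(5,10),(0,5)$ red, and weight its internal edges by $$\begin{array}{lll} (0,0)(2,1)\mapsto 3 & (0,10)(1,8)\mapsto 3 & (5,5)(3,9)\mapsto 2\\ (5,5)(3,4)\mapsto 1 & (5,10)(3,9)\mapsto 2 & (5,0)(4,2)\mapsto 2\\ (0,5)(2,6)\mapsto 1 & (0,5)(2,1)\mapsto 1 & (2,1)(4,2)\mapsto 2\\ (4,2)(3,4)\mapsto 2 & (3,4)(2,6)\mapsto 1 & (2,6)(1,8)\mapsto 1\\ (1,8)(3,9)\mapsto 1 & (3,9)(3,4)\mapsto 1 & (2,1)(2,6)\mapsto 1. \end{array}$$ *Claim.* Every non-pinwheel tiling $\mathcal T$ has a partition into congruent copies of the rectangle supertile with the following properties. Call the vertices and edges of $G_{\mathcal T}$ on the boundaries of these rectangles external. 1. The external vertices can be coloured red and blue such that the ends of each external edge have different colours. 2. For each such colouring, each rectangle of the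 partition is the image of the model rectangle (as a set of tiles) under exactly one isometry that respects the colours. Hence there is a labelling of the edges of $G_{\mathcal T}$ that gives weight $3$ to all external edges and, inside each rectangle, carries over the weights of the internal edges of the model by this isometry. 3. For each such colouring and labelling, at each external vertex of each rectangle the internal edges of that rectangle sum to $2$ if the vertex is red and to $3$ if it is blue. The sum of each red vertex of $G_{\mathcal T}$ is $10$, $15$ or $20$, the sum of each blue vertex is $12$, $18$ or $24$, and the internal vertices corresponding to $(2,1),(3,4),(4,2),(2,6),(1,8),(3,9)$ have the sums $7,5,6,4,5,6$. 4. $G_{\mathcal T}$ is locally finite and the labelling is a solution to the 1-2-3 problem for $G_{\mathcal T}$. -/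

import Mathlib

noncomputable section

namespace NonPinwheel

/-! ### Labelled right triangles in the plane `ℂ = ℝ²` -/

/-- A triangle in the plane with labelled corners: `P` is the right-angled corner, `S` the other
end of the short leg and `L` the other end of the long leg. For a triangle with side lengths
`1, 2, √5` the labels are determined by the underlying set. -/
@[ext] structure Tri where
  P : ℂ
  S : ℂ
  L : ℂ

namespace Tri

/-- The three corners. -/
def corners (t : Tri) : Set ℂ := {t.P, t.S, t.L}

/-- The closed triangle as a subset of the plane. -/
def carrier (t : Tri) : Set ℂ := convexHull ℝ t.corners

/-- The image of a triangle under a map of the plane. -/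
def map (f : ℂ → ℂ) (t : Tri) : Tri := ⟨f t.P, f t.S, f t.L⟩

/-- The point with coordinates `(x, y)` in the affine frame in which the corners `P, S, L`
of the triangle are `(0, 0)`, `(5, 0)`, `(0, 10)`. -/
def pt (t : Tri) (x y : ℝ) : ℂ := t.P + (x / 5) • (t.S - t.P) + (y / 10) • (t.L - t.P)

/-- The non-pinwheel dissection of a triangle (legs in ratio `1 : 2`) into five similar triangles
that are smaller by the factor `√5`. -/
def dissect (t : Tri) : Set Tri :=
  {⟨t.pt 2 1, t.pt 0 0, t.pt 0 5⟩,
   ⟨t.pt 0 5, t.pt 2 6, t.pt 2 1⟩,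
   ⟨t.pt 2 6, t.pt 0 5, t.pt 0 10⟩,
   ⟨t.pt 4 2, t.pt 2 1, t.pt 2 6⟩,
   ⟨t.pt 4 2, t.pt 5 0, t.pt 0 0⟩}

/-- Inflation by the factor `√5`. -/
def inflate (t : Tri) : Tri := t.map (fun z => (Real.sqrt 5 : ℂ) * z)

end Tri

/-! ### The non-pinwheel tilings -/

/-- The prototile: a right triangle with side lengths `1, 2, √5`. -/
def prototile : Tri := ⟨0, 1, 2 * Complex.I⟩

/-- The `n`-th supertile: the `n`-fold substitution (inflate, then dissect) of the prototile. -/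
def supertile : ℕ → Set Tri
  | 0 => {prototile}
  | n + 1 => ⋃ t ∈ supertile n, t.inflate.dissect

/-- `T` is a non-pinwheel tiling: its tiles cover the plane, different tiles have disjoint
interiors, and each finite set of tiles is congruent to a part of some supertile. -/
structure IsTiling (T : Set Tri) : Prop where
  cover : ⋃ t ∈ T, t.carrier = Set.univ
  disjoint : ∀ t ∈ T, ∀ t' ∈ T, t ≠ t' → Disjoint (interior t.carrier) (interior t'.carrier)
  legal : ∀ F : Set Tri, F ⊆ T → F.Finite →
    ∃ (n : ℕ) (f : ℂ ≃ᵢ ℂ), Tri.map f '' F ⊆ supertile n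

/-! ### The graph of a tiling by triangles -/

/-- The corners of all tiles. -/
def vertexSet (T : Set Tri) : Set ℂ := ⋃ t ∈ T, t.corners

/-- The union of the boundaries of all tiles. -/
def skeleton (T : Set Tri) : Set ℂ := ⋃ t ∈ T, frontier t.carrier

/-- The graph of the tiling: two different vertices are joined if the segment between them runs in
the union of the tile boundaries and has no vertex in between. (Points of the plane that are
not vertices of the tiling are isolated and play no role.) -/
def graph (T : Set Tri) : SimpleGraph ℂ where
  Adj u v := u ≠ v ∧ u ∈ vertexSet T ∧ v ∈ vertexSet T ∧
    segment ℝ u v ⊆ skeleton T ∧ Disjoint (openSegment ℝ u v) (vertexSet T)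
  symm := ⟨fun u v h => ⟨h.1.symm, h.2.2.1, h.2.1, by
    rw [segment_symm]; exact h.2.2.2.1, by rw [openSegment_symm]; exact h.2.2.2.2⟩⟩
  loopless := ⟨fun _ h => h.1 rfl⟩

/-- The weighted degree of a vertex `u`: the sum of the labels of the edges at `u`. -/
def weightedDegree {V : Type*} (G : SimpleGraph V) (l : Sym2 V → ℕ) (u : V) : ℕ :=
  ∑ᶠ v ∈ G.neighborSet u, l s(u, v)

/-- The edge labelling `l` solves the 1-2-3 problem for the locally finite graph `G`. -/
structure IsSolution123 {V : Type*} (G : SimpleGraph V) (l : Sym2 V → ℕ) : Prop where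
  locallyFinite : ∀ u, (G.neighborSet u).Finite
  labels : ∀ e ∈ G.edgeSet, l e = 1 ∨ l e = 2 ∨ l e = 3
  colouring : ∀ u v, G.Adj u v → weightedDegree G l u ≠ weightedDegree G l v

/-! ### The rectangle supertile -/

/-- The model rectangle is drawn in units of `1 / √5`: it is `[0, 5] × [0, 10]`. -/
def node (p : ℕ × ℕ) : ℂ := ((p.1 : ℂ) + (p.2 : ℂ) * Complex.I) / (Real.sqrt 5 : ℂ)

/-- The ten tiles of the rectangle supertile in model position: two inflated tiles that share their
hypotenuse and together form a `√5 × 2√5` rectangle, each dissected into five tiles. -/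
def rectangle : Set Tri :=
  Tri.dissect ⟨node (0, 0), node (5, 0), node (0, 10)⟩ ∪
  Tri.dissect ⟨node (5, 10), node (0, 10), node (5, 0)⟩

/-- The copy of the rectangle supertile placed by the isometry `φ`. -/
def placed (φ : ℂ ≃ᵢ ℂ) : Set Tri := Tri.map φ '' rectangle

/-- The region covered by a set of tiles. -/
def region (R : Set Tri) : Set ℂ := ⋃ t ∈ R, t.carrier

/-- `𝓡` is a partition of the tiling `T` into rectangle supertiles. -/
structure IsRectanglePartition (T : Set Tri) (𝓡 : Set (Set Tri)) : Prop where
  congruent : ∀ R ∈ 𝓡, ∃ φ : ℂ ≃ᵢ ℂ, R = placed φ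
  disjoint : 𝓡.PairwiseDisjoint id
  union : ⋃₀ 𝓡 = T

/-- External vertices: those on the boundary of a rectangle supertile. -/
def ExternalVertex (T : Set Tri) (𝓡 : Set (Set Tri)) (v : ℂ) : Prop :=
  v ∈ vertexSet T ∧ ∃ R ∈ 𝓡, v ∈ frontier (region R)

/-- External edges: those that run in the boundary of a rectangle supertile. -/
def ExternalEdge (T : Set Tri) (𝓡 : Set (Set Tri)) (u v : ℂ) : Prop :=
  (graph T).Adj u v ∧ ∃ R ∈ 𝓡, segment ℝ u v ⊆ frontier (region R)

/-- Edges that are internal to the rectangle supertile `R`. -/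
def InternalEdge (T : Set Tri) (R : Set Tri) (u v : ℂ) : Prop :=
  (graph T).Adj u v ∧ openSegment ℝ u v ⊆ interior (region R)

/-- The sum of the labels over the group of internal edges of `R` at `v`. -/
def groupSum (T : Set Tri) (l : Sym2 ℂ → ℕ) (R : Set Tri) (v : ℂ) : ℕ :=
  ∑ᶠ u ∈ {u | InternalEdge T R v u}, l s(v, u)

/-! ### Colours and weights -/

/-- The two colours of the external vertices. -/
inductive Colour
  | red
  | blue

/-- The colours of external vertices alternate along external edges. (Only the values of `c` at
external vertices matter.) -/
def IsAlternating (T : Set Tri) (𝓡 : Set (Set Tri)) (c : ℂ → Colour) : Prop :=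
  ∀ u v, ExternalEdge T 𝓡 u v → c u ≠ c v

/-- The blue external vertices of the model rectangle. -/
def blueNodes : List (ℕ × ℕ) := [(0, 0), (0, 10), (5, 5)]

/-- The red external vertices of the model rectangle. -/
def redNodes : List (ℕ × ℕ) := [(5, 0), (5, 10), (0, 5)]

/-- The placement `φ` of the model rectangle takes its colours to the colours `c`. -/
def Matches (c : ℂ → Colour) (φ : ℂ ≃ᵢ ℂ) : Prop :=
  (∀ p ∈ blueNodes, c (φ (node p)) = Colour.blue) ∧
  (∀ p ∈ redNodes, c (φ (node p)) = Colour.red)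

/-- The fifteen internal edges of the model rectangle with their weights. -/
def internalWeights : List ((ℕ × ℕ) × (ℕ × ℕ) × ℕ) :=
  [((0, 0), (2, 1), 3), ((0, 10), (1, 8), 3), ((5, 5), (3, 9), 2), ((5, 5), (3, 4), 1),
   ((5, 10), (3, 9), 2), ((5, 0), (4, 2), 2), ((0, 5), (2, 6), 1), ((0, 5), (2, 1), 1),
   ((2, 1), (4, 2), 2), ((4, 2), (3, 4), 2), ((3, 4), (2, 6), 1), ((2, 6), (1, 8), 1),
   ((1, 8), (3, 9), 1), ((3, 9), (3, 4), 1), ((2, 1), (2, 6), 1)]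

/-- The six internal vertices of the model rectangle with their weighted degrees. -/
def internalDegrees : List ((ℕ × ℕ) × ℕ) :=
  [((2, 1), 7), ((3, 4), 5), ((4, 2), 6), ((2, 6), 4), ((1, 8), 5), ((3, 9), 6)]

/-- The labelling `l` is the prescribed one: external edges get weight `3`, and in each rectangle
supertile, placed such that the colours match, the internal edges get the weights of the model. -/
structure IsPrescribed (T : Set Tri) (𝓡 : Set (Set Tri)) (c : ℂ → Colour)
    (l : Sym2 ℂ → ℕ) : Prop where
  external : ∀ u v, ExternalEdge T 𝓡 u v → l s(u, v) = 3
  internal : ∀ φ : ℂ ≃ᵢ ℂ, placed φ ∈ 𝓡 → Matches c φ →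
    ∀ e ∈ internalWeights, l s(φ (node e.1), φ (node e.2.1)) = e.2.2

end NonPinwheel

end

noncomputable section

namespace NonPinwheel

open Set Complex

/-! The tiling is a domino tiling in disguise. The five pieces of a dissection all have the
orientation opposite to their parent, turned by the argument of 2 + i and a multiple of 90°, with
right-angled corners divisible by 2 + i. So, by induction on the level, the triangles with legs √5
and 2√5 that make up an inflated supertile sit on one square lattice of mesh √5, all with the same
orientation (`aligned_supertile`).

A tiling inherits this structure from its finite patches. Each patch lies in a supertile, hence its
tiles have parents there; an ultrafilter on the finite patches selects a coherent parent for every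
tile (`IsTiling.exists_composition`). No recognizability of the substitution is needed: some
consistent choice is enough. The parents form an aligned packing that covers the plane, and in such
a packing the only triangle that fits across a hypotenuse is the half-turn of the given one
(`flip_mem`). The pairs are 1 × 2 rectangles on the lattice, that is, dominoes
(`IsTiling.exists_dominoTiling`).

Everything else is combinatorics of dominoes plus a finite check of the model. The interior of a
rectangle meets no other rectangle (`IsDominoTiling.eq_of_mem_interior`), all external vertices are
lattice points, and the edges of the graph are exactly the images of the 21 model edges
(`graph_adj_iff`). The checkerboard colouring alternates. The boundary of a rectangle is a 6-cycle
whose two alternating colourings are exchanged by the half-turn, and the half-turn is the only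
nontrivial symmetry of the model, so exactly one placement respects the colours
(`existsUnique_matches`).

At a lattice point, the four surrounding cells belong to n = 2, 3 or 4 dominoes, since diagonal
cells are never in the same domino, and the number of external edges there is also n
(`card_externalNbrs`). Each external edge contributes 3 and each rectangle contributes k = 2 (red)
or k = 3 (blue), so the sum is n(3 + k), that is 5n or 6n (`weightedDegree_gridPoint`). The values
10, 15, 20 and 12, 18, 24 are disjoint, the internal sums 4 to 7 are smaller than all of them, and
the edges between internal vertices are checked by enumeration. -/

/-- A map of the plane is an affine bijection. -/
def IsAff (f : ℂ → ℂ) : Prop := ∃ g : ℂ ≃ᵃ[ℝ] ℂ, ⇑g = f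

/-! ### Affine bijections of the plane -/

namespace IsAff

variable {f g : ℂ → ℂ}

lemma comp (hg : IsAff g) (hf : IsAff f) : IsAff (fun z => g (f z)) := by
  obtain ⟨g, rfl⟩ := hg
  obtain ⟨f, rfl⟩ := hf
  exact ⟨f.trans g, rfl⟩

lemma isometryEquiv (φ : ℂ ≃ᵢ ℂ) : IsAff φ :=
  ⟨φ.toRealAffineIsometryEquiv.toAffineEquiv, φ.coeFn_toRealAffineIsometryEquiv⟩

lemma bijective (hf : IsAff f) : Function.Bijective f := by
  obtain ⟨f, rfl⟩ := hf
  exact f.bijective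

lemma injective (hf : IsAff f) : Function.Injective f := hf.bijective.1

lemma exists_homeomorph (hf : IsAff f) : ∃ e : ℂ ≃ₜ ℂ, ⇑e = f := by
  obtain ⟨f, rfl⟩ := hf
  exact ⟨(AffineEquiv.toContinuousAffineEquiv f).toHomeomorph, rfl⟩

lemma image_interior (hf : IsAff f) (s : Set ℂ) : interior (f '' s) = f '' interior s := by
  obtain ⟨e, rfl⟩ := hf.exists_homeomorph
  exact (e.image_interior s).symm

lemma image_frontier (hf : IsAff f) (s : Set ℂ) : frontier (f '' s) = f '' frontier s := by
  obtain ⟨e, rfl⟩ := hf.exists_homeomorph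
  exact (e.image_frontier s).symm

lemma image_convexHull (hf : IsAff f) (s : Set ℂ) :
    convexHull ℝ (f '' s) = f '' convexHull ℝ s := by
  obtain ⟨f, rfl⟩ := hf
  exact (AffineMap.image_convexHull f.toAffineMap s).symm

lemma image_segment (hf : IsAff f) (a b : ℂ) : f '' segment ℝ a b = segment ℝ (f a) (f b) := by
  obtain ⟨f, rfl⟩ := hf
  exact _root_.image_segment ℝ f.toAffineMap a b

lemma image_openSegment (hf : IsAff f) (a b : ℂ) :
    f '' openSegment ℝ a b = openSegment ℝ (f a) (f b) := by
  obtain ⟨f, rfl⟩ := hf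
  exact _root_.image_openSegment ℝ f.toAffineMap a b

lemma map_pt (hf : IsAff f) (t : Tri) (x y : ℝ) : (t.map f).pt x y = f (t.pt x y) := by
  obtain ⟨f, rfl⟩ := hf
  have h (a b : ℂ) : f b - f a = f.linear (b - a) := by
    simpa using (f.toAffineMap.linearMap_vsub b a).symm
  have h2 (a b : ℂ) : f (a + b) = f a + f.linear b := by
    have := f.map_vadd a b
    simp only [vadd_eq_add] at this
    rw [add_comm a, this, add_comm]
  simp only [Tri.pt, Tri.map, add_assoc]
  rw [h2, map_add, map_smul, map_smul, h, h]

end IsAff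

lemma isAff_mul_add {a : ℂ} (ha : a ≠ 0) (b : ℂ) : IsAff (fun z => a * z + b) := by
  let e : ℂ ≃ₗ[ℝ] ℂ := (LinearEquiv.smulOfNeZero ℂ ℂ a ha).restrictScalars ℝ
  refine ⟨e.toAffineEquiv.trans (AffineEquiv.vaddConst ℝ b), ?_⟩
  ext z
  simp [e]

lemma isAff_mul {a : ℂ} (ha : a ≠ 0) : IsAff (fun z => a * z) := by
  simpa using isAff_mul_add ha 0

lemma isAff_conj : IsAff (starRingEnd ℂ) := IsAff.isometryEquiv conjLIE.toIsometryEquiv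

lemma isAff_mul_conj_add {a : ℂ} (ha : a ≠ 0) (b : ℂ) :
    IsAff (fun z => a * starRingEnd ℂ z + b) :=
  (isAff_mul_add ha b).comp isAff_conj

/-! ### The reference triangle and its dissection -/

namespace Tri

lemma map_map (f g : ℂ → ℂ) (t : Tri) : (t.map g).map f = t.map (fun z => f (g z)) := rfl

lemma map_injective {f : ℂ → ℂ} (hf : Function.Injective f) : Function.Injective (Tri.map f) := by
  intro s t h
  simp only [map, Tri.mk.injEq] at h
  exact Tri.ext (hf h.1) (hf h.2.1) (hf h.2.2)

lemma corners_map (f : ℂ → ℂ) (t : Tri) : (t.map f).corners = f '' t.corners := by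
  simp [corners, map, image_insert_eq]

variable {f : ℂ → ℂ}

lemma carrier_map (hf : IsAff f) (t : Tri) : (t.map f).carrier = f '' t.carrier := by
  rw [carrier, corners_map, hf.image_convexHull, carrier]

lemma dissect_map (hf : IsAff f) (t : Tri) : (t.map f).dissect = Tri.map f '' t.dissect := by
  simp only [dissect, image_insert_eq, image_singleton]
  simp only [map, ← hf.map_pt]

/-- The reference triangle with corners `0, 5, 10 i`. -/
def std : Tri := ⟨0, 5, 10 * I⟩

lemma carrier_std : std.carrier = {z | 0 ≤ z.re ∧ 0 ≤ z.im ∧ 2 * z.re + z.im ≤ 10} := by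
  apply Subset.antisymm
  · refine convexHull_min ?_ ?_
    · rintro z (rfl | rfl | rfl) <;> norm_num [std]
    · intro z hz w hw a b ha hb hab
      obtain ⟨h1, h2, h3⟩ := hz
      obtain ⟨h4, h5, h6⟩ := hw
      refine ⟨?_, ?_, ?_⟩ <;> simp
      · positivity
      · positivity
      · have := mul_le_mul_of_nonneg_left h3 ha
        have := mul_le_mul_of_nonneg_left h6 hb
        nlinarith
  · rintro z ⟨h1, h2, h3⟩
    have hz : z = ∑ i : Fin 3, (![1 - z.re / 5 - z.im / 10, z.re / 5, z.im / 10] i) •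
        (![std.P, std.S, std.L] i) := by
      apply Complex.ext <;> simp [Fin.sum_univ_three, std]
    rw [hz]
    refine (convex_convexHull ℝ _).sum_mem ?_ ?_ ?_
    · intro i _
      fin_cases i <;> simp <;> linarith
    · simp only [Fin.sum_univ_three, Matrix.cons_val]
      ring
    · intro i _
      apply subset_convexHull
      fin_cases i <;> simp [corners]

lemma interior_carrier_std :
    interior std.carrier = {z | 0 < z.re ∧ 0 < z.im ∧ 2 * z.re + z.im < 10} := by
  apply Subset.antisymm
  · intro z hz
    have hc := interior_subset hz
    rw [carrier_std] at hc
    obtain ⟨h1, h2, h3⟩ := hc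
    obtain ⟨ε, hε, hb⟩ := Metric.isOpen_iff.1 isOpen_interior z hz
    have key (w : ℂ) (hw : ‖w‖ = 1) : z + (ε / 2 : ℝ) * w ∈ std.carrier := by
      apply interior_subset
      apply hb
      rw [Metric.mem_ball, dist_eq, add_sub_cancel_left, norm_mul, hw, norm_real,
        Real.norm_of_nonneg (by positivity)]
      linarith
    have k1 := key (-1) (by simp)
    have k2 := key (-I) (by simp)
    have k3 := key I (by simp)
    rw [carrier_std] at k1 k2 k3
    obtain ⟨k1, -, -⟩ := k1
    obtain ⟨-, k2, -⟩ := k2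
    obtain ⟨-, -, k3⟩ := k3
    simp at k1 k2 k3
    refine ⟨?_, ?_, ?_⟩ <;> linarith
  · apply interior_maximal
    · rw [carrier_std]
      rintro z ⟨h1, h2, h3⟩
      exact ⟨h1.le, h2.le, h3.le⟩
    · refine (isOpen_lt continuous_const continuous_re).inter
        ((isOpen_lt continuous_const continuous_im).inter (isOpen_lt ((continuous_const.mul continuous_re).add continuous_im)
          continuous_const))

lemma isClosed_carrier_std : IsClosed std.carrier := by
  rw [carrier_std]
  exact (isClosed_le continuous_const continuous_re).inter
    ((isClosed_le continuous_const continuous_im).inter (isClosed_le ((continuous_const.mul continuous_re).add continuous_im)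
          continuous_const))

lemma frontier_carrier_std : frontier std.carrier =
    segment ℝ std.P std.S ∪ segment ℝ std.S std.L ∪ segment ℝ std.P std.L := by
  rw [isClosed_carrier_std.frontier_eq, interior_carrier_std, carrier_std]
  simp only [segment_eq_image', std]
  ext z
  constructor
  · rintro ⟨⟨h1, h2, h3⟩, h4⟩
    rcases h1.eq_or_lt with h1' | h1'
    · right
      exact ⟨z.im / 10, ⟨by linarith, by linarith⟩, by apply Complex.ext <;> simp <;> linarith⟩
    rcases h2.eq_or_lt with h2' | h2'
    · left; left
      exact ⟨z.re / 5, ⟨by linarith, by linarith⟩, by apply Complex.ext <;> simp <;> linarith⟩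
    left; right
    have h5 : 2 * z.re + z.im = 10 := by
      by_contra h
      exact h4 ⟨h1', h2', lt_of_le_of_ne h3 h⟩
    exact ⟨z.im / 10, ⟨by linarith, by linarith⟩, by apply Complex.ext <;> simp <;> linarith⟩
  · rintro ((⟨x, ⟨h1, h2⟩, rfl⟩ | ⟨x, ⟨h1, h2⟩, rfl⟩) | ⟨x, ⟨h1, h2⟩, rfl⟩)
    · refine ⟨⟨?_, ?_, ?_⟩, fun h => ?_⟩
      · simpa using h1
      · simp
      · simp; linarith
      · simpa using h.2.1
    · refine ⟨⟨?_, ?_, ?_⟩, fun h => ?_⟩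
      · simpa using h2
      · simpa using h1
      · simp; linarith
      · have := h.2.2
        simp at this
        linarith
    · refine ⟨⟨?_, ?_, ?_⟩, fun h => ?_⟩
      · simp
      · simpa using h1
      · simp; linarith
      · simpa using h.1

/-- The corners of the five pieces of the dissection of the reference triangle that are
right-angled. -/
def childBase : Fin 5 → ℂ := ![2 + I, 5 * I, 2 + 6 * I, 4 + 2 * I, 4 + 2 * I]

/-- The directions of the pieces of the dissection. -/
def childUnit : Fin 5 → ℂ := ![-1, 1, -1, -1, -I]

/-- The map that takes the reference triangle to a piece of its dissection. -/
def child (j : Fin 5) (w : ℂ) : ℂ :=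
  (2 + I) * childUnit j / 5 * starRingEnd ℂ w + childBase j

lemma childUnit_ne_zero (j : Fin 5) : childUnit j ≠ 0 := by
  fin_cases j <;> simp [childUnit]

lemma two_add_I_ne_zero : (2 + I : ℂ) ≠ 0 := fun h => by simpa using congrArg re h

lemma isAff_child (j : Fin 5) : IsAff (child j) :=
  isAff_mul_conj_add
    (div_ne_zero (mul_ne_zero two_add_I_ne_zero (childUnit_ne_zero j)) (by norm_num)) _

lemma std_pt (x y : ℝ) : std.pt x y = x + y * I := by
  apply Complex.ext <;> simp [pt, std]

/-- All five pieces reverse the orientation and share the slope of 2 + i up to quarter turns. This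
common shape is what lets alignment survive a substitution step. -/
lemma dissect_std : std.dissect = range (fun j => std.map (child j)) := by
  have h : std.dissect = {std.map (child 0), std.map (child 1), std.map (child 2),
      std.map (child 3), std.map (child 4)} := by
    simp only [dissect, std_pt]
    congr 1
    · ext : 1 <;> apply Complex.ext <;> simp [map, std, child, childBase, childUnit] <;> norm_num
    congr 1
    · ext : 1 <;> apply Complex.ext <;> simp [map, std, child, childBase, childUnit] <;> norm_num
    congr 1
    · ext : 1 <;> apply Complex.ext <;> simp [map, std, child, childBase, childUnit] <;> norm_num
    congr 1
    · ext : 1 <;> apply Complex.ext <;> simp [map, std, child, childBase, childUnit] <;> norm_num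
    congr 1
    · ext : 1 <;> apply Complex.ext <;> simp [map, std, child, childBase, childUnit] <;> norm_num
  rw [h]
  ext t
  simp [Fin.exists_fin_succ, eq_comm]

lemma dissect_map_std {f : ℂ → ℂ} (hf : IsAff f) :
    (std.map f).dissect = range (fun j => std.map (fun w => f (child j w))) := by
  rw [dissect_map hf, dissect_std, ← range_comp]
  rfl

end Tri

namespace Tri

lemma child_mem (j : Fin 5) {w : ℂ} (hw : w ∈ std.carrier) : child j w ∈ std.carrier := by
  rw [carrier_std] at hw ⊢
  obtain ⟨h1, h2, h3⟩ := hw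
  fin_cases j <;> simp [child, childUnit, childBase] <;> refine ⟨?_, ?_, ?_⟩ <;> linarith

lemma child_ne {j k : Fin 5} (hjk : j ≠ k) {w w' : ℂ} (hw : w ∈ interior std.carrier)
    (hw' : w' ∈ interior std.carrier) : child j w ≠ child k w' := by
  rw [interior_carrier_std] at hw hw'
  obtain ⟨h1, h2, h3⟩ := hw
  obtain ⟨h4, h5, h6⟩ := hw'
  intro h
  have hr := congrArg re h
  have hi := congrArg im h
  fin_cases j <;> fin_cases k <;> first | exact hjk rfl | skip
  all_goals
    simp [child, childUnit, childBase] at hr hi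
    linarith

lemma exists_child_eq {z : ℂ} (hz : z ∈ std.carrier) : ∃ j, ∃ w ∈ std.carrier, child j w = z := by
  rw [carrier_std] at hz ⊢
  obtain ⟨h1, h2, h3⟩ := hz
  obtain ⟨x, y⟩ := z
  simp only at h1 h2 h3
  -- The lines 2y = x, x = 2, 2x + y = 5 and 2y = x + 10 separate the pieces; each witness is the
  -- preimage of the point under the corresponding `child`.
  by_cases hE : 2 * y ≤ x
  · refine ⟨4, ⟨x - 2 * y, 10 - 2 * x - y⟩, ⟨?_, ?_, ?_⟩, ?_⟩ <;> try (simp only; linarith)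
    apply Complex.ext <;> simp [child, childUnit, childBase] <;> ring
  by_cases hD : 2 ≤ x
  · refine ⟨3, ⟨10 - 2 * x - y, 2 * y - x⟩, ⟨?_, ?_, ?_⟩, ?_⟩ <;> try (simp only; linarith)
    apply Complex.ext <;> simp [child, childUnit, childBase] <;> ring
  by_cases hA : y ≤ 5 - 2 * x
  · refine ⟨0, ⟨5 - 2 * x - y, 2 * y - x⟩, ⟨?_, ?_, ?_⟩, ?_⟩ <;> try (simp only; linarith)
    apply Complex.ext <;> simp [child, childUnit, childBase] <;> ring
  by_cases hB : 2 * y ≤ 10 + x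
  · refine ⟨1, ⟨2 * x + y - 5, x + 10 - 2 * y⟩, ⟨?_, ?_, ?_⟩, ?_⟩ <;> try (simp only; linarith)
    apply Complex.ext <;> simp [child, childUnit, childBase] <;> ring
  · refine ⟨2, ⟨10 - 2 * x - y, 2 * y - 10 - x⟩, ⟨?_, ?_, ?_⟩, ?_⟩ <;> try (simp only; linarith)
    apply Complex.ext <;> simp [child, childUnit, childBase] <;> ring

/-- A triangle with three corners in general position. -/
def Nondeg (t : Tri) : Prop := ∃ f, IsAff f ∧ t = std.map f

lemma Nondeg.map {f : ℂ → ℂ} (hf : IsAff f) {t : Tri} (ht : t.Nondeg) : (t.map f).Nondeg := by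
  obtain ⟨g, hg, rfl⟩ := ht
  exact ⟨_, hf.comp hg, rfl⟩

lemma Nondeg.dissect {t s : Tri} (ht : t.Nondeg) (hs : s ∈ t.dissect) : s.Nondeg := by
  obtain ⟨g, hg, rfl⟩ := ht
  rw [dissect_map_std hg] at hs
  obtain ⟨j, rfl⟩ := hs
  exact ⟨_, hg.comp (isAff_child j), rfl⟩

lemma Nondeg.interior_nonempty {t : Tri} (ht : t.Nondeg) : (interior t.carrier).Nonempty := by
  obtain ⟨g, hg, rfl⟩ := ht
  rw [carrier_map hg, hg.image_interior, interior_carrier_std]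
  exact ⟨_, 1 + I, by norm_num, rfl⟩

lemma isCompact_carrier (t : Tri) : IsCompact t.carrier := by
  have h : t.corners.Finite := by simp [corners]
  exact h.isCompact_convexHull ℝ

lemma Nondeg.closure_interior {t : Tri} (ht : t.Nondeg) :
    t.carrier = closure (interior t.carrier) := by
  have h : Convex ℝ t.carrier := convex_convexHull ℝ t.corners
  rw [h.closure_interior_eq_closure_of_nonempty_interior ht.interior_nonempty,
    t.isCompact_carrier.isClosed.closure_eq]

lemma Nondeg.carrier_subset {t s : Tri} (ht : t.Nondeg) (hs : s ∈ t.dissect) :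
    s.carrier ⊆ t.carrier := by
  obtain ⟨g, hg, rfl⟩ := ht
  rw [dissect_map_std hg] at hs
  obtain ⟨j, rfl⟩ := hs
  rw [carrier_map (hg.comp (isAff_child j)), carrier_map hg]
  rintro _ ⟨w, hw, rfl⟩
  exact ⟨_, child_mem j hw, rfl⟩

lemma Nondeg.exists_mem_dissect {t : Tri} (ht : t.Nondeg) {z : ℂ} (hz : z ∈ t.carrier) :
    ∃ s ∈ t.dissect, z ∈ s.carrier := by
  obtain ⟨g, hg, rfl⟩ := ht
  rw [carrier_map hg] at hz
  obtain ⟨z, hz, rfl⟩ := hz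
  obtain ⟨j, w, hw, rfl⟩ := exists_child_eq hz
  rw [dissect_map_std hg]
  refine ⟨_, ⟨j, rfl⟩, ?_⟩
  rw [carrier_map (hg.comp (isAff_child j))]
  exact ⟨w, hw, rfl⟩

end Tri

/-! ### Packings and supertiles -/

/-- The triangles of a set have pairwise disjoint interiors. -/
def IsPacking (A : Set Tri) : Prop :=
  ∀ t ∈ A, ∀ t' ∈ A, t ≠ t' → Disjoint (interior t.carrier) (interior t'.carrier)

lemma Tri.Nondeg.isPacking_dissect {t : Tri} (ht : t.Nondeg) : IsPacking t.dissect := by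
  obtain ⟨g, hg, rfl⟩ := ht
  rw [dissect_map_std hg]
  rintro _ ⟨j, rfl⟩ _ ⟨k, rfl⟩ hne
  have hjk : j ≠ k := fun h => hne (by rw [h])
  rw [carrier_map (hg.comp (isAff_child j)), carrier_map (hg.comp (isAff_child k)),
    (hg.comp (isAff_child j)).image_interior, (hg.comp (isAff_child k)).image_interior,
    disjoint_left]
  rintro _ ⟨w, hw, rfl⟩ ⟨w', hw', h⟩
  exact child_ne hjk hw hw' (hg.injective h).symm

lemma IsPacking.map {A : Set Tri} (hA : IsPacking A) {f : ℂ → ℂ} (hf : IsAff f) :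
    IsPacking (Tri.map f '' A) := by
  rintro _ ⟨t, ht, rfl⟩ _ ⟨s, hs, rfl⟩ hne
  rw [Tri.carrier_map hf, Tri.carrier_map hf, hf.image_interior, hf.image_interior,
    disjoint_image_iff hf.injective]
  exact hA t ht s hs fun h => hne (by rw [h])

lemma IsPacking.dissect {A : Set Tri} (hA : IsPacking A) (hn : ∀ t ∈ A, t.Nondeg) :
    IsPacking (⋃ t ∈ A, t.dissect) := by
  intro s hs s' hs' hne
  simp only [mem_iUnion, exists_prop] at hs hs'
  obtain ⟨t, ht, hst⟩ := hs
  obtain ⟨t', ht', hst'⟩ := hs'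
  by_cases h : t = t'
  · subst h
    exact (hn t ht).isPacking_dissect s hst s' hst' hne
  · exact (hA t ht t' ht' h).mono (interior_mono ((hn t ht).carrier_subset hst))
      (interior_mono ((hn t' ht').carrier_subset hst'))

lemma sqrt_five_ne_zero : (Real.sqrt 5 : ℂ) ≠ 0 := by
  exact_mod_cast (Real.sqrt_pos.2 (by norm_num : (0 : ℝ) < 5)).ne'

lemma sqrt_five_mul_self : (Real.sqrt 5 : ℂ) * Real.sqrt 5 = 5 := by
  exact_mod_cast Real.mul_self_sqrt (by norm_num : (0 : ℝ) ≤ 5)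

lemma isAff_inflate : IsAff (fun z => (Real.sqrt 5 : ℂ) * z) := isAff_mul sqrt_five_ne_zero

lemma supertile_succ (n : ℕ) :
    supertile (n + 1) = ⋃ t ∈ Tri.inflate '' supertile n, t.dissect := by
  rw [biUnion_image, supertile]

lemma nondeg_supertile (n : ℕ) : ∀ t ∈ supertile n, t.Nondeg := by
  induction n with
  | zero =>
    rintro t rfl
    refine ⟨fun z => 5⁻¹ * z, isAff_mul (by norm_num), ?_⟩
    ext : 1 <;> simp [Tri.map, Tri.std, prototile]
    ring
  | succ n ih =>
    rw [supertile_succ]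
    intro s hs
    simp only [mem_iUnion, exists_prop] at hs
    obtain ⟨_, ⟨t, ht, rfl⟩, hs⟩ := hs
    exact ((ih t ht).map isAff_inflate).dissect hs

lemma isPacking_inflate_supertile_of {n : ℕ} (h : IsPacking (supertile n)) :
    IsPacking (Tri.inflate '' supertile n) :=
  h.map isAff_inflate

lemma nondeg_inflate_supertile (n : ℕ) : ∀ t ∈ Tri.inflate '' supertile n, t.Nondeg := by
  rintro _ ⟨t, ht, rfl⟩
  exact (nondeg_supertile n t ht).map isAff_inflate

lemma isPacking_supertile (n : ℕ) : IsPacking (supertile n) := by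
  induction n with
  | zero =>
    rintro t rfl s rfl h
    exact absurd rfl h
  | succ n ih =>
    rw [supertile_succ]
    exact (isPacking_inflate_supertile_of ih).dissect (nondeg_inflate_supertile n)

/-! ### Alignment of the tiles of a supertile -/

/-- The isometry `z ↦ a z + b`. -/
def rigid (a b : ℂ) (ha : ‖a‖ = 1) : ℂ ≃ᵢ ℂ :=
  (rotation ⟨a, mem_sphere_zero_iff_norm.2 ha⟩).toIsometryEquiv.trans (IsometryEquiv.addRight b)

@[simp] lemma rigid_apply (a b : ℂ) (ha : ‖a‖ = 1) (z : ℂ) : rigid a b ha z = a * z + b := rfl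

/-- The Gaussian integers. -/
def gauss : Subring ℂ := GaussianInt.toComplex.range

lemma mem_gauss {z : ℂ} : z ∈ gauss ↔ ∃ a b : ℤ, z = a + b * I := by
  constructor
  · rintro ⟨w, rfl⟩
    exact ⟨w.re, w.im, GaussianInt.toComplex_def w⟩
  · rintro ⟨a, b, rfl⟩
    exact ⟨⟨a, b⟩, GaussianInt.toComplex_def _⟩

lemma conj_mem_gauss {z : ℂ} (hz : z ∈ gauss) : starRingEnd ℂ z ∈ gauss := by
  rw [mem_gauss] at hz ⊢
  obtain ⟨a, b, rfl⟩ := hz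
  exact ⟨a, -b, by simp⟩

/-- The four Gaussian units. -/
def quarterTurns : Set ℂ := {1, I, -1, -I}

section quarterTurns

variable {u v : ℂ}

lemma mul_mem_quarterTurns (hu : u ∈ quarterTurns) (hv : v ∈ quarterTurns) :
    u * v ∈ quarterTurns := by
  rcases hu with rfl | rfl | rfl | rfl <;> rcases hv with rfl | rfl | rfl | rfl <;>
    simp [quarterTurns]

lemma conj_mem_quarterTurns (hu : u ∈ quarterTurns) : starRingEnd ℂ u ∈ quarterTurns := by
  rcases hu with rfl | rfl | rfl | rfl <;> simp [quarterTurns]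

lemma conj_mul_quarterTurns (hu : u ∈ quarterTurns) : u * starRingEnd ℂ u = 1 := by
  rcases hu with rfl | rfl | rfl | rfl <;> simp

lemma mem_gauss_of_mem_quarterTurns (hu : u ∈ quarterTurns) : u ∈ gauss := by
  rw [mem_gauss]
  rcases hu with rfl | rfl | rfl | rfl
  · exact ⟨1, 0, by simp⟩
  · exact ⟨0, 1, by simp⟩
  · exact ⟨-1, 0, by simp⟩
  · exact ⟨0, -1, by simp⟩

lemma norm_quarterTurns (hu : u ∈ quarterTurns) : ‖u‖ = 1 := by
  rcases hu with rfl | rfl | rfl | rfl <;> simp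

end quarterTurns

namespace Tri

lemma childUnit_mem (j : Fin 5) : childUnit j ∈ quarterTurns := by
  fin_cases j <;> simp [childUnit, quarterTurns]

/-- Divisibility by 2 + i is the reason why the corners of the pieces are again lattice points after
the lattice is turned by the argument of 2 + i and refined by √5. -/
lemma exists_childBase_eq (j : Fin 5) : ∃ m ∈ gauss, childBase j = (2 + I) * m := by
  simp only [mem_gauss]
  fin_cases j
  · exact ⟨_, ⟨1, 0, rfl⟩, by simp [childBase]⟩
  · exact ⟨_, ⟨1, 2, rfl⟩, by apply Complex.ext <;> simp [childBase]; norm_num⟩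
  · exact ⟨_, ⟨2, 2, rfl⟩, by apply Complex.ext <;> simp [childBase] <;> norm_num⟩
  · exact ⟨_, ⟨2, 0, rfl⟩, by apply Complex.ext <;> simp [childBase] <;> norm_num⟩
  · exact ⟨_, ⟨2, 0, rfl⟩, by apply Complex.ext <;> simp [childBase] <;> norm_num⟩

end Tri

/-- Scaling the range and the domain of an isometry gives an isometry. -/
lemma exists_isometryEquiv_scale (g : ℂ ≃ᵢ ℂ) :
    ∃ g' : ℂ ≃ᵢ ℂ, ∀ x, (Real.sqrt 5 : ℂ) * g x = g' (Real.sqrt 5 * x) := by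
  refine ⟨g.toRealLinearIsometryEquiv.toIsometryEquiv.trans
    (IsometryEquiv.addRight (Real.sqrt 5 * g 0)), fun x => ?_⟩
  have h : (Real.sqrt 5 : ℂ) * x = Real.sqrt 5 • x := by simp
  simp only [IsometryEquiv.trans_apply, LinearIsometryEquiv.coe_toIsometryEquiv,
    IsometryEquiv.addRight_apply]
  rw [h, map_smul, g.toRealLinearIsometryEquiv_apply]
  simp
  ring

/-- Inflation turns the mesh 1 of the tiles into the mesh √5 = 5 / √5, and the factor can be moved
through the isometry. -/
lemma aligned_inflate_of {n : ℕ} (h : ∃ g : ℂ ≃ᵢ ℂ, ∀ t ∈ supertile n,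
    ∃ z ∈ gauss, ∃ u ∈ quarterTurns, t = Tri.std.map (fun w => g ((5 * z + u * w) / 5))) :
    ∃ g : ℂ ≃ᵢ ℂ, ∀ t ∈ Tri.inflate '' supertile n, ∃ z ∈ gauss, ∃ u ∈ quarterTurns,
      t = Tri.std.map (fun w => g ((5 * z + u * w) / Real.sqrt 5)) := by
  obtain ⟨g, hg⟩ := h
  obtain ⟨g', hg'⟩ := exists_isometryEquiv_scale g
  refine ⟨g', ?_⟩
  rintro _ ⟨t, ht, rfl⟩
  obtain ⟨z, hz, u, hu, rfl⟩ := hg t ht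
  refine ⟨z, hz, u, hu, ?_⟩
  rw [Tri.inflate, Tri.map_map]
  congr 1
  ext w
  rw [hg']
  congr 1
  field_simp [sqrt_five_ne_zero]
  rw [← sqrt_five_mul_self]
  ring

/-- Induction on the level. Since 5 = (2 + i)(2 - i), both the lattice 5ℤ[i] of the parents and the
bases of the children are multiples of 2 + i; that factor, divided by √5, and the conjugation are
absorbed into the frame. -/
lemma aligned_supertile (n : ℕ) : ∃ g : ℂ ≃ᵢ ℂ, ∀ t ∈ supertile n,
    ∃ z ∈ gauss, ∃ u ∈ quarterTurns, t = Tri.std.map (fun w => g ((5 * z + u * w) / 5)) := by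
  induction n with
  | zero =>
    refine ⟨rigid 1 0 (by simp), ?_⟩
    rintro t rfl
    refine ⟨0, zero_mem _, 1, by simp [quarterTurns], ?_⟩
    ext : 1
    · simp [Tri.map, Tri.std, prototile]
    · simp [Tri.map, Tri.std, prototile]
    · simp only [Tri.map, Tri.std, prototile, rigid_apply]
      ring
  | succ n ih =>
    obtain ⟨g, hg⟩ := aligned_inflate_of ih
    have hnorm : ‖(2 + I) / (Real.sqrt 5 : ℂ)‖ = 1 := by
      rw [norm_div, norm_real, Real.norm_of_nonneg (Real.sqrt_nonneg 5)]
      have : ‖(2 + I : ℂ)‖ = Real.sqrt 5 := by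
        rw [Complex.norm_def]
        congr 1
        simp [Complex.normSq_apply]
        norm_num
      rw [this, div_self (Real.sqrt_pos.2 (by norm_num)).ne']
    -- One frame serves all children of all parents: the old one preceded by conjugation and the
    -- rotation by (2 + i) / √5.
    refine ⟨(conjLIE.toIsometryEquiv.trans (rigid _ 0 hnorm)).trans g, ?_⟩
    rw [supertile_succ]
    intro s hs
    simp only [mem_iUnion, exists_prop] at hs
    obtain ⟨t, ht, hs⟩ := hs
    have hn := nondeg_inflate_supertile n t ht
    obtain ⟨z, hz, u, hu, rfl⟩ := hg t ht
    have hu0 : u ≠ 0 := fun h => by simpa [h] using norm_quarterTurns hu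
    have haff : IsAff (fun w => g ((5 * z + u * w) / Real.sqrt 5)) := by
      have := (IsAff.isometryEquiv g).comp
        (isAff_mul_add (div_ne_zero hu0 sqrt_five_ne_zero) (5 * z / Real.sqrt 5))
      convert this using 3
      ring
    rw [Tri.dissect_map_std haff] at hs
    obtain ⟨j, rfl⟩ := hs
    obtain ⟨m, hm, hjm⟩ := Tri.exists_childBase_eq j
    -- The quotient of 5z + u (2 + i) m by 2 + i, conjugated because the new frame conjugates first.
    refine ⟨starRingEnd ℂ ((2 - I) * z + u * m), ?_, starRingEnd ℂ (u * Tri.childUnit j),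
      conj_mem_quarterTurns (mul_mem_quarterTurns hu (Tri.childUnit_mem j)), ?_⟩
    · refine conj_mem_gauss (add_mem (mul_mem ?_ hz)
        (mul_mem (mem_gauss_of_mem_quarterTurns hu) hm))
      exact mem_gauss.2 ⟨2, -1, by simp [sub_eq_add_neg]⟩
    · change Tri.std.map _ = _
      congr 1
      funext w
      simp only [IsometryEquiv.trans_apply, rigid_apply, LinearIsometryEquiv.coe_toIsometryEquiv,
        conjLIE_apply, map_div₀, map_add, map_mul, conj_conj, Tri.child, hjm]
      congr 1
      have h5 : (5 : ℂ) = (2 + I) * (2 - I) := by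
        ring_nf
        simp
        norm_num
      have h5' : starRingEnd ℂ (5 : ℂ) = 5 := map_ofNat _ 5
      rw [h5']
      field_simp [sqrt_five_ne_zero]
      linear_combination 5 * z * h5

lemma aligned_inflate_supertile (n : ℕ) :
    ∃ g : ℂ ≃ᵢ ℂ, ∀ t ∈ Tri.inflate '' supertile n, ∃ z ∈ gauss, ∃ u ∈ quarterTurns,
      t = Tri.std.map (fun w => g ((5 * z + u * w) / Real.sqrt 5)) :=
  aligned_inflate_of (aligned_supertile n)

/-! ### Composition of tiles into triangles of the next level -/

/-- The triangles of a set cover the plane. -/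
def IsCovering (A : Set Tri) : Prop := ∀ z : ℂ, ∃ t ∈ A, z ∈ t.carrier

/-- Two triangles of legs `√5` and `2√5` belong to a common square lattice. -/
def Aligned (s t : Tri) : Prop :=
  ∃ h : ℂ ≃ᵢ ℂ, ∃ z ∈ gauss, ∃ u ∈ quarterTurns, ∃ z' ∈ gauss, ∃ u' ∈ quarterTurns,
    s = Tri.std.map (fun w => h ((5 * z + u * w) / Real.sqrt 5)) ∧
    t = Tri.std.map (fun w => h ((5 * z' + u' * w) / Real.sqrt 5))

lemma IsAff.apply_eq_pt {f : ℂ → ℂ} (hf : IsAff f) (z : ℂ) :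
    f z = (Tri.std.map f).pt z.re z.im := by
  rw [hf.map_pt, Tri.std_pt, re_add_im]

/-- An affine map is determined by the images of three points in general position; the corners are
labelled, so no symmetry is left over. -/
lemma IsAff.eq_of_map_eq {f g : ℂ → ℂ} (hf : IsAff f) (hg : IsAff g)
    (h : Tri.std.map f = Tri.std.map g) : f = g := by
  ext z
  rw [hf.apply_eq_pt, hg.apply_eq_pt, h]

lemma Tri.map_symm_map (f : ℂ ≃ᵢ ℂ) (t : Tri) : (t.map f).map f.symm = t := by
  simp [Tri.map]

lemma IsTiling.isCovering {T : Set Tri} (hT : IsTiling T) : IsCovering T := by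
  intro z
  have := hT.cover.symm ▸ mem_univ z
  simpa using this

/-- A single compact triangle cannot cover the plane. Two different tiles rule out the supertile of
level 0, so that parents exist. -/
lemma IsTiling.nontrivial {T : Set Tri} (hT : IsTiling T) : T.Nontrivial := by
  by_contra h
  rw [not_nontrivial_iff] at h
  obtain ⟨t, ht, -⟩ := hT.isCovering 0
  have h1 : t.carrier = univ := by
    refine eq_univ_of_forall fun z => ?_
    obtain ⟨s, hs, hz⟩ := hT.isCovering z
    rwa [h hs ht] at hz
  exact noncompact_univ ℂ (h1 ▸ t.isCompact_carrier)

lemma Tri.Nondeg.nonempty_inter {s : Tri} (hs : s.Nondeg) {U : Set ℂ}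
    (hU : IsOpen U) {z : ℂ} (hzU : z ∈ U) (hz : z ∈ s.carrier) :
    (U ∩ interior s.carrier).Nonempty := by
  rw [hs.closure_interior] at hz
  exact mem_closure_iff.1 hz U hU hzU

/-- The tiles of a tiling can be grouped into aligned triangles of the next level. -/
theorem IsTiling.exists_composition {T : Set Tri} (hT : IsTiling T) :
    ∃ S : Set Tri, IsPacking S ∧ IsCovering S ∧ (∀ s ∈ S, ∀ t ∈ S, Aligned s t) ∧
      T = ⋃ s ∈ S, s.dissect := by
  classical
  let N := Finset T
  have hleg (F : N) := hT.legal (Subtype.val '' (F : Set T)) (by simp)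
    ((F.finite_toSet).image _)
  choose n f hf using hleg
  -- The levels and isometries chosen for different patches are unrelated. The ultrafilter replaces
  -- a compactness argument: it turns "some choice for each patch" into one choice that is right for
  -- almost all patches.
  let 𝒰 : Ultrafilter N := Ultrafilter.of Filter.atTop
  have hat {p : N → Prop} (h : ∀ᶠ F in Filter.atTop, p F) : ∀ᶠ F in (𝒰 : Filter N), p F :=
    Ultrafilter.of_le _ h
  have hmem {t : Tri} (ht : t ∈ T) :
      ∀ᶠ F in (𝒰 : Filter N), t.map (f F) ∈ supertile (n F) := by
    refine hat ?_
    filter_upwards [Filter.eventually_ge_atTop ({⟨t, ht⟩} : N)] with F hF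
    exact hf F ⟨t, ⟨⟨t, ht⟩, Finset.singleton_subset_iff.1 hF, rfl⟩, rfl⟩
  have hpos : ∀ᶠ F in (𝒰 : Filter N), ∃ m, n F = m + 1 := by
    obtain ⟨t, ht, s, hs, hne⟩ := hT.nontrivial
    filter_upwards [hmem ht, hmem hs] with F h1 h2
    rcases h : n F with _ | m
    · rw [h] at h1 h2
      exact absurd (Tri.map_injective (f F).injective (h1.trans h2.symm)) hne
    · exact ⟨m, rfl⟩
  -- Membership is the limit along the ultrafilter of being a parent. Two members are therefore
  -- parents in a common supertile for some patch, which transfers packing and alignment from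
  -- supertiles to this set.
  let S : Set Tri := {s | ∀ᶠ F in (𝒰 : Filter N),
    ∃ m, n F = m + 1 ∧ s.map (f F) ∈ Tri.inflate '' supertile m}
  have hpair {s t : Tri} (hs : s ∈ S) (ht : t ∈ S) : ∃ (F : N) (m : ℕ),
      s.map (f F) ∈ Tri.inflate '' supertile m ∧ t.map (f F) ∈ Tri.inflate '' supertile m := by
    obtain ⟨F, ⟨m, h1, h2⟩, m', h3, h4⟩ := (hs.and ht).exists
    obtain rfl : m = m' := by omega
    exact ⟨F, m, h2, h4⟩
  have hndS {s : Tri} (hs : s ∈ S) : s.Nondeg := by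
    obtain ⟨F, m, h, -⟩ := hpair hs hs
    rw [← Tri.map_symm_map (f F) s]
    exact (nondeg_inflate_supertile m _ h).map (IsAff.isometryEquiv _)
  have hup {t : Tri} (ht : t ∈ T) : ∃ s ∈ S, t ∈ s.dissect := by
    have h1 : ∀ᶠ F in (𝒰 : Filter N), ∃ j : Fin 5, ∃ m, n F = m + 1 ∧ ∃ g, IsAff g ∧
        Tri.std.map g ∈ Tri.inflate '' supertile m ∧
        t.map (f F) = Tri.std.map (fun w => g (Tri.child j w)) := by
      filter_upwards [hmem ht, hpos] with F h1 ⟨m, hm⟩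
      rw [hm, supertile_succ] at h1
      simp only [mem_iUnion, exists_prop] at h1
      obtain ⟨s, hs, hts⟩ := h1
      obtain ⟨g, hg, rfl⟩ := nondeg_inflate_supertile m s hs
      rw [Tri.dissect_map_std hg] at hts
      obtain ⟨j, hj⟩ := hts
      exact ⟨j, m, hm, g, hg, hs, hj.symm⟩
    -- There are only five positions of a tile in its parent, so one of them occurs for almost all
    -- patches.
    rw [Ultrafilter.eventually_exists_iff] at h1
    obtain ⟨j, hj⟩ := h1
    obtain ⟨F₀, m₀, -, g₀, hg₀, -, ht₀⟩ := hj.exists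
    have haff₀ := (IsAff.isometryEquiv (f F₀).symm).comp hg₀
    have ht₁ : t = Tri.std.map (fun w => (f F₀).symm (g₀ (Tri.child j w))) := by
      rw [← Tri.map_symm_map (f F₀) t, ht₀]
      rfl
    refine ⟨Tri.std.map (fun w => (f F₀).symm (g₀ w)), ?_, ?_⟩
    · filter_upwards [hj] with F ⟨m, hm, g, hg, hgm, htF⟩
      refine ⟨m, hm, ?_⟩
      have haff := (IsAff.isometryEquiv (f F).symm).comp hg
      have ht₂ : t = Tri.std.map (fun w => (f F).symm (g (Tri.child j w))) := by
        rw [← Tri.map_symm_map (f F) t, htF]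
        rfl
      have heq := (haff₀.comp (Tri.isAff_child j)).eq_of_map_eq
        (haff.comp (Tri.isAff_child j)) (ht₁.symm.trans ht₂)
      -- A tile and its position j determine the parent, since `child j` is invertible. So the
      -- parent, pulled back to the tiling, does not depend on the patch.
      have heq' : (fun w => (f F₀).symm (g₀ w)) = fun w => (f F).symm (g w) := by
        ext w
        obtain ⟨w, rfl⟩ := (Tri.isAff_child j).bijective.2 w
        exact congrFun heq w
      rw [heq', Tri.map_map]
      simpa using hgm
    · rw [Tri.dissect_map_std haff₀]
      exact ⟨j, ht₁.symm⟩
  have hndT {t : Tri} (ht : t ∈ T) : t.Nondeg := by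
    obtain ⟨s, hs, hts⟩ := hup ht
    exact (hndS hs).dissect hts
  have hcov : IsCovering S := by
    intro z
    obtain ⟨t, ht, hz⟩ := hT.isCovering z
    obtain ⟨s, hs, hts⟩ := hup ht
    exact ⟨s, hs, (hndS hs).carrier_subset hts hz⟩
  refine ⟨S, ?_, hcov, ?_, ?_⟩
  · intro s hs t ht hne
    obtain ⟨F, m, h1, h2⟩ := hpair hs ht
    have := isPacking_inflate_supertile_of (isPacking_supertile m) _ h1 _ h2
      fun h => hne (Tri.map_injective (f F).injective h)
    rwa [Tri.carrier_map (IsAff.isometryEquiv _), Tri.carrier_map (IsAff.isometryEquiv _),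
      (IsAff.isometryEquiv (f F)).image_interior, (IsAff.isometryEquiv (f F)).image_interior,
      disjoint_image_iff (f F).injective] at this
  · intro s hs t ht
    obtain ⟨F, m, h1, h2⟩ := hpair hs ht
    obtain ⟨g, hg⟩ := aligned_inflate_supertile m
    obtain ⟨z, hz, u, hu, hs'⟩ := hg _ h1
    obtain ⟨z', hz', u', hu', ht'⟩ := hg _ h2
    refine ⟨g.trans (f F).symm, z, hz, u, hu, z', hz', u', hu', ?_, ?_⟩
    · rw [← Tri.map_symm_map (f F) s, hs']
      rfl
    · rw [← Tri.map_symm_map (f F) t, ht']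
      rfl
  · apply Subset.antisymm
    · intro t ht
      obtain ⟨s, hs, hts⟩ := hup ht
      exact mem_biUnion hs hts
    · intro c hc
      simp only [mem_iUnion, exists_prop] at hc
      obtain ⟨s, hs, hcs⟩ := hc
      have hndc := (hndS hs).dissect hcs
      -- A piece of a parent is a tile: the tile over an interior point of the piece lies with it in
      -- a common supertile, where overlapping tiles coincide.
      obtain ⟨z, hz⟩ := hndc.interior_nonempty
      obtain ⟨t, ht, hzt⟩ := hT.isCovering z
      obtain ⟨F, ⟨m, hm, h1⟩, h2⟩ := (Filter.Eventually.and hs (hmem ht)).exists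
      have hcF : c.map (f F) ∈ supertile (n F) := by
        rw [hm, supertile_succ]
        refine mem_biUnion h1 ?_
        rw [Tri.dissect_map (IsAff.isometryEquiv _)]
        exact mem_image_of_mem _ hcs
      by_cases hct : c = t
      · rwa [hct]
      · have := isPacking_supertile (n F) _ hcF _ h2
          fun h => hct (Tri.map_injective (f F).injective h)
        rw [Tri.carrier_map (IsAff.isometryEquiv _), Tri.carrier_map (IsAff.isometryEquiv _),
          (IsAff.isometryEquiv (f F)).image_interior, (IsAff.isometryEquiv (f F)).image_interior,
          disjoint_image_iff (f F).injective] at this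
        have hne := (hndT ht).nonempty_inter isOpen_interior hz hzt
        exact absurd this (not_disjoint_iff_nonempty_inter.2 hne)

/-! ### Common frames and matching hypotenuses -/

/-- Every triangle of an aligned set is the reference triangle of a common frame. -/
lemma exists_frame {S : Set Tri} (hS : ∀ s ∈ S, ∀ t ∈ S, Aligned s t) {s : Tri} (hs : s ∈ S) :
    ∃ h : ℂ ≃ᵢ ℂ, s = Tri.std.map (fun w => h (w / Real.sqrt 5)) ∧ ∀ t ∈ S,
      ∃ z ∈ gauss, ∃ u ∈ quarterTurns,
        t = Tri.std.map (fun w => h ((5 * z + u * w) / Real.sqrt 5)) := by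
  have haff (h : ℂ ≃ᵢ ℂ) : IsAff (fun w => h (w / Real.sqrt 5)) := by
    convert (IsAff.isometryEquiv h).comp (isAff_mul (inv_ne_zero sqrt_five_ne_zero)) using 3
    rw [div_eq_inv_mul]
  have key (t : Tri) (ht : t ∈ S) : ∃ h : ℂ ≃ᵢ ℂ,
      s = Tri.std.map (fun w => h (w / Real.sqrt 5)) ∧ ∃ z ∈ gauss, ∃ u ∈ quarterTurns,
        t = Tri.std.map (fun w => h ((5 * z + u * w) / Real.sqrt 5)) := by
    obtain ⟨h, z, hz, u, hu, z', hz', u', hu', hs', ht'⟩ := hS s hs t ht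
    -- The position of `s` is absorbed into the frame, and the position of `t` is expressed relative
    -- to it by dividing by the unit `u`, whose inverse is its conjugate.
    refine ⟨(rigid u (5 * z / Real.sqrt 5) (norm_quarterTurns hu)).trans h, ?_,
      starRingEnd ℂ u * (z' - z),
      mul_mem (mem_gauss_of_mem_quarterTurns (conj_mem_quarterTurns hu)) (sub_mem hz' hz),
      starRingEnd ℂ u * u', mul_mem_quarterTurns (conj_mem_quarterTurns hu) hu', ?_⟩
    · rw [hs']
      congr 1
      funext w
      simp only [IsometryEquiv.trans_apply, rigid_apply]
      congr 1
      ring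
    · rw [ht']
      congr 1
      funext w
      simp only [IsometryEquiv.trans_apply, rigid_apply]
      congr 1
      linear_combination (-(5 * (z' - z) + u' * w) / Real.sqrt 5) * conj_mul_quarterTurns hu
  obtain ⟨h, hs', -⟩ := key s hs
  refine ⟨h, hs', fun t ht => ?_⟩
  obtain ⟨h', hs'', z, hz, u, hu, ht'⟩ := key t ht
  refine ⟨z, hz, u, hu, ?_⟩
  -- A frame in which `s` is the reference triangle is unique, so the frames found for the different
  -- `t` agree.
  have heq := (haff h).eq_of_map_eq (haff h') (hs'.symm.trans hs'')
  rw [ht']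
  congr 1
  funext w
  exact (congrFun heq (5 * z + u * w)).symm

lemma isAff_frame (h : ℂ ≃ᵢ ℂ) {u : ℂ} (hu : u ∈ quarterTurns) (c : ℂ) :
    IsAff (fun w => h ((c + u * w) / Real.sqrt 5)) := by
  have hu0 : u ≠ 0 := fun h => by simpa [h] using norm_quarterTurns hu
  convert (IsAff.isometryEquiv h).comp (isAff_mul_add (div_ne_zero hu0 sqrt_five_ne_zero)
    (c / Real.sqrt 5)) using 3
  ring

lemma IsAff.mem_carrier_map {f : ℂ → ℂ} (hf : IsAff f) {t : Tri} {z : ℂ} :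
    f z ∈ (t.map f).carrier ↔ z ∈ t.carrier := by
  rw [Tri.carrier_map hf, hf.injective.mem_set_image]

lemma IsAff.mem_interior_carrier_map {f : ℂ → ℂ} (hf : IsAff f) {t : Tri} {z : ℂ} :
    f z ∈ interior (t.map f).carrier ↔ z ∈ interior t.carrier := by
  rw [Tri.carrier_map hf, hf.image_interior, hf.injective.mem_set_image]

lemma exists_frame_mem {h : ℂ ≃ᵢ ℂ} {z u : ℂ} (hu : u ∈ quarterTurns) {q : ℂ} :
    h (q / Real.sqrt 5) =
      (fun w => h ((5 * z + u * w) / Real.sqrt 5)) (starRingEnd ℂ u * (q - 5 * z)) := by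
  simp only
  congr 2
  linear_combination (-(q - 5 * z)) * conj_mul_quarterTurns hu

/-- In an aligned tiling the hypotenuses match. -/
lemma flip_mem {S : Set Tri} (hP : IsPacking S) (hC : IsCovering S)
    (hS : ∀ s ∈ S, ∀ t ∈ S, Aligned s t) {f : ℂ → ℂ} (hf : IsAff f) (hs : Tri.std.map f ∈ S) :
    Tri.std.map (fun w => f (5 + 10 * I - w)) ∈ S := by
  obtain ⟨h, hsh, hall⟩ := exists_frame hS hs
  have haff0 : IsAff (fun w => h (w / Real.sqrt 5)) := by
    convert isAff_frame h (by simp [quarterTurns] : (1 : ℂ) ∈ quarterTurns) 0 using 3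
    simp
  obtain rfl := hf.eq_of_map_eq haff0 hsh
  -- A point just beyond the hypotenuse: 2 · 23/5 + 11/10 = 10.3 exceeds 10.
  obtain ⟨t, ht, hq⟩ := hC (h ((⟨23 / 5, 11 / 10⟩ : ℂ) / Real.sqrt 5))
  obtain ⟨z, hz, u, hu, rfl⟩ := hall t ht
  have haff := isAff_frame h hu (5 * z)
  rw [exists_frame_mem hu, haff.mem_carrier_map, Tri.carrier_std] at hq
  -- The companion point 22/5 + (9/10) i is just inside the reference triangle, as 2 · 22/5 + 9/10 =
  -- 9.7. It cannot be interior to the triangle `t`, which would otherwise overlap the reference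
  -- triangle or equal it.
  have hint : starRingEnd ℂ u * ((⟨22 / 5, 9 / 10⟩ : ℂ) - 5 * z) ∉ interior Tri.std.carrier := by
    intro hint
    by_cases hst : Tri.std.map (fun w => h (w / Real.sqrt 5)) =
        Tri.std.map (fun w => h ((5 * z + u * w) / Real.sqrt 5))
    · have heq := haff0.eq_of_map_eq haff hst
      have h1 : h ((⟨23 / 5, 11 / 10⟩ : ℂ) / Real.sqrt 5) ∈
          (Tri.std.map (fun w => h (w / Real.sqrt 5))).carrier := by
        rw [hst, exists_frame_mem hu (z := z), haff.mem_carrier_map, Tri.carrier_std]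
        exact hq
      rw [haff0.mem_carrier_map (z := (⟨23 / 5, 11 / 10⟩ : ℂ)), Tri.carrier_std] at h1
      obtain ⟨-, -, h1⟩ := h1
      norm_num at h1
    · refine disjoint_left.1 (hP _ hs _ ht hst)
        ((haff0.mem_interior_carrier_map (z := (⟨22 / 5, 9 / 10⟩ : ℂ))).2 ?_) ?_
      · rw [Tri.interior_carrier_std]
        norm_num
      · rw [exists_frame_mem hu (z := z), haff.mem_interior_carrier_map]
        exact hint
  rw [Tri.interior_carrier_std] at hint
  obtain ⟨a, b, rfl⟩ := mem_gauss.1 hz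
  obtain ⟨h1, h2, h3⟩ := hq
  -- The integrality of the corner leaves finitely many triangles over the outer point. The units 1
  -- and -i allow none, i only one that contains the companion point in its interior, and -1 only
  -- the half-turn with corner 5(1 + 2i).
  rcases hu with rfl | rfl | rfl | rfl <;> simp at h1 h2 h3 hint
  · have ha : a < 1 := by
      have : (a : ℝ) < 1 := by linarith
      exact_mod_cast this
    have hb : b < 1 := by
      have : (b : ℝ) < 1 := by linarith
      exact_mod_cast this
    have hab : 0 < 2 * a + b := by
      have : (0 : ℝ) < 2 * a + b := by linarith
      exact_mod_cast this
    omega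
  · have ha : 0 < a := by
      have : (0 : ℝ) < a := by linarith
      exact_mod_cast this
    have hb : b < 1 := by
      have : (b : ℝ) < 1 := by linarith
      exact_mod_cast this
    have hab : a - 2 * b < 3 := by
      have : (a : ℝ) - 2 * b < 3 := by linarith
      exact_mod_cast this
    have ha' : (1 : ℝ) ≤ a := by exact_mod_cast ha
    have hb' : (b : ℝ) ≤ 0 := by exact_mod_cast Int.lt_add_one_iff.1 hb
    have hab' : (a : ℝ) - 2 * b ≤ 2 := by exact_mod_cast Int.lt_add_one_iff.1 hab
    have := hint (by linarith) (by linarith)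
    linarith
  · have ha : 0 < a := by
      have : (0 : ℝ) < a := by linarith
      exact_mod_cast this
    have hb : 0 < b := by
      have : (0 : ℝ) < b := by linarith
      exact_mod_cast this
    have hab : 2 * a + b < 5 := by
      have : 2 * (a : ℝ) + b < 5 := by linarith
      exact_mod_cast this
    have ha' : (1 : ℝ) ≤ a := by exact_mod_cast ha
    have hb' : (1 : ℝ) ≤ b := by exact_mod_cast hb
    have hab' : 4 ≤ 2 * a + b := by
      have := hint (by linarith) (by linarith)
      have : 3 < 2 * (a : ℝ) + b := by linarith
      have : 3 < 2 * a + b := by exact_mod_cast this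
      omega
    obtain rfl : a = 1 := by omega
    obtain rfl : b = 2 := by omega
    convert ht using 5
    push_cast
    ring
  · have ha : a < 1 := by
      have : (a : ℝ) < 1 := by linarith
      exact_mod_cast this
    have hb : 0 < b := by
      have : (0 : ℝ) < b := by linarith
      exact_mod_cast this
    have hab : 2 * b - a < 2 := by
      have : 2 * (b : ℝ) - a < 2 := by linarith
      exact_mod_cast this
    omega

/-! ### Domino tilings of the square grid -/

/-- A domino in the square grid: the coordinates of the lower left corner and the direction. -/
@[ext] structure Domino where
  x : ℤ
  y : ℤ
  horizontal : Bool

namespace Domino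

/-- The number of unit squares in a row of the domino. -/
def width (d : Domino) : ℤ := bif d.horizontal then 2 else 1

/-- The number of unit squares in a column of the domino. -/
def height (d : Domino) : ℤ := bif d.horizontal then 1 else 2

/-- The unit square with lower left corner `(x, y)` belongs to the domino. -/
def Covers (d : Domino) (x y : ℤ) : Prop :=
  d.x ≤ x ∧ x < d.x + d.width ∧ d.y ≤ y ∧ y < d.y + d.height

/-- The direction of the short side of the model rectangle in the position of the domino. -/
def dir (d : Domino) : ℂ := bif d.horizontal then I else 1

/-- The origin of the model rectangle in the position of the domino. -/
def origin (d : Domino) : ℂ := 5 * (d.x + d.y * I) + bif d.horizontal then 10 else 0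

lemma dir_mem (d : Domino) : d.dir ∈ quarterTurns := by
  cases h : d.horizontal <;> simp [dir, h, quarterTurns]

/-- The placement of the model rectangle on a domino of the grid with frame `h`. -/
def place (h : ℂ ≃ᵢ ℂ) (d : Domino) : ℂ ≃ᵢ ℂ :=
  (rigid d.dir (d.origin / Real.sqrt 5) (norm_quarterTurns d.dir_mem)).trans h

/-- The affine map from the model rectangle in units `1 / √5` to the plane. -/
def frame (h : ℂ ≃ᵢ ℂ) (d : Domino) (w : ℂ) : ℂ := h ((d.origin + d.dir * w) / Real.sqrt 5)

lemma isAff_frame (h : ℂ ≃ᵢ ℂ) (d : Domino) : IsAff (d.frame h) :=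
  NonPinwheel.isAff_frame h d.dir_mem _

lemma place_div (h : ℂ ≃ᵢ ℂ) (d : Domino) (w : ℂ) :
    d.place h (w / Real.sqrt 5) = d.frame h w := by
  simp only [place, frame, IsometryEquiv.trans_apply, rigid_apply]
  congr 1
  ring

end Domino

/-- The half-turn of the model rectangle, in units `1 / √5`. -/
def halfTurn (w : ℂ) : ℂ := 5 + 10 * I - w

lemma isAff_halfTurn : IsAff halfTurn := by
  convert isAff_mul_add (neg_ne_zero.2 (one_ne_zero' ℂ)) (5 + 10 * I) using 1
  ext z
  simp [halfTurn]
  ring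

lemma rectangle_eq : rectangle = (Tri.std.map (fun w => w / Real.sqrt 5)).dissect ∪
    (Tri.std.map (fun w => halfTurn w / Real.sqrt 5)).dissect := by
  simp only [rectangle, Tri.map, Tri.std, node, halfTurn]
  norm_num

lemma isAff_div : IsAff (fun w => w / Real.sqrt 5) := by
  convert isAff_mul (inv_ne_zero sqrt_five_ne_zero) using 2
  rw [div_eq_inv_mul]

lemma placed_eq (φ : ℂ ≃ᵢ ℂ) : placed φ = (Tri.std.map (fun w => φ (w / Real.sqrt 5))).dissect ∪
    (Tri.std.map (fun w => φ (halfTurn w / Real.sqrt 5))).dissect := by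
  rw [placed, rectangle_eq, image_union, ← Tri.dissect_map (IsAff.isometryEquiv φ),
    ← Tri.dissect_map (IsAff.isometryEquiv φ)]
  rfl

lemma Domino.placed_place (h : ℂ ≃ᵢ ℂ) (d : Domino) : placed (d.place h) =
    (Tri.std.map (d.frame h)).dissect ∪
      (Tri.std.map (fun w => d.frame h (halfTurn w))).dissect := by
  rw [placed_eq]
  simp only [Domino.place_div]

/-- A set of dominoes that covers each unit square of the grid exactly once. -/
def IsDominoTiling (𝓓 : Set Domino) : Prop := ∀ x y : ℤ, ∃! d, d ∈ 𝓓 ∧ d.Covers x y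

/-- The point of the unit square `(x, y)` used to recognize the domino that covers it. -/
lemma Domino.mem_interior_of_covers {d : Domino} {x y : ℤ} (hd : d.Covers x y) :
    ∃ w : ℂ, (w ∈ interior Tri.std.carrier ∨ halfTurn w ∈ interior Tri.std.carrier) ∧
      ∀ h : ℂ ≃ᵢ ℂ, h ((⟨5 * x + 1, 5 * y + 2⟩ : ℂ) / Real.sqrt 5) = d.frame h w := by
  obtain ⟨a, b, o⟩ := d
  rw [Tri.interior_carrier_std]
  obtain ⟨h1, h2, h3, h4⟩ := hd
  -- The offset (1, 2) in the cell avoids the diagonals of all dominoes over this cell: in model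
  -- coordinates 2 re + im is 4 or 9 for a vertical domino and 13 or 8 for a horizontal one, never
  -- 10.
  cases o <;> simp only [width, height, cond_false, cond_true] at h1 h2 h3 h4
  · refine ⟨⟨5 * (x - a) + 1, 5 * (y - b) + 2⟩, ?_, fun h => ?_⟩
    · obtain rfl : x = a := by omega
      rcases (by omega : y = b ∨ y = b + 1) with rfl | rfl
      · left; norm_num
      · left; simp; norm_num
    · simp only [frame, origin, dir, cond_false]
      congr 2
      apply Complex.ext <;> simp <;> ring
  · refine ⟨⟨5 * (y - b) + 2, 9 - 5 * (x - a)⟩, ?_, fun h => ?_⟩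
    · obtain rfl : y = b := by omega
      rcases (by omega : x = a ∨ x = a + 1) with rfl | rfl
      · right; simp [halfTurn]; norm_num
      · left; norm_num
    · simp only [frame, origin, dir, cond_true]
      congr 2
      apply Complex.ext <;> simp <;> ring

/-- Since 5x + 1 and 5y + 2 are not multiples of 5, weak bounds by multiples of 5 already place the
cell inside the domino. -/
lemma Domino.covers_of_eq {d : Domino} {x y : ℤ} {w : ℂ} (hw0 : 0 ≤ w.re) (hw1 : w.re ≤ 5)
    (hw2 : 0 ≤ w.im) (hw3 : w.im ≤ 10)
    (h : (⟨5 * x + 1, 5 * y + 2⟩ : ℂ) = d.origin + d.dir * w) : d.Covers x y := by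
  obtain ⟨a, b, o⟩ := d
  have hr := congrArg re h
  have hi := congrArg im h
  cases o <;> simp [origin, dir] at hr hi
  · have e1 : 5 * a ≤ 5 * x + 1 := by
      have : (5 * a : ℝ) ≤ 5 * x + 1 := by linarith
      exact_mod_cast this
    have e2 : 5 * x + 1 ≤ 5 * a + 5 := by
      have : (5 * x + 1 : ℝ) ≤ 5 * a + 5 := by linarith
      exact_mod_cast this
    have e3 : 5 * b ≤ 5 * y + 2 := by
      have : (5 * b : ℝ) ≤ 5 * y + 2 := by linarith
      exact_mod_cast this
    have e4 : 5 * y + 2 ≤ 5 * b + 10 := by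
      have : (5 * y + 2 : ℝ) ≤ 5 * b + 10 := by linarith
      exact_mod_cast this
    refine ⟨?_, ?_, ?_, ?_⟩ <;> simp only [width, height, cond_false] <;> omega
  · have e1 : 5 * a ≤ 5 * x + 1 := by
      have : (5 * a : ℝ) ≤ 5 * x + 1 := by linarith
      exact_mod_cast this
    have e2 : 5 * x + 1 ≤ 5 * a + 10 := by
      have : (5 * x + 1 : ℝ) ≤ 5 * a + 10 := by linarith
      exact_mod_cast this
    have e3 : 5 * b ≤ 5 * y + 2 := by
      have : (5 * b : ℝ) ≤ 5 * y + 2 := by linarith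
      exact_mod_cast this
    have e4 : 5 * y + 2 ≤ 5 * b + 5 := by
      have : (5 * y + 2 : ℝ) ≤ 5 * b + 5 := by linarith
      exact_mod_cast this
    refine ⟨?_, ?_, ?_, ?_⟩ <;> simp only [width, height, cond_true] <;> omega

/-- The products of the directions 1, i with the signs ±1 are four different units, so the linear
part determines both the orientation of the domino and the half; the constant term then gives its
position. -/
lemma Domino.eq_of_affine_eq {d d' : Domino} {ε ε' c c' : ℂ}
    (hε : ε = 1 ∧ c = 0 ∨ ε = -1 ∧ c = 5 + 10 * I)
    (hε' : ε' = 1 ∧ c' = 0 ∨ ε' = -1 ∧ c' = 5 + 10 * I)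
    (h : ∀ w : ℂ, d.origin + d.dir * (ε * w + c) = d'.origin + d'.dir * (ε' * w + c')) :
    d = d' := by
  obtain ⟨a, b, o⟩ := d
  obtain ⟨a', b', o'⟩ := d'
  have h0 := h 0
  have h1 := h 1
  have hd : (⟨a, b, o⟩ : Domino).dir * ε = (⟨a', b', o'⟩ : Domino).dir * ε' := by
    linear_combination h1 - h0
  have hdr := congrArg re hd
  have hdi := congrArg im hd
  have hr := congrArg re h0
  have hi := congrArg im h0
  rcases hε with ⟨rfl, rfl⟩ | ⟨rfl, rfl⟩ <;> rcases hε' with ⟨rfl, rfl⟩ | ⟨rfl, rfl⟩ <;>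
    cases o <;> cases o' <;> simp [origin, dir] at hdr hdi hr hi <;>
    first
    | (exfalso; linarith)
    | (ext <;> simp <;> exact_mod_cast (by linarith))

/-- Every non-pinwheel tiling is a domino tiling of a square grid with rectangle supertiles as
dominoes. -/
theorem IsTiling.exists_dominoTiling {T : Set Tri} (hT : IsTiling T) :
    ∃ (h : ℂ ≃ᵢ ℂ) (𝓓 : Set Domino), IsDominoTiling 𝓓 ∧
      T = ⋃ d ∈ 𝓓, placed (d.place h) := by
  obtain ⟨S, hP, hC, hS, rfl⟩ := hT.exists_composition
  obtain ⟨s₀, hs₀, -⟩ := hC 0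
  obtain ⟨h, -, hall⟩ := exists_frame hS hs₀
  -- A domino is recorded through the half of its rectangle that is the image of the reference
  -- triangle; `flip_mem` supplies the other half.
  let 𝓓 : Set Domino := {d | Tri.std.map (d.frame h) ∈ S}
  have hflip {d : Domino} (hd : d ∈ 𝓓) : Tri.std.map (fun w => d.frame h (halfTurn w)) ∈ S :=
    flip_mem hP hC hS (d.isAff_frame h) hd
  have hdom {s : Tri} (hs : s ∈ S) : ∃ d ∈ 𝓓, s = Tri.std.map (d.frame h) ∨
      s = Tri.std.map (fun w => d.frame h (halfTurn w)) := by
    obtain ⟨z, hz, u, hu, rfl⟩ := hall s hs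
    have hs' := flip_mem hP hC hS (NonPinwheel.isAff_frame h hu _) hs
    obtain ⟨a, b, rfl⟩ := mem_gauss.1 hz
    rcases hu with rfl | rfl | rfl | rfl
    · have e : (fun w => h ((5 * (a + b * I : ℂ) + 1 * w) / Real.sqrt 5)) =
          (⟨a, b, false⟩ : Domino).frame h := by
        funext w
        simp [Domino.frame, Domino.origin, Domino.dir]
      rw [e] at hs ⊢
      exact ⟨_, hs, Or.inl rfl⟩
    · have e : (fun w => h ((5 * (a + b * I : ℂ) + I * w) / Real.sqrt 5)) =
          -- A quarter turn sends the long leg two cells to the left of the right-angled corner,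
          -- while a domino is recorded by its lower left corner.
          (⟨a - 2, b, true⟩ : Domino).frame h := by
        funext w
        simp only [Domino.frame, Domino.origin, Domino.dir, cond_true]
        congr 2
        push_cast
        ring
      rw [e] at hs ⊢
      exact ⟨_, hs, Or.inl rfl⟩
    -- For the units -1 and -i the triangle is the second half of its rectangle, so the partner is
    -- the one that gives the domino.
    · have e : (fun w => h ((5 * (a + b * I : ℂ) + -1 * (5 + 10 * I - w)) / Real.sqrt 5)) =
          (⟨a - 1, b - 2, false⟩ : Domino).frame h := by
        funext w
        simp only [Domino.frame, Domino.origin, Domino.dir, cond_false]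
        congr 2
        push_cast
        ring
      rw [e] at hs'
      refine ⟨_, hs', Or.inr ?_⟩
      rw [← e]
      simp [halfTurn]
    · have e : (fun w => h ((5 * (a + b * I : ℂ) + -I * (5 + 10 * I - w)) / Real.sqrt 5)) =
          (⟨a, b - 1, true⟩ : Domino).frame h := by
        funext w
        simp only [Domino.frame, Domino.origin, Domino.dir, cond_true]
        congr 2
        push_cast
        linear_combination (-10) * I_mul_I
      rw [e] at hs'
      refine ⟨_, hs', Or.inr ?_⟩
      rw [← e]
      simp [halfTurn]
  refine ⟨h, 𝓓, ?_, ?_⟩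
  · intro x y
    refine existsUnique_of_exists_of_unique ?_ ?_
    · obtain ⟨s, hs, hq⟩ := hC (h ((⟨5 * x + 1, 5 * y + 2⟩ : ℂ) / Real.sqrt 5))
      have hinj {p q : ℂ} (e : h (p / Real.sqrt 5) = h (q / Real.sqrt 5)) : p = q :=
        (div_left_inj' sqrt_five_ne_zero).1 (h.injective e)
      obtain ⟨d, hd, rfl | rfl⟩ := hdom hs
      · refine ⟨d, hd, ?_⟩
        rw [Tri.carrier_map (d.isAff_frame h), Tri.carrier_std] at hq
        obtain ⟨w, ⟨h1, h2, h3⟩, hw⟩ := hq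
        exact Domino.covers_of_eq h1 (by linarith) h2 (by linarith) (hinj hw.symm)
      · refine ⟨d, hd, ?_⟩
        rw [Tri.carrier_map ((d.isAff_frame h).comp isAff_halfTurn), Tri.carrier_std] at hq
        obtain ⟨w, ⟨h1, h2, h3⟩, hw⟩ := hq
        refine Domino.covers_of_eq (w := halfTurn w) ?_ ?_ ?_ ?_ (hinj hw.symm) <;>
          simp [halfTurn] <;> linarith
    · rintro d d' ⟨hd, hdc⟩ ⟨hd', hdc'⟩
      -- Two dominoes over the same cell yield two triangles of the packing with the sample point in
      -- their interiors, hence the same triangle.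
      have key {d : Domino} (hd : d ∈ 𝓓) (hdc : d.Covers x y) : ∃ ε c : ℂ,
          (ε = 1 ∧ c = 0 ∨ ε = -1 ∧ c = 5 + 10 * I) ∧
          Tri.std.map (fun w => d.frame h (ε * w + c)) ∈ S ∧
          h ((⟨5 * x + 1, 5 * y + 2⟩ : ℂ) / Real.sqrt 5) ∈
            interior (Tri.std.map (fun w => d.frame h (ε * w + c))).carrier := by
        obtain ⟨w, hw | hw, e⟩ := Domino.mem_interior_of_covers hdc
        · refine ⟨1, 0, Or.inl ⟨rfl, rfl⟩, ?_, ?_⟩ <;> simp only [one_mul, add_zero]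
          · exact hd
          · rw [e]
            exact (d.isAff_frame h).mem_interior_carrier_map.2 hw
        · have e' : (fun w => d.frame h (-1 * w + (5 + 10 * I))) =
              fun w => d.frame h (halfTurn w) := by
            funext w
            simp only [halfTurn]
            congr 1
            ring
          refine ⟨-1, _, Or.inr ⟨rfl, rfl⟩, ?_, ?_⟩ <;> rw [e']
          · exact hflip hd
          · rw [e]
            have := ((d.isAff_frame h).comp isAff_halfTurn).mem_interior_carrier_map.2 hw
            simpa [halfTurn] using this
      obtain ⟨ε, c, hε, hm, hi⟩ := key hd hdc
      obtain ⟨ε', c', hε', hm', hi'⟩ := key hd' hdc'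
      have haff {d : Domino} {ε c : ℂ} (hε : ε = 1 ∧ c = 0 ∨ ε = -1 ∧ c = 5 + 10 * I) :
          IsAff (fun w => d.frame h (ε * w + c)) :=
        (d.isAff_frame h).comp (isAff_mul_add (by rcases hε with ⟨rfl, -⟩ | ⟨rfl, -⟩ <;> simp) c)
      have hst : Tri.std.map (fun w => d.frame h (ε * w + c)) =
          Tri.std.map (fun w => d'.frame h (ε' * w + c')) := by
        by_contra hne
        exact disjoint_left.1 (hP _ hm _ hm' hne) hi hi'
      have heq := (haff hε).eq_of_map_eq (haff hε') hst
      refine Domino.eq_of_affine_eq hε hε' fun w => ?_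
      exact (div_left_inj' sqrt_five_ne_zero).1 (h.injective (congrFun heq w))
  · simp only [Domino.placed_place]
    apply Subset.antisymm
    · refine iUnion₂_subset fun s hs => ?_
      obtain ⟨d, hd, rfl | rfl⟩ := hdom hs
      · exact subset_union_left.trans (subset_biUnion_of_mem
          (u := fun d : Domino => (Tri.std.map (d.frame h)).dissect ∪
            (Tri.std.map (fun w => d.frame h (halfTurn w))).dissect) hd)
      · exact subset_union_right.trans (subset_biUnion_of_mem
          (u := fun d : Domino => (Tri.std.map (d.frame h)).dissect ∪
            (Tri.std.map (fun w => d.frame h (halfTurn w))).dissect) hd)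
    · refine iUnion₂_subset fun d hd => union_subset ?_ ?_
      · exact subset_biUnion_of_mem (u := fun s : Tri => s.dissect) hd
      · exact subset_biUnion_of_mem (u := fun s : Tri => s.dissect) (hflip hd)

/-! ### The geometry of a placed rectangle -/

/-- The point with integer coordinates `p`, in units `1 / √5`. -/
def pn (p : ℕ × ℕ) : ℂ := (p.1 : ℂ) + (p.2 : ℂ) * I

@[simp] lemma pn_re (p : ℕ × ℕ) : (pn p).re = p.1 := by simp [pn]

@[simp] lemma pn_im (p : ℕ × ℕ) : (pn p).im = p.2 := by simp [pn]

lemma node_eq (p : ℕ × ℕ) : node p = pn p / Real.sqrt 5 := rfl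

lemma pn_injective : Function.Injective pn := by
  intro p q h
  have h1 := congrArg re h
  have h2 := congrArg im h
  simp only [pn_re, pn_im, Nat.cast_inj] at h1 h2
  exact Prod.ext h1 h2

lemma node_injective : Function.Injective node := by
  intro p q h
  exact pn_injective ((div_left_inj' sqrt_five_ne_zero).1 h)

lemma isAff_scaled (φ : ℂ ≃ᵢ ℂ) : IsAff (fun w => φ (w / Real.sqrt 5)) :=
  (IsAff.isometryEquiv φ).comp isAff_div

/-- The model rectangle in units `1 / √5`. -/
def box : Set ℂ := Icc 0 5 ×ℂ Icc 0 10

lemma mem_box {z : ℂ} : z ∈ box ↔ (0 ≤ z.re ∧ z.re ≤ 5) ∧ 0 ≤ z.im ∧ z.im ≤ 10 := Iff.rfl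

lemma mem_interior_box {z : ℂ} :
    z ∈ interior box ↔ (0 < z.re ∧ z.re < 5) ∧ 0 < z.im ∧ z.im < 10 := by
  rw [box, interior_reProdIm, interior_Icc, interior_Icc]
  rfl

lemma frontier_box : frontier box = box \ interior box :=
  (isClosed_Icc.reProdIm isClosed_Icc).frontier_eq

lemma box_eq : box = Tri.std.carrier ∪ halfTurn '' Tri.std.carrier := by
  rw [Tri.carrier_std]
  ext z
  constructor
  · rintro ⟨⟨h1, h2⟩, h3, h4⟩
    by_cases h : 2 * z.re + z.im ≤ 10
    · exact Or.inl ⟨h1, h3, h⟩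
    · refine Or.inr ⟨halfTurn z, ⟨?_, ?_, ?_⟩, by simp [halfTurn]⟩ <;> simp [halfTurn] <;> linarith
  · rintro (⟨h1, h2, h3⟩ | ⟨w, ⟨h1, h2, h3⟩, rfl⟩)
    · exact ⟨⟨h1, by linarith⟩, h2, by linarith⟩
    · refine ⟨⟨?_, ?_⟩, ?_, ?_⟩ <;> simp [halfTurn] <;> linarith

lemma Tri.Nondeg.region_dissect {t : Tri} (ht : t.Nondeg) : region t.dissect = t.carrier := by
  apply Subset.antisymm
  · exact iUnion₂_subset fun s hs => ht.carrier_subset hs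
  · intro z hz
    obtain ⟨s, hs, hz⟩ := ht.exists_mem_dissect hz
    exact mem_biUnion hs hz

lemma region_placed (φ : ℂ ≃ᵢ ℂ) :
    region (placed φ) = (fun w => φ (w / Real.sqrt 5)) '' box := by
  have h1 := isAff_scaled φ
  have h2 := h1.comp isAff_halfTurn
  rw [placed_eq, region, biUnion_union]
  have e1 := Tri.Nondeg.region_dissect ⟨_, h1, rfl⟩
  have e2 := Tri.Nondeg.region_dissect ⟨_, h2, rfl⟩
  rw [region] at e1 e2
  rw [e1, e2, Tri.carrier_map h1, Tri.carrier_map h2, box_eq, image_union, image_image]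

lemma interior_region_placed (φ : ℂ ≃ᵢ ℂ) :
    interior (region (placed φ)) = (fun w => φ (w / Real.sqrt 5)) '' interior box := by
  rw [region_placed, (isAff_scaled φ).image_interior]

lemma frontier_region_placed (φ : ℂ ≃ᵢ ℂ) :
    frontier (region (placed φ)) = (fun w => φ (w / Real.sqrt 5)) '' (box \ interior box) := by
  rw [region_placed, (isAff_scaled φ).image_frontier, frontier_box]

lemma disjoint_interior_frontier_region (R : Set Tri) :
    Disjoint (interior (region R)) (frontier (region R)) :=
  disjoint_interior_frontier

lemma frontier_region_placed_subset (φ : ℂ ≃ᵢ ℂ) :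
    frontier (region (placed φ)) ⊆ region (placed φ) := by
  rw [frontier_region_placed, region_placed]
  exact image_mono sdiff_subset

/-! ### Nodes and edges of the rectangle -/

/-- The internal edges of the model rectangle. -/
def innerEdges : List ((ℕ × ℕ) × (ℕ × ℕ)) := internalWeights.map fun e => (e.1, e.2.1)

/-- The external edges of the model rectangle. -/
def outerEdges : List ((ℕ × ℕ) × (ℕ × ℕ)) :=
  [((0, 0), (5, 0)), ((5, 5), (5, 0)), ((5, 5), (5, 10)), ((0, 10), (5, 10)), ((0, 10), (0, 5)),
   ((0, 0), (0, 5))]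

/-- The external vertices of the model rectangle. -/
def outerNodes : List (ℕ × ℕ) := blueNodes ++ redNodes

/-- The internal vertices of the model rectangle. -/
def innerNodes : List (ℕ × ℕ) := internalDegrees.map Prod.fst

/-- The corners of the ten tiles of the model rectangle. -/
def tileNodes : List ((ℕ × ℕ) × (ℕ × ℕ) × (ℕ × ℕ)) :=
  [((2, 1), (0, 0), (0, 5)), ((0, 5), (2, 6), (2, 1)), ((2, 6), (0, 5), (0, 10)),
   ((4, 2), (2, 1), (2, 6)), ((4, 2), (5, 0), (0, 0)), ((3, 9), (5, 10), (5, 5)),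
   ((5, 5), (3, 4), (3, 9)), ((3, 4), (5, 5), (5, 0)), ((1, 8), (3, 9), (3, 4)),
   ((1, 8), (0, 10), (5, 10))]

/-- With the tiles given by a finite list of integer points, all incidences of the model can be
decided by computation. The second five tiles are the half-turns of the first five. -/
lemma rectangle_eq_tileNodes :
    rectangle = {t | ∃ τ ∈ tileNodes, t = ⟨node τ.1, node τ.2.1, node τ.2.2⟩} := by
  have h : rectangle =
      {⟨node (2, 1), node (0, 0), node (0, 5)⟩, ⟨node (0, 5), node (2, 6), node (2, 1)⟩,
       ⟨node (2, 6), node (0, 5), node (0, 10)⟩, ⟨node (4, 2), node (2, 1), node (2, 6)⟩,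
       ⟨node (4, 2), node (5, 0), node (0, 0)⟩} ∪
      {⟨node (3, 9), node (5, 10), node (5, 5)⟩, ⟨node (5, 5), node (3, 4), node (3, 9)⟩,
       ⟨node (3, 4), node (5, 5), node (5, 0)⟩, ⟨node (1, 8), node (3, 9), node (3, 4)⟩,
       ⟨node (1, 8), node (0, 10), node (5, 10)⟩} := by
    rw [rectangle_eq, ← Tri.map_map (fun w => w / (Real.sqrt 5 : ℂ)) halfTurn,
      Tri.dissect_map isAff_div, Tri.dissect_map isAff_div, Tri.dissect_map isAff_halfTurn]
    have e (x y : ℝ) : Tri.std.pt x y = x + y * I := Tri.std_pt x y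
    simp only [Tri.dissect, e, image_insert_eq, image_singleton, Tri.map, node_eq, pn, halfTurn]
    congr 3 <;> norm_num <;> ring_nf <;> simp
  rw [h]
  ext t
  simp only [mem_union, mem_insert_iff, mem_singleton_iff, mem_ofPred_eq, tileNodes, List.mem_cons,
    List.not_mem_nil, or_false, exists_eq_or_imp, exists_eq_left, or_assoc]

/-- All edges of the model rectangle. -/
def edges : List ((ℕ × ℕ) × (ℕ × ℕ)) := innerEdges ++ outerEdges

/-- All vertices of the model rectangle. -/
def nodes : List (ℕ × ℕ) := innerNodes ++ outerNodes

lemma mem_placed {φ : ℂ ≃ᵢ ℂ} {t : Tri} : t ∈ placed φ ↔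
    ∃ τ ∈ tileNodes, t = ⟨φ (node τ.1), φ (node τ.2.1), φ (node τ.2.2)⟩ := by
  rw [placed, rectangle_eq_tileNodes]
  constructor
  · rintro ⟨_, ⟨τ, hτ, rfl⟩, rfl⟩
    exact ⟨τ, hτ, rfl⟩
  · rintro ⟨τ, hτ, rfl⟩
    exact ⟨_, ⟨τ, hτ, rfl⟩, rfl⟩

lemma nondeg_of_mem_placed {φ : ℂ ≃ᵢ ℂ} {t : Tri} (ht : t ∈ placed φ) : t.Nondeg := by
  have h1 := isAff_scaled φ
  rw [placed_eq] at ht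
  rcases ht with ht | ht
  · exact Tri.Nondeg.dissect ⟨_, h1, rfl⟩ ht
  · exact Tri.Nondeg.dissect ⟨_, h1.comp isAff_halfTurn, rfl⟩ ht

lemma Tri.Nondeg.frontier_carrier {t : Tri} (ht : t.Nondeg) :
    frontier t.carrier = segment ℝ t.P t.S ∪ segment ℝ t.S t.L ∪ segment ℝ t.P t.L := by
  obtain ⟨f, hf, rfl⟩ := ht
  rw [carrier_map hf, hf.image_frontier, frontier_carrier_std, image_union, image_union,
    hf.image_segment, hf.image_segment, hf.image_segment]
  rfl

lemma mem_vertexSet_placed {φ : ℂ ≃ᵢ ℂ} {v : ℂ} :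
    v ∈ vertexSet (placed φ) ↔ ∃ p ∈ nodes, v = φ (node p) := by
  have h1 : ∀ τ ∈ tileNodes, τ.1 ∈ nodes ∧ τ.2.1 ∈ nodes ∧ τ.2.2 ∈ nodes := by decide
  have h2 : ∀ p ∈ nodes, ∃ τ ∈ tileNodes, p = τ.1 ∨ p = τ.2.1 ∨ p = τ.2.2 := by decide
  simp only [vertexSet, mem_iUnion, exists_prop, mem_placed]
  constructor
  · rintro ⟨_, ⟨τ, hτ, rfl⟩, rfl | rfl | rfl⟩
    · exact ⟨_, (h1 τ hτ).1, rfl⟩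
    · exact ⟨_, (h1 τ hτ).2.1, rfl⟩
    · exact ⟨_, (h1 τ hτ).2.2, rfl⟩
  · rintro ⟨p, hp, rfl⟩
    obtain ⟨τ, hτ, h⟩ := h2 p hp
    refine ⟨_, ⟨τ, hτ, rfl⟩, ?_⟩
    rcases h with rfl | rfl | rfl <;> simp [Tri.corners]

lemma segment_subset_of_midpoint {a b m : ℂ} (h : a + b = 2 * m) :
    segment ℝ a m ⊆ segment ℝ a b := by
  refine (convex_segment a b).segment_subset (left_mem_segment ℝ a b) ?_
  obtain rfl : m = (a + b) / 2 := by rw [h]; ring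
  exact ⟨1 / 2, 1 / 2, by norm_num, by norm_num, by norm_num, by
    simp only [real_smul]; push_cast; ring⟩

lemma segment_subset_union_of_midpoint {a b m : ℂ} (h : a + b = 2 * m) :
    segment ℝ a b ⊆ segment ℝ a m ∪ segment ℝ m b := by
  obtain rfl : m = (a + b) / 2 := by rw [h]; ring
  simp only [segment_eq_image']
  rintro _ ⟨t, ⟨h0, h1⟩, rfl⟩
  rcases le_total t (1 / 2) with ht | ht
  · refine Or.inl ⟨2 * t, ⟨by linarith, by linarith⟩, ?_⟩
    simp only [real_smul]; push_cast; ring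
  · refine Or.inr ⟨2 * t - 1, ⟨by linarith, by linarith⟩, ?_⟩
    simp only [real_smul]; push_cast; ring

lemma node_add_node {p q m : ℕ × ℕ} (h : p + q = m + m) : node p + node q = 2 * node m := by
  have h1 := congrArg Prod.fst h
  have h2 := congrArg Prod.snd h
  simp only [Prod.fst_add, Prod.snd_add] at h1 h2
  have h1' : (p.1 + q.1 : ℂ) = m.1 + m.1 := by exact_mod_cast h1
  have h2' : (p.2 + q.2 : ℂ) = m.2 + m.2 := by exact_mod_cast h2
  simp only [node]
  linear_combination (h1' + h2' * I) / Real.sqrt 5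

lemma map_node_add {φ : ℂ ≃ᵢ ℂ} {p q m : ℕ × ℕ} (h : p + q = m + m) :
    φ (node p) + φ (node q) = 2 * φ (node m) := by
  have h1 := node_add_node h
  have h2 : node m - node q = node p - node m := by linear_combination -h1
  have h3 (z : ℂ) : φ z = φ.toRealLinearIsometryEquiv z + φ 0 := by
    rw [φ.toRealLinearIsometryEquiv_apply]
    ring
  have h4 := congrArg φ.toRealLinearIsometryEquiv h2
  rw [map_sub, map_sub] at h4
  rw [h3 (node p), h3 (node q), h3 (node m)]
  linear_combination -h4

/-- The sides of the ten tiles of the model rectangle. -/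
def sides : List ((ℕ × ℕ) × (ℕ × ℕ)) :=
  tileNodes.flatMap fun τ => [(τ.1, τ.2.1), (τ.2.1, τ.2.2), (τ.1, τ.2.2)]

/-- The pair `{p, q}` belongs to the list. -/
def HasPair (l : List ((ℕ × ℕ) × (ℕ × ℕ))) (p q : ℕ × ℕ) : Prop := (p, q) ∈ l ∨ (q, p) ∈ l

instance (l : List ((ℕ × ℕ) × (ℕ × ℕ))) (p q : ℕ × ℕ) : Decidable (HasPair l p q) :=
  inferInstanceAs (Decidable (_ ∨ _))

lemma HasPair.exists_segment {l : List ((ℕ × ℕ) × (ℕ × ℕ))} {p q : ℕ × ℕ} (h : HasPair l p q)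
    {φ : ℂ ≃ᵢ ℂ} {z : ℂ} (hz : z ∈ segment ℝ (φ (node p)) (φ (node q))) :
    ∃ e ∈ l, z ∈ segment ℝ (φ (node e.1)) (φ (node e.2)) := by
  rcases h with h | h
  · exact ⟨_, h, hz⟩
  · exact ⟨_, h, by rwa [segment_symm]⟩

lemma mem_skeleton_placed_iff_sides {φ : ℂ ≃ᵢ ℂ} {z : ℂ} : z ∈ skeleton (placed φ) ↔
    ∃ e ∈ sides, z ∈ segment ℝ (φ (node e.1)) (φ (node e.2)) := by
  simp only [skeleton, mem_iUnion, exists_prop, sides, List.mem_flatMap]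
  constructor
  · rintro ⟨t, ht, hz⟩
    rw [(nondeg_of_mem_placed ht).frontier_carrier] at hz
    obtain ⟨τ, hτ, rfl⟩ := mem_placed.1 ht
    rcases hz with (hz | hz) | hz
    · exact ⟨(τ.1, τ.2.1), ⟨τ, hτ, by simp⟩, hz⟩
    · exact ⟨(τ.2.1, τ.2.2), ⟨τ, hτ, by simp⟩, hz⟩
    · exact ⟨(τ.1, τ.2.2), ⟨τ, hτ, by simp⟩, hz⟩
  · rintro ⟨e, ⟨τ, hτ, he⟩, hz⟩
    have ht := (mem_placed (φ := φ)).2 ⟨τ, hτ, rfl⟩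
    refine ⟨_, ht, ?_⟩
    rw [(nondeg_of_mem_placed ht).frontier_carrier]
    simp only [List.mem_cons, List.not_mem_nil, or_false] at he
    rcases he with rfl | rfl | rfl
    · exact Or.inl (Or.inl hz)
    · exact Or.inl (Or.inr hz)
    · exact Or.inr hz

/-- Tile sides are not always edges, because a corner of another tile may lie on them. Cutting at
these corners does not change the union. -/
lemma mem_skeleton_placed {φ : ℂ ≃ᵢ ℂ} {z : ℂ} : z ∈ skeleton (placed φ) ↔
    ∃ e ∈ edges, z ∈ segment ℝ (φ (node e.1)) (φ (node e.2)) := by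
  -- An extra vertex on a side of the model is always its midpoint, so each side is one edge or two
  -- equal halves, and conversely each edge is a side or half of one.
  have h1 : ∀ e ∈ sides, HasPair edges e.1 e.2 ∨ ∃ m ∈ nodes, e.1 + e.2 = m + m ∧
      HasPair edges e.1 m ∧ HasPair edges m e.2 := by decide
  have h2 : ∀ e ∈ edges, HasPair sides e.1 e.2 ∨
      (∃ b ∈ nodes, e.1 + b = e.2 + e.2 ∧ HasPair sides e.1 b) ∨
      ∃ b ∈ nodes, e.2 + b = e.1 + e.1 ∧ HasPair sides e.2 b := by decide
  rw [mem_skeleton_placed_iff_sides]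
  constructor
  · rintro ⟨e, he, hz⟩
    rcases h1 e he with h | ⟨m, -, hm, h, h'⟩
    · exact h.exists_segment hz
    · rcases segment_subset_union_of_midpoint (map_node_add hm) hz with hz | hz
      · exact h.exists_segment hz
      · exact h'.exists_segment hz
  · rintro ⟨e, he, hz⟩
    rcases h2 e he with h | ⟨b, -, hb, h⟩ | ⟨b, -, hb, h⟩
    · exact h.exists_segment hz
    · exact h.exists_segment (segment_subset_of_midpoint (map_node_add hb) hz)
    · rw [segment_symm] at hz
      exact h.exists_segment (segment_subset_of_midpoint (map_node_add hb) hz)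

/-! ### Nodes and edges in the interior and in the boundary -/

lemma map_node_mem_interior (φ : ℂ ≃ᵢ ℂ) {p : ℕ × ℕ} (hp : p ∈ innerNodes) :
    φ (node p) ∈ interior (region (placed φ)) := by
  have h : ∀ p ∈ innerNodes, (0 < p.1 ∧ p.1 < 5) ∧ 0 < p.2 ∧ p.2 < 10 := by decide
  rw [interior_region_placed]
  refine ⟨pn p, ?_, rfl⟩
  rw [mem_interior_box, pn_re, pn_im]
  exact_mod_cast h p hp

lemma map_node_mem_frontier (φ : ℂ ≃ᵢ ℂ) {p : ℕ × ℕ} (hp : p ∈ outerNodes) :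
    φ (node p) ∈ frontier (region (placed φ)) := by
  have h : ∀ p ∈ outerNodes, ((0 ≤ p.1 ∧ p.1 ≤ 5) ∧ 0 ≤ p.2 ∧ p.2 ≤ 10) ∧
      ¬ ((0 < p.1 ∧ p.1 < 5) ∧ 0 < p.2 ∧ p.2 < 10) := by decide
  rw [frontier_region_placed]
  refine ⟨pn p, ?_, rfl⟩
  rw [mem_sdiff, mem_interior_box, mem_box, pn_re, pn_im]
  exact_mod_cast h p hp

lemma map_node_mem_region (φ : ℂ ≃ᵢ ℂ) {p : ℕ × ℕ} (hp : p ∈ nodes) :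
    φ (node p) ∈ region (placed φ) := by
  rcases List.mem_append.1 hp with h | h
  · exact interior_subset (map_node_mem_interior φ h)
  · exact frontier_region_placed_subset φ (map_node_mem_frontier φ h)

/-- The endpoints of an internal edge never lie on the same side of the box, so in each coordinate a
proper convex combination is strictly between the bounds. -/
lemma inner_openSegment_subset (φ : ℂ ≃ᵢ ℂ) {e : (ℕ × ℕ) × (ℕ × ℕ)} (he : e ∈ innerEdges) :
    openSegment ℝ (φ (node e.1)) (φ (node e.2)) ⊆ interior (region (placed φ)) := by
  have h : ∀ e ∈ innerEdges, (e.1.1 ≤ 5 ∧ e.2.1 ≤ 5 ∧ 0 < e.1.1 + e.2.1 ∧ e.1.1 + e.2.1 < 10) ∧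
      e.1.2 ≤ 10 ∧ e.2.2 ≤ 10 ∧ 0 < e.1.2 + e.2.2 ∧ e.1.2 + e.2.2 < 20 := by decide
  have key (a b N : ℕ) (h : a ≤ N ∧ b ≤ N ∧ 0 < a + b ∧ a + b < 2 * N) (s t : ℝ) (hs : 0 < s)
      (ht : 0 < t) (hst : s + t = 1) : 0 < s * a + t * b ∧ s * a + t * b < N := by
    obtain ⟨h1, h2, h3, h4⟩ := h
    have h1' : (a : ℝ) ≤ N := by exact_mod_cast h1
    have h2' : (b : ℝ) ≤ N := by exact_mod_cast h2
    have ha : (0 : ℝ) ≤ a := Nat.cast_nonneg a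
    have hb : (0 : ℝ) ≤ b := Nat.cast_nonneg b
    have hN : (N : ℝ) = s * N + t * N := by rw [← add_mul, hst, one_mul]
    constructor
    · rcases (by omega : 0 < a ∨ 0 < b) with h | h
      · have : (0 : ℝ) < a := by exact_mod_cast h
        positivity
      · have : (0 : ℝ) < b := by exact_mod_cast h
        positivity
    · rw [hN]
      rcases (by omega : a < N ∨ b < N) with h | h
      · have : (a : ℝ) < N := by exact_mod_cast h
        exact add_lt_add_of_lt_of_le (mul_lt_mul_of_pos_left this hs)
          (mul_le_mul_of_nonneg_left h2' ht.le)
      · have : (b : ℝ) < N := by exact_mod_cast h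
        exact add_lt_add_of_le_of_lt (mul_le_mul_of_nonneg_left h1' hs.le)
          (mul_lt_mul_of_pos_left this ht)
  rw [interior_region_placed]
  have := (isAff_scaled φ).image_openSegment (pn e.1) (pn e.2)
  rw [node_eq, node_eq, ← this]
  refine image_mono ?_
  rintro _ ⟨s, t, hs, ht, hst, rfl⟩
  have h1 := key e.1.1 e.2.1 5 (h e he).1 s t hs ht hst
  have h2 := key e.1.2 e.2.2 10 (h e he).2 s t hs ht hst
  rw [mem_interior_box]
  simpa using And.intro h1 h2

lemma outer_segment_subset (φ : ℂ ≃ᵢ ℂ) {e : (ℕ × ℕ) × (ℕ × ℕ)} (he : e ∈ outerEdges) :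
    segment ℝ (φ (node e.1)) (φ (node e.2)) ⊆ frontier (region (placed φ)) := by
  rw [frontier_region_placed]
  have := (isAff_scaled φ).image_segment (pn e.1) (pn e.2)
  rw [node_eq, node_eq, ← this]
  refine image_mono ?_
  rintro _ ⟨s, t, hs, ht, hst, rfl⟩
  obtain rfl : s = 1 - t := by linarith
  simp only [outerEdges, List.mem_cons, List.not_mem_nil, or_false] at he
  rw [mem_sdiff, mem_interior_box, mem_box]
  rcases he with rfl | rfl | rfl | rfl | rfl | rfl <;>
    refine ⟨⟨⟨?_, ?_⟩, ?_, ?_⟩, ?_⟩ <;> simp <;> intros <;> linarith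

/-- The open edges of a rectangle contain no vertices of this rectangle. -/
lemma map_node_notMem_openSegment (φ : ℂ ≃ᵢ ℂ) {e : (ℕ × ℕ) × (ℕ × ℕ)} (he : e ∈ edges)
    {p : ℕ × ℕ} (hp : p ∈ nodes) :
    φ (node p) ∉ openSegment ℝ (φ (node e.1)) (φ (node e.2)) := by
  -- Integer criterion for a point p to be off the open segment ab: either p - a and b - a are not
  -- parallel, or the scalar product of p - a and b - p is not positive.
  have h : ∀ e ∈ edges, ∀ p ∈ nodes,
      ((p.1 : ℤ) - e.1.1) * ((e.2.2 : ℤ) - e.1.2) ≠ ((p.2 : ℤ) - e.1.2) * ((e.2.1 : ℤ) - e.1.1) ∨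
      ((p.1 : ℤ) - e.1.1) * ((e.2.1 : ℤ) - p.1) + ((p.2 : ℤ) - e.1.2) * ((e.2.2 : ℤ) - p.2) ≤ 0 := by
    decide
  have hne : ∀ e ∈ edges, 0 < ((e.2.1 : ℤ) - e.1.1) ^ 2 + ((e.2.2 : ℤ) - e.1.2) ^ 2 := by decide
  have := (isAff_scaled φ).image_openSegment (pn e.1) (pn e.2)
  rw [node_eq, node_eq, node_eq, ← this,
    Function.Injective.mem_set_image (f := fun w => φ (w / Real.sqrt 5)) (isAff_scaled φ).injective]
  rintro ⟨s, t, hs, ht, hst, hp'⟩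
  have hr := congrArg re hp'
  have hi := congrArg im hp'
  simp at hr hi
  obtain rfl : s = 1 - t := by linarith
  have hpos : (0 : ℝ) < ((e.2.1 : ℝ) - e.1.1) ^ 2 + ((e.2.2 : ℝ) - e.1.2) ^ 2 := by
    exact_mod_cast hne e he
  rcases h e he p hp with h | h
  · apply h
    have : ((p.1 : ℝ) - e.1.1) * ((e.2.2 : ℝ) - e.1.2) =
        ((p.2 : ℝ) - e.1.2) * ((e.2.1 : ℝ) - e.1.1) := by
      rw [← hr, ← hi]
      ring
    exact_mod_cast this
  · have h' : ((p.1 : ℝ) - e.1.1) * ((e.2.1 : ℝ) - p.1) +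
        ((p.2 : ℝ) - e.1.2) * ((e.2.2 : ℝ) - p.2) ≤ 0 := by exact_mod_cast h
    rw [← hr, ← hi] at h'
    have : 0 < (1 - t) * t * (((e.2.1 : ℝ) - e.1.1) ^ 2 + ((e.2.2 : ℝ) - e.1.2) ^ 2) := by
      positivity
    linarith

/-! ### The placements of a rectangle -/

/-- The half-turn of the model rectangle as an isometry. -/
def turn : ℂ ≃ᵢ ℂ := rigid (-1) (node (5, 10)) (by simp)

lemma turn_div (w : ℂ) : turn (w / Real.sqrt 5) = halfTurn w / Real.sqrt 5 := by
  simp only [turn, rigid_apply, node, halfTurn]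
  push_cast
  ring

lemma halfTurn_halfTurn (w : ℂ) : halfTurn (halfTurn w) = w := by
  simp [halfTurn]

/-- The half-turn on the nodes. -/
def turnNode (p : ℕ × ℕ) : ℕ × ℕ := (5 - p.1, 10 - p.2)

lemma turn_node {p : ℕ × ℕ} (hp : p ∈ nodes) : turn (node p) = node (turnNode p) := by
  have h : ∀ p ∈ nodes, p.1 ≤ 5 ∧ p.2 ≤ 10 := by decide
  obtain ⟨h1, h2⟩ := h p hp
  rw [node_eq, turn_div, node_eq, halfTurn, pn, pn, turnNode]
  push_cast [h1, h2]
  ring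

lemma placed_turn (φ : ℂ ≃ᵢ ℂ) : placed (turn.trans φ) = placed φ := by
  rw [placed_eq, placed_eq, union_comm]
  simp only [IsometryEquiv.trans_apply, turn_div, halfTurn_halfTurn]

/-- There are at most two placements of a rectangle. -/
lemma eq_or_eq_turn_of_placed_eq {φ ψ : ℂ ≃ᵢ ℂ} (h : placed ψ = placed φ) :
    ψ = φ ∨ ψ = turn.trans φ := by
  have hφ := isAff_scaled φ
  have hψ := isAff_scaled ψ
  have hsurj (z : ℂ) : ∃ w, Tri.child 4 w / Real.sqrt 5 = z :=
    (isAff_div.comp (Tri.isAff_child 4)).bijective.2 z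
  have hE : Tri.std.map (fun w => ψ (Tri.child 4 w / Real.sqrt 5)) ∈ placed φ := by
    rw [← h, placed_eq, Tri.dissect_map_std hψ]
    exact Or.inl ⟨4, rfl⟩
  have hbox {w : ℂ} (hw : w ∈ box) : ∃ w' ∈ box, φ (w' / Real.sqrt 5) = ψ (w / Real.sqrt 5) := by
    have := congrArg region h
    rw [region_placed, region_placed] at this
    exact this.subset ⟨w, hw, rfl⟩
  -- The value is the corner 10i of the box. For the other four pieces the point with the same
  -- reference coordinate -20 has real part outside [0, 5], so this point tells piece 4 from the
  -- others.
  have h4 : Tri.child 4 (-20) ∈ box := by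
    refine ⟨⟨?_, ?_⟩, ?_, ?_⟩ <;> simp [Tri.child, Tri.childUnit, Tri.childBase] <;> norm_num
  have hj {j : Fin 5} (hj : Tri.child j (-20) ∈ box) : j = 4 := by
    obtain ⟨⟨h1, h2⟩, -, -⟩ := hj
    fin_cases j <;> simp [Tri.child, Tri.childUnit, Tri.childBase] at h1 h2 ⊢ <;> linarith
  rw [placed_eq, Tri.dissect_map_std hφ, Tri.dissect_map_std (hφ.comp isAff_halfTurn)] at hE
  obtain ⟨w', hw', e'⟩ := hbox h4
  rcases hE with ⟨j, hE⟩ | ⟨j, hE⟩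
  · have heq := (hφ.comp (Tri.isAff_child j)).eq_of_map_eq (hψ.comp (Tri.isAff_child 4)) hE
    have e := congrFun heq (-20)
    obtain rfl : j = 4 := hj (by rwa [← hφ.injective (e'.trans e.symm)])
    left
    ext z
    obtain ⟨w, rfl⟩ := hsurj z
    exact (congrFun heq w).symm
  · have heq := ((hφ.comp isAff_halfTurn).comp (Tri.isAff_child j)).eq_of_map_eq
      (hψ.comp (Tri.isAff_child 4)) hE
    have e := congrFun heq (-20)
    have hw : halfTurn (Tri.child j (-20)) ∈ box := by rwa [← hφ.injective (e'.trans e.symm)]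
    obtain rfl : j = 4 := hj (by
      obtain ⟨⟨h1, h2⟩, h3, h4⟩ := hw
      simp [halfTurn] at h1 h2 h3 h4
      exact ⟨⟨by linarith, by linarith⟩, by linarith, by linarith⟩)
    right
    ext z
    obtain ⟨w, rfl⟩ := hsurj z
    rw [IsometryEquiv.trans_apply, turn_div]
    exact (congrFun heq w).symm

/-! ### Segments -/

/-- Two overlapping segments none of which has an endpoint inside the other coincide. -/
lemma segment_endpoints_eq {u v a b p q : ℂ} (huv : u ≠ v) (hpq : p ≠ q)
    (hp : p ∈ segment ℝ u v) (hq : q ∈ segment ℝ u v) (hp' : p ∈ segment ℝ a b)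
    (hq' : q ∈ segment ℝ a b) (ha : a ∉ openSegment ℝ u v) (hb : b ∉ openSegment ℝ u v)
    (hu : u ∉ openSegment ℝ a b) (hv : v ∉ openSegment ℝ a b) : s(u, v) = s(a, b) := by
  simp only [segment_eq_image', openSegment_eq_image', mem_image, not_exists, not_and] at *
  obtain ⟨s, ⟨hs0, hs1⟩, rfl⟩ := hp
  obtain ⟨s', ⟨hs0', hs1'⟩, rfl⟩ := hq
  obtain ⟨r, ⟨hr0, hr1⟩, hr⟩ := hp'
  obtain ⟨r', ⟨hr0', hr1'⟩, hr'⟩ := hq'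
  simp only [real_smul] at *
  have hs : s' - s ≠ 0 := fun h => hpq (by rw [sub_eq_zero.1 h])
  have h1 : ((r' - r : ℝ) : ℂ) * (b - a) = ((s' - s : ℝ) : ℂ) * (v - u) := by
    push_cast
    linear_combination hr' - hr
  have hr0 : r' - r ≠ 0 := by
    intro h
    rw [h, ofReal_zero, zero_mul] at h1
    rcases mul_eq_zero.1 h1.symm with h2 | h2
    · exact hs (ofReal_eq_zero.1 h2)
    · exact huv (sub_eq_zero.1 h2).symm
  -- In the coordinate along the line with u at 0 and v at 1, the second segment runs from α to α +
  -- k. It shares two different parameters with [0, 1], and the endpoint conditions force {α, α + k}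
  -- = {0, 1}; the sign of k decides the order.
  obtain ⟨k, hk⟩ : ∃ k : ℝ, k = (s' - s) / (r' - r) := ⟨_, rfl⟩
  have hk0 : k ≠ 0 := hk ▸ div_ne_zero hs hr0
  have hks : k * (r' - r) = s' - s := by rw [hk]; field_simp
  have hba : b - a = k * (v - u) := by
    have : ((r' - r : ℝ) : ℂ) ≠ 0 := ofReal_ne_zero.2 hr0
    apply mul_left_cancel₀ this
    rw [h1, ← hks]
    push_cast
    ring
  obtain ⟨α, hα⟩ : ∃ α : ℝ, α = s - r * k := ⟨_, rfl⟩
  have ha' : a = u + α * (v - u) := by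
    rw [hα]
    push_cast
    linear_combination hr - r * hba
  have hb' : b = u + (α + k : ℝ) * (v - u) := by
    push_cast
    linear_combination hba + ha'
  have ha1 : ¬ (0 < α ∧ α < 1) := fun h => ha α h ha'.symm
  have hb1 : ¬ (0 < α + k ∧ α + k < 1) := fun h => hb _ h hb'.symm
  have hkk : (k : ℂ) ≠ 0 := ofReal_ne_zero.2 hk0
  have hu1 : ¬ (0 < -α / k ∧ -α / k < 1) := by
    refine fun h => hu _ h ?_
    rw [hba, ha']
    push_cast
    field_simp
    ring
  have hv1 : ¬ (0 < (1 - α) / k ∧ (1 - α) / k < 1) := by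
    refine fun h => hv _ h ?_
    rw [hba, ha']
    push_cast
    field_simp
    ring
  have hsα : s = α + r * k := by linarith
  have hsα' : s' = α + r' * k := by linarith
  rcases lt_or_gt_of_ne hk0 with hneg | hpos
  · have h2 (x : ℝ) : ¬ (0 < x / k ∧ x / k < 1) ↔ ¬ (x < 0 ∧ k < x) := by
      rw [div_lt_one_of_neg hneg, div_pos_iff]
      constructor
      · rintro h ⟨h3, h4⟩
        exact h ⟨Or.inr ⟨h3, hneg⟩, h4⟩
      · rintro h ⟨⟨-, h3⟩ | ⟨h3, -⟩, h4⟩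
        · linarith
        · exact h ⟨h3, h4⟩
    rw [h2] at hu1 hv1
    have e1 : α + k = 0 ∧ α = 1 := by
      have i1 : s ≤ α := by nlinarith
      have i2 : s' ≤ α := by nlinarith
      have i3 : α + k ≤ s := by nlinarith
      have i4 : α + k ≤ s' := by nlinarith
      have i5 : 0 < α := by
        by_contra h
        exact hs (by linarith)
      have i6 : α + k < 1 := by
        by_contra h
        exact hs (by linarith)
      have i7 : 1 ≤ α := by
        by_contra h
        exact ha1 ⟨i5, not_le.1 h⟩
      have i8 : α + k ≤ 0 := by
        by_contra h
        exact hb1 ⟨not_le.1 h, i6⟩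
      have i9 : 0 ≤ α + k := by
        by_contra h
        exact hu1 ⟨by linarith, by linarith⟩
      have i10 : α ≤ 1 := by
        by_contra h
        exact hv1 ⟨by linarith, by linarith⟩
      exact ⟨le_antisymm i8 i9, le_antisymm i10 i7⟩
    rw [e1.1] at hb'
    rw [e1.2] at ha'
    have : a = v := by rw [ha']; simp
    have : b = u := by rw [hb']; simp
    subst_vars
    exact Sym2.eq_swap
  · have h2 (x : ℝ) : ¬ (0 < x / k ∧ x / k < 1) ↔ ¬ (0 < x ∧ x < k) := by
      rw [div_lt_one hpos, div_pos_iff_of_pos_right hpos]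
    rw [h2] at hu1 hv1
    have e1 : α = 0 ∧ α + k = 1 := by
      have i1 : α ≤ s := by nlinarith
      have i2 : α ≤ s' := by nlinarith
      have i3 : s ≤ α + k := by nlinarith
      have i4 : s' ≤ α + k := by nlinarith
      have i5 : 0 < α + k := by
        by_contra h
        exact hs (by linarith)
      have i6 : α < 1 := by
        by_contra h
        exact hs (by linarith)
      have i7 : α ≤ 0 := by
        by_contra h
        exact ha1 ⟨not_le.1 h, i6⟩
      have i8 : 1 ≤ α + k := by
        by_contra h
        exact hb1 ⟨i5, not_le.1 h⟩
      have i9 : 0 ≤ α := by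
        by_contra h
        exact hu1 ⟨by linarith, by linarith⟩
      have i10 : α + k ≤ 1 := by
        by_contra h
        exact hv1 ⟨by linarith, by linarith⟩
      exact ⟨le_antisymm i7 i9, le_antisymm i10 i8⟩
    rw [e1.2] at hb'
    rw [e1.1] at ha'
    have : a = u := by rw [ha']; simp
    have : b = v := by rw [hb']; simp
    subst_vars
    rfl

/-- A segment that is covered by countably many sets meets one of them in two points. -/
lemma exists_pair_mem_of_segment_subset {ι : Type*} [Countable ι] {A : ι → Set ℂ} {u v : ℂ}
    (huv : u ≠ v) (h : segment ℝ u v ⊆ ⋃ i, A i) :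
    ∃ i p q, p ≠ q ∧ p ∈ segment ℝ u v ∧ q ∈ segment ℝ u v ∧ p ∈ A i ∧ q ∈ A i := by
  by_contra! hcon
  have hmem (t : Icc (0 : ℝ) 1) : u + (t : ℝ) • (v - u) ∈ segment ℝ u v := by
    rw [segment_eq_image']
    exact ⟨t, t.2, rfl⟩
  choose f hf using fun t : Icc (0 : ℝ) 1 => mem_iUnion.1 (h (hmem t))
  have hinj : Function.Injective f := by
    intro t t' htt
    by_contra hne
    refine hcon (f t) _ _ ?_ (hmem t) (hmem t') (hf t) (htt ▸ hf t')
    intro he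
    have h1 := smul_left_injective ℝ (sub_ne_zero.2 huv.symm) (add_left_cancel he)
    exact hne (Subtype.ext h1)
  have h1 : Countable (Icc (0 : ℝ) 1) := hinj.countable
  have h2 := Cardinal.mk_Icc_real (zero_lt_one (α := ℝ))
  have h3 := Cardinal.mk_le_aleph0_iff.2 h1
  rw [h2] at h3
  exact absurd h3 (not_le.2 Cardinal.aleph0_lt_continuum)

/-! ### Domino tilings: regions and vertices -/

namespace Domino

variable {h : ℂ ≃ᵢ ℂ} {d d' : Domino}

lemma frame_bounds {w : ℂ} (hw : w ∈ box) :
    (5 * d.x : ℝ) ≤ (d.origin + d.dir * w).re ∧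
      (d.origin + d.dir * w).re ≤ (5 * (d.x + d.width) : ℤ) ∧
      (5 * d.y : ℝ) ≤ (d.origin + d.dir * w).im ∧
      (d.origin + d.dir * w).im ≤ (5 * (d.y + d.height) : ℤ) := by
  obtain ⟨a, b, o⟩ := d
  obtain ⟨⟨h1, h2⟩, h3, h4⟩ := hw
  cases o <;> simp [origin, dir, width, height] <;> refine ⟨?_, ?_, ?_, ?_⟩ <;> linarith

lemma frame_bounds_interior {w : ℂ} (hw : w ∈ interior box) :
    (5 * d.x : ℝ) < (d.origin + d.dir * w).re ∧
      (d.origin + d.dir * w).re < (5 * (d.x + d.width) : ℤ) ∧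
      (5 * d.y : ℝ) < (d.origin + d.dir * w).im ∧
      (d.origin + d.dir * w).im < (5 * (d.y + d.height) : ℤ) := by
  obtain ⟨a, b, o⟩ := d
  rw [mem_interior_box] at hw
  obtain ⟨⟨h1, h2⟩, h3, h4⟩ := hw
  cases o <;> simp [origin, dir, width, height] <;> refine ⟨?_, ?_, ?_, ?_⟩ <;> linarith

lemma place_injective_div {w w' : ℂ} (e : d.place h (w / Real.sqrt 5) =
    d'.place h (w' / Real.sqrt 5)) : d.origin + d.dir * w = d'.origin + d'.dir * w' := by
  rw [place_div, place_div] at e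
  exact (div_left_inj' sqrt_five_ne_zero).1 (h.injective e)

lemma width_pos (d : Domino) : 0 < d.width := by
  cases h : d.horizontal <;> simp [width, h]

lemma height_pos (d : Domino) : 0 < d.height := by
  cases h : d.horizontal <;> simp [height, h]

end Domino

lemma IsDominoTiling.eq_of_covers {𝓓 : Set Domino} (hD : IsDominoTiling 𝓓) {d d' : Domino}
    (hd : d ∈ 𝓓) (hd' : d' ∈ 𝓓) {x y : ℤ} (hx : d.Covers x y) (hx' : d'.Covers x y) : d = d' :=
  (hD x y).unique ⟨hd, hx⟩ ⟨hd', hx'⟩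

/-- The tiling obtained from a domino tiling by placing rectangle supertiles. -/
def ofDominoes (h : ℂ ≃ᵢ ℂ) (𝓓 : Set Domino) : Set Tri := ⋃ d ∈ 𝓓, placed (d.place h)

/-- The partition of the tiling obtained from a domino tiling. -/
def rectangles (h : ℂ ≃ᵢ ℂ) (𝓓 : Set Domino) : Set (Set Tri) :=
  (fun d : Domino => placed (d.place h)) '' 𝓓

variable {h : ℂ ≃ᵢ ℂ} {𝓓 : Set Domino} {d d' : Domino} {u v : ℂ}

/-- Rectangles have their corners on the lattice, so an open one that meets a closed one shares a
whole cell with it. -/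
lemma IsDominoTiling.eq_of_mem_interior (hD : IsDominoTiling 𝓓) (hd : d ∈ 𝓓) (hd' : d' ∈ 𝓓)
    (hv : v ∈ interior (region (placed (d.place h)))) (hv' : v ∈ region (placed (d'.place h))) :
    d = d' := by
  rw [interior_region_placed] at hv
  rw [region_placed] at hv'
  obtain ⟨w, hw, rfl⟩ := hv
  obtain ⟨w', hw', e⟩ := hv'
  have e' := Domino.place_injective_div e
  obtain ⟨h1, h2, h3, h4⟩ := Domino.frame_bounds (d := d') hw'
  obtain ⟨k1, k2, k3, k4⟩ := Domino.frame_bounds_interior (d := d) hw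
  rw [e'] at h1 h2 h3 h4
  have i1 : 5 * d'.x < 5 * (d.x + d.width) := by exact_mod_cast h1.trans_lt k2
  have i2 : 5 * d.x < 5 * (d'.x + d'.width) := by exact_mod_cast k1.trans_le h2
  have i3 : 5 * d'.y < 5 * (d.y + d.height) := by exact_mod_cast h3.trans_lt k4
  have i4 : 5 * d.y < 5 * (d'.y + d'.height) := by exact_mod_cast k3.trans_le h4
  have := d.width_pos
  have := d'.width_pos
  have := d.height_pos
  have := d'.height_pos
  -- The lower left cell of the intersection of the two rectangles.
  refine hD.eq_of_covers hd hd' (x := max d.x d'.x) (y := max d.y d'.y) ?_ ?_ <;>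
    refine ⟨?_, ?_, ?_, ?_⟩ <;> omega

lemma mem_vertexSet_ofDominoes :
    v ∈ vertexSet (ofDominoes h 𝓓) ↔ ∃ d ∈ 𝓓, ∃ p ∈ nodes, v = d.place h (node p) := by
  simp only [← mem_vertexSet_placed, vertexSet, ofDominoes, mem_iUnion, exists_prop]
  grind

lemma mem_skeleton_ofDominoes :
    v ∈ skeleton (ofDominoes h 𝓓) ↔ ∃ d ∈ 𝓓, ∃ e ∈ edges,
      v ∈ segment ℝ (d.place h (node e.1)) (d.place h (node e.2)) := by
  simp only [← mem_skeleton_placed, skeleton, ofDominoes, mem_iUnion, exists_prop]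
  grind

lemma isRectanglePartition_rectangles (hD : IsDominoTiling 𝓓) :
    IsRectanglePartition (ofDominoes h 𝓓) (rectangles h 𝓓) where
  congruent := by
    rintro _ ⟨d, -, rfl⟩
    exact ⟨_, rfl⟩
  disjoint := by
    rintro _ ⟨d, hd, rfl⟩ _ ⟨d', hd', rfl⟩ hne
    refine disjoint_left.2 fun t ht ht' => hne ?_
    obtain ⟨z, hz⟩ := (nondeg_of_mem_placed ht).interior_nonempty
    have h1 : t.carrier ⊆ region (placed (d.place h)) := subset_biUnion_of_mem (u := Tri.carrier) ht
    have h2 : t.carrier ⊆ region (placed (d'.place h)) :=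
      subset_biUnion_of_mem (u := Tri.carrier) ht'
    rw [hD.eq_of_mem_interior hd hd' (interior_mono h1 hz) (h2 (interior_subset hz))]
  union := by rw [rectangles, sUnion_image, ofDominoes]

/-! ### External vertices as points of a square grid -/

/-- The points of the square grid. -/
def gridPoint (h : ℂ ≃ᵢ ℂ) (W : ℤ × ℤ) : ℂ := h (5 * (W.1 + W.2 * I) / Real.sqrt 5)

lemma gridPoint_injective (h : ℂ ≃ᵢ ℂ) : Function.Injective (gridPoint h) := by
  intro V W e
  have e1 := (div_left_inj' sqrt_five_ne_zero).1 (h.injective e)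
  have hr := congrArg re e1
  have hi := congrArg im e1
  simp at hr hi
  exact Prod.ext hr hi

/-- The position in the grid of an external vertex of the model rectangle. -/
def Domino.corner (d : Domino) (p : ℕ × ℕ) : ℤ × ℤ :=
  bif d.horizontal then (d.x + 2 - p.2 / 5, d.y + p.1 / 5) else (d.x + p.1 / 5, d.y + p.2 / 5)

lemma place_node_of_outer {p : ℕ × ℕ} (hp : p ∈ outerNodes) :
    d.place h (node p) = gridPoint h (d.corner p) := by
  rw [node_eq, Domino.place_div, Domino.frame, gridPoint]
  congr 2
  obtain ⟨a, b, o⟩ := d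
  simp only [outerNodes, blueNodes, redNodes, List.cons_append, List.nil_append, List.mem_cons,
    List.not_mem_nil, or_false] at hp
  rcases hp with rfl | rfl | rfl | rfl | rfl | rfl <;> cases o <;>
    apply Complex.ext <;> simp [Domino.origin, Domino.dir, Domino.corner] <;> ring

lemma Domino.corner_edge (d : Domino) {e : (ℕ × ℕ) × (ℕ × ℕ)} (he : e ∈ outerEdges) :
    (d.corner e.1).1 = (d.corner e.2).1 ∧
      ((d.corner e.2).2 = (d.corner e.1).2 + 1 ∨ (d.corner e.1).2 = (d.corner e.2).2 + 1) ∨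
    (d.corner e.1).2 = (d.corner e.2).2 ∧
      ((d.corner e.2).1 = (d.corner e.1).1 + 1 ∨ (d.corner e.1).1 = (d.corner e.2).1 + 1) := by
  obtain ⟨a, b, o⟩ := d
  simp only [outerEdges, List.mem_cons, List.not_mem_nil, or_false] at he
  rcases he with rfl | rfl | rfl | rfl | rfl | rfl <;> cases o <;> simp [corner] <;> omega

lemma gridPoint_notMem_openSegment (h : ℂ ≃ᵢ ℂ) {W W₁ W₂ : ℤ × ℤ}
    (hW : W₁.1 = W₂.1 ∧ (W₂.2 = W₁.2 + 1 ∨ W₁.2 = W₂.2 + 1) ∨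
      W₁.2 = W₂.2 ∧ (W₂.1 = W₁.1 + 1 ∨ W₁.1 = W₂.1 + 1)) :
    gridPoint h W ∉ openSegment ℝ (gridPoint h W₁) (gridPoint h W₂) := by
  obtain ⟨x, y⟩ := W
  obtain ⟨x₁, y₁⟩ := W₁
  obtain ⟨x₂, y₂⟩ := W₂
  have haff := isAff_scaled h
  simp only [gridPoint]
  rw [← haff.image_openSegment, Function.Injective.mem_set_image (f := fun w => h (w / Real.sqrt 5))
    haff.injective]
  rintro ⟨s, t, hs, ht, hst, e⟩
  have hr := congrArg re e
  have hi := congrArg im e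
  simp at hr hi
  obtain rfl : s = 1 - t := by linarith
  have key (m n : ℤ) (r : ℝ) (h0 : 0 < r) (h1 : r < 1) (hm : (m : ℝ) = n + r) : False := by
    have h2 : n < m := by
      have : (n : ℝ) < m := by linarith
      exact_mod_cast this
    have h3 : m < n + 1 := by
      have : (m : ℝ) < n + 1 := by linarith
      exact_mod_cast this
    omega
  simp only at hW
  rcases hW with ⟨-, rfl | rfl⟩ | ⟨-, rfl | rfl⟩ <;> push_cast at hr hi
  · exact key y y₁ t ht (by linarith) (by linarith)
  · exact key y y₂ (1 - t) hs (by linarith) (by linarith)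
  · exact key x x₁ t ht (by linarith) (by linarith)
  · exact key x x₂ (1 - t) hs (by linarith) (by linarith)

lemma outer_of_mem_outerEdges {e : (ℕ × ℕ) × (ℕ × ℕ)} (he : e ∈ outerEdges) :
    e.1 ∈ outerNodes ∧ e.2 ∈ outerNodes := by
  have h : ∀ e ∈ outerEdges, e.1 ∈ outerNodes ∧ e.2 ∈ outerNodes := by decide
  exact h e he

lemma nodes_of_mem_edges {e : (ℕ × ℕ) × (ℕ × ℕ)} (he : e ∈ edges) :
    e.1 ∈ nodes ∧ e.2 ∈ nodes ∧ e.1 ≠ e.2 := by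
  have h : ∀ e ∈ edges, e.1 ∈ nodes ∧ e.2 ∈ nodes ∧ e.1 ≠ e.2 := by decide
  exact h e he

/-- An internal edge stays away from the other rectangles. An external edge joins neighbouring
lattice points, the midpoints of the long sides being nodes of the model, so even a rectangle that
meets the side in a shifted position puts no vertex inside the edge. -/
lemma disjoint_openSegment_vertexSet (hD : IsDominoTiling 𝓓) (hd : d ∈ 𝓓)
    {e : (ℕ × ℕ) × (ℕ × ℕ)} (he : e ∈ edges) :
    Disjoint (openSegment ℝ (d.place h (node e.1)) (d.place h (node e.2)))
      (vertexSet (ofDominoes h 𝓓)) := by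
  rw [disjoint_left]
  intro z hz hzv
  obtain ⟨d', hd', p, hp, rfl⟩ := mem_vertexSet_ofDominoes.1 hzv
  rcases List.mem_append.1 he with hin | hout
  · obtain rfl := hD.eq_of_mem_interior hd hd' (inner_openSegment_subset _ hin hz)
      (map_node_mem_region _ hp)
    exact map_node_notMem_openSegment _ he hp hz
  · have hreg := frontier_region_placed_subset _
      (outer_segment_subset _ hout (openSegment_subset_segment ℝ _ _ hz))
    rcases List.mem_append.1 hp with hp' | hp'
    · obtain rfl := hD.eq_of_mem_interior hd' hd (map_node_mem_interior _ hp') hreg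
      exact map_node_notMem_openSegment _ he hp hz
    · rw [place_node_of_outer hp', place_node_of_outer (outer_of_mem_outerEdges hout).1,
        place_node_of_outer (outer_of_mem_outerEdges hout).2] at hz
      exact gridPoint_notMem_openSegment h (d.corner_edge hout) hz

instance : Countable Domino :=
  Function.Injective.countable (f := fun d : Domino => (d.x, d.y, d.horizontal))
    fun d d' e => by
      simp only [Prod.mk.injEq] at e
      exact Domino.ext e.1 e.2.1 e.2.2

/-- The edges of the graph of the tiling. -/
lemma graph_adj_iff (hD : IsDominoTiling 𝓓) : (graph (ofDominoes h 𝓓)).Adj u v ↔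
    ∃ d ∈ 𝓓, ∃ e ∈ edges, s(u, v) = s(d.place h (node e.1), d.place h (node e.2)) := by
  constructor
  · rintro ⟨hne, hu, hv, hs, hdis⟩
    -- The segment is uncountable and the placed model edges are countable, so two of its points lie
    -- on the same model edge. As neither segment has an endpoint inside the other, they coincide.
    have hcov : segment ℝ u v ⊆ ⋃ i : {i : Domino × (ℕ × ℕ) × (ℕ × ℕ) // i.1 ∈ 𝓓 ∧ i.2 ∈ edges},
        segment ℝ (i.1.1.place h (node i.1.2.1)) (i.1.1.place h (node i.1.2.2)) := by
      intro z hz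
      obtain ⟨d, hd, e, he, hze⟩ := mem_skeleton_ofDominoes.1 (hs hz)
      exact mem_iUnion.2 ⟨⟨(d, e), hd, he⟩, hze⟩
    obtain ⟨⟨⟨d, e⟩, hd, he⟩, p, q, hpq, hp, hq, hp', hq'⟩ :=
      exists_pair_mem_of_segment_subset hne hcov
    simp only at hd he hp' hq'
    refine ⟨d, hd, e, he, ?_⟩
    have hdis' := disjoint_openSegment_vertexSet (h := h) hD hd he
    refine segment_endpoints_eq hne hpq hp hq hp' hq' ?_ ?_ (disjoint_right.1 hdis' hu)
      (disjoint_right.1 hdis' hv)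
    · exact disjoint_right.1 hdis
        (mem_vertexSet_ofDominoes.2 ⟨d, hd, _, (nodes_of_mem_edges he).1, rfl⟩)
    · exact disjoint_right.1 hdis
        (mem_vertexSet_ofDominoes.2 ⟨d, hd, _, (nodes_of_mem_edges he).2.1, rfl⟩)
  · rintro ⟨d, hd, e, he, huv⟩
    have hadj : (graph (ofDominoes h 𝓓)).Adj (d.place h (node e.1)) (d.place h (node e.2)) := by
      obtain ⟨h1, h2, h3⟩ := nodes_of_mem_edges he
      refine ⟨fun hh => h3 (node_injective ((d.place h).injective hh)),
        mem_vertexSet_ofDominoes.2 ⟨d, hd, _, h1, rfl⟩,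
        mem_vertexSet_ofDominoes.2 ⟨d, hd, _, h2, rfl⟩, ?_,
        disjoint_openSegment_vertexSet hD hd he⟩
      intro z hz
      exact mem_skeleton_ofDominoes.2 ⟨d, hd, e, he, hz⟩
    rcases Sym2.eq_iff.1 huv with ⟨rfl, rfl⟩ | ⟨rfl, rfl⟩
    · exact hadj
    · exact hadj.symm

lemma segment_eq_of_sym2_eq {a b : ℂ} (e : s(u, v) = s(a, b)) :
    segment ℝ u v = segment ℝ a b ∧ openSegment ℝ u v = openSegment ℝ a b := by
  rcases Sym2.eq_iff.1 e with ⟨rfl, rfl⟩ | ⟨rfl, rfl⟩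
  · exact ⟨rfl, rfl⟩
  · exact ⟨segment_symm ℝ _ _, openSegment_symm ℝ _ _⟩

lemma openSegment_nonempty (a b : ℂ) : (openSegment ℝ a b).Nonempty :=
  ⟨_, 1 / 2, 1 / 2, by norm_num, by norm_num, by norm_num, rfl⟩

lemma openSegment_subset_region {e : (ℕ × ℕ) × (ℕ × ℕ)} (he : e ∈ edges) (φ : ℂ ≃ᵢ ℂ) :
    openSegment ℝ (φ (node e.1)) (φ (node e.2)) ⊆ region (placed φ) := by
  rcases List.mem_append.1 he with h | h
  · exact (inner_openSegment_subset φ h).trans interior_subset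
  · exact (openSegment_subset_segment ℝ _ _).trans
      ((outer_segment_subset φ h).trans (frontier_region_placed_subset φ))

lemma externalEdge_iff (hD : IsDominoTiling 𝓓) :
    ExternalEdge (ofDominoes h 𝓓) (rectangles h 𝓓) u v ↔
    ∃ d ∈ 𝓓, ∃ e ∈ outerEdges, s(u, v) = s(d.place h (node e.1), d.place h (node e.2)) := by
  constructor
  · rintro ⟨hadj, _, ⟨d', hd', rfl⟩, hR⟩
    obtain ⟨d, hd, e, he, huv⟩ := (graph_adj_iff hD).1 hadj
    refine ⟨d, hd, e, ?_, huv⟩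
    rcases List.mem_append.1 he with hin | hout
    · exfalso
      obtain ⟨z, hz⟩ := openSegment_nonempty (d.place h (node e.1)) (d.place h (node e.2))
      rw [(segment_eq_of_sym2_eq huv).1] at hR
      have h1 := inner_openSegment_subset _ hin hz
      have h2 := hR (openSegment_subset_segment ℝ _ _ hz)
      obtain rfl := hD.eq_of_mem_interior hd hd' h1 (frontier_region_placed_subset _ h2)
      exact disjoint_left.1 (disjoint_interior_frontier_region _) h1 h2
    · exact hout
  · rintro ⟨d, hd, e, he, huv⟩
    refine ⟨(graph_adj_iff hD).2 ⟨d, hd, e, List.mem_append_right _ he, huv⟩, _, ⟨d, hd, rfl⟩, ?_⟩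
    rw [(segment_eq_of_sym2_eq huv).1]
    exact outer_segment_subset _ he

lemma internalEdge_iff (hD : IsDominoTiling 𝓓) (hd : d ∈ 𝓓) :
    InternalEdge (ofDominoes h 𝓓) (placed (d.place h)) u v ↔
    ∃ e ∈ innerEdges, s(u, v) = s(d.place h (node e.1), d.place h (node e.2)) := by
  constructor
  · rintro ⟨hadj, hR⟩
    obtain ⟨d', hd', e, he, huv⟩ := (graph_adj_iff hD).1 hadj
    obtain ⟨z, hz⟩ := openSegment_nonempty (d'.place h (node e.1)) (d'.place h (node e.2))
    rw [(segment_eq_of_sym2_eq huv).2] at hR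
    obtain rfl := hD.eq_of_mem_interior hd hd' (hR hz) (openSegment_subset_region he _ hz)
    refine ⟨e, ?_, huv⟩
    rcases List.mem_append.1 he with hin | hout
    · exact hin
    · exact absurd (outer_segment_subset _ hout (openSegment_subset_segment ℝ _ _ hz))
        (disjoint_left.1 (disjoint_interior_frontier_region _) (hR hz))
  · rintro ⟨e, he, huv⟩
    refine ⟨(graph_adj_iff hD).2 ⟨d, hd, e, List.mem_append_left _ he, huv⟩, ?_⟩
    rw [(segment_eq_of_sym2_eq huv).2]
    exact inner_openSegment_subset _ he

variable {c : ℂ → Colour} {φ : ℂ ≃ᵢ ℂ} {l : Sym2 ℂ → ℕ}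

/-! ### Colourings -/

/-- The checkerboard colouring works because external edges join neighbouring lattice points. -/
lemma exists_isAlternating (hD : IsDominoTiling 𝓓) :
    ∃ c, IsAlternating (ofDominoes h 𝓓) (rectangles h 𝓓) c := by
  classical
  let c : ℂ → Colour := fun v =>
    if ∃ W : ℤ × ℤ, v = gridPoint h W ∧ Even (W.1 + W.2) then Colour.blue else Colour.red
  have hc (W : ℤ × ℤ) : c (gridPoint h W) = Colour.blue ↔ Even (W.1 + W.2) := by
    have e : (∃ W' : ℤ × ℤ, gridPoint h W = gridPoint h W' ∧ Even (W'.1 + W'.2)) ↔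
        Even (W.1 + W.2) := by
      constructor
      · rintro ⟨W', e, hW'⟩
        rwa [gridPoint_injective h e]
      · exact fun hW => ⟨W, rfl, hW⟩
    simp only [c, e]
    split_ifs with hW <;> simp [hW]
  refine ⟨c, fun u v huv => ?_⟩
  obtain ⟨d, hd, e, he, huv⟩ := (externalEdge_iff hD).1 huv
  rw [place_node_of_outer (outer_of_mem_outerEdges he).1,
    place_node_of_outer (outer_of_mem_outerEdges he).2] at huv
  have key : c (gridPoint h (d.corner e.1)) ≠ c (gridPoint h (d.corner e.2)) := by
    intro heq
    have h1 := hc (d.corner e.1)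
    have h2 := hc (d.corner e.2)
    rw [heq, h2] at h1
    have h3 := d.corner_edge he
    simp only [Int.even_iff] at h1
    omega
  rcases Sym2.eq_iff.1 huv with ⟨rfl, rfl⟩ | ⟨rfl, rfl⟩
  · exact key
  · exact key.symm

lemma IsAlternating.ne_of_mem (hc : IsAlternating (ofDominoes h 𝓓) (rectangles h 𝓓) c)
    (hD : IsDominoTiling 𝓓) (hd : d ∈ 𝓓) {e : (ℕ × ℕ) × (ℕ × ℕ)} (he : e ∈ outerEdges) :
    c (d.place h (node e.1)) ≠ c (d.place h (node e.2)) :=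
  hc _ _ ((externalEdge_iff hD).2 ⟨d, hd, e, he, rfl⟩)

/-- Five consecutive edges of the boundary hexagon fix its colouring up to the exchange of colours.
The second alternative lists the nodes in the order in which the half-turn permutes them. -/
lemma Colour.alternate {p q r x y z : Colour} (h1 : p ≠ x) (h2 : r ≠ x) (h3 : r ≠ y) (h4 : q ≠ y)
    (h5 : q ≠ z) :
    ((p = blue ∧ q = blue ∧ r = blue) ∧ x = red ∧ y = red ∧ z = red) ∨
      (y = blue ∧ x = blue ∧ z = blue) ∧ q = red ∧ p = red ∧ r = red := by
  cases p <;> cases q <;> cases r <;> cases x <;> cases y <;> cases z <;> simp_all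

lemma matches_iff : Matches c φ ↔
    (c (φ (node (0, 0))) = Colour.blue ∧ c (φ (node (0, 10))) = Colour.blue ∧
      c (φ (node (5, 5))) = Colour.blue) ∧
    (c (φ (node (5, 0))) = Colour.red ∧ c (φ (node (5, 10))) = Colour.red ∧
      c (φ (node (0, 5))) = Colour.red) := by
  simp [Matches, blueNodes, redNodes]

/-- The two placements of a rectangle differ by the half-turn, which exchanges the colours of the
model: the blue node (0, 0) goes to the red node (5, 10). -/
lemma existsUnique_matches (hD : IsDominoTiling 𝓓)
    (hc : IsAlternating (ofDominoes h 𝓓) (rectangles h 𝓓) c) {R : Set Tri}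
    (hR : R ∈ rectangles h 𝓓) : ∃! φ : ℂ ≃ᵢ ℂ, placed φ = R ∧ Matches c φ := by
  obtain ⟨d, hd, rfl⟩ := hR
  refine existsUnique_of_exists_of_unique ?_ ?_
  · have h1 := hc.ne_of_mem hD hd (e := ((0, 0), (5, 0))) (by decide)
    have h2 := hc.ne_of_mem hD hd (e := ((5, 5), (5, 0))) (by decide)
    have h3 := hc.ne_of_mem hD hd (e := ((5, 5), (5, 10))) (by decide)
    have h4 := hc.ne_of_mem hD hd (e := ((0, 10), (5, 10))) (by decide)
    have h5 := hc.ne_of_mem hD hd (e := ((0, 10), (0, 5))) (by decide)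
    rcases Colour.alternate h1 h2 h3 h4 h5 with hb | hb
    · exact ⟨d.place h, rfl, matches_iff.2 hb⟩
    · refine ⟨turn.trans (d.place h), placed_turn _, matches_iff.2 ?_⟩
      simp only [IsometryEquiv.trans_apply]
      rw [turn_node (by decide), turn_node (by decide), turn_node (by decide),
        turn_node (by decide), turn_node (by decide), turn_node (by decide)]
      exact hb
  · rintro φ ψ ⟨h1, h2⟩ ⟨h3, h4⟩
    rcases eq_or_eq_turn_of_placed_eq (h1.trans h3.symm) with e | e
    · exact e
    · have h5 := (matches_iff.1 h2).1.1
      have h6 := (matches_iff.1 h4).2.2.1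
      rw [e, IsometryEquiv.trans_apply, turn_node (by decide)] at h5
      exact absurd (h5.symm.trans h6) (by simp)

/-! ### Internal edges and group sums -/

/-- The placement that respects the colours need not be the one attached to the domino; the list of
internal edges is invariant under the half-turn, so either placement describes them. -/
lemma internalEdge_placed_iff (hD : IsDominoTiling 𝓓) (hφ : placed φ ∈ rectangles h 𝓓) :
    InternalEdge (ofDominoes h 𝓓) (placed φ) u v ↔
      ∃ e ∈ innerEdges, s(u, v) = s(φ (node e.1), φ (node e.2)) := by
  have ht : ∀ e ∈ innerEdges, HasPair innerEdges (turnNode e.1) (turnNode e.2) ∧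
      turnNode (turnNode e.1) = e.1 ∧ turnNode (turnNode e.2) = e.2 := by decide
  obtain ⟨d, hd, e⟩ := hφ
  simp only at e
  rw [← e, internalEdge_iff hD hd]
  have key (φ : ℂ ≃ᵢ ℂ) : (∃ e ∈ innerEdges, s(u, v) = s(φ (node e.1), φ (node e.2))) →
      ∃ e ∈ innerEdges, s(u, v) = s(turn.trans φ (node e.1), turn.trans φ (node e.2)) := by
    rintro ⟨e, he, huv⟩
    obtain ⟨h1, h2, h3⟩ := ht e he
    have hn (e) (he : e ∈ innerEdges) := nodes_of_mem_edges (List.mem_append_left outerEdges he)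
    simp only [IsometryEquiv.trans_apply]
    rcases h1 with h1 | h1
    · refine ⟨_, h1, ?_⟩
      rw [turn_node (hn _ h1).1, turn_node (hn _ h1).2.1, h2, h3, huv]
    · refine ⟨_, h1, ?_⟩
      rw [turn_node (hn _ h1).1, turn_node (hn _ h1).2.1, h2, h3, huv, Sym2.eq_swap]
  rcases eq_or_eq_turn_of_placed_eq e with rfl | e'
  · rfl
  · rw [e']
    refine ⟨fun hh => ?_, key φ⟩
    have := key _ hh
    have e2 : turn.trans (turn.trans φ) = φ := by
      ext z
      simp only [IsometryEquiv.trans_apply]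
      congr 1
      simp [turn]
    rwa [e2] at this

/-- The neighbours of a node of the model rectangle along internal edges. -/
def innerNbrs (p : ℕ × ℕ) : Finset (ℕ × ℕ) := (nodes.filter fun q => HasPair innerEdges p q).toFinset

/-- The weight of an internal edge of the model rectangle. -/
def modelWeight (p q : ℕ × ℕ) : ℕ :=
  ((internalWeights.filter fun e => (e.1, e.2.1) = (p, q) ∨ (e.1, e.2.1) = (q, p)).map
    fun e => e.2.2).sum

lemma mem_innerNbrs {p q : ℕ × ℕ} : q ∈ innerNbrs p ↔ HasPair innerEdges p q := by
  have hn (e) (he : e ∈ innerEdges) := nodes_of_mem_edges (List.mem_append_left outerEdges he)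
  simp only [innerNbrs, List.mem_toFinset, List.mem_filter, decide_eq_true_eq,
    and_iff_right_iff_imp]
  rintro (h | h)
  · exact (hn _ h).2.1
  · exact (hn _ h).1

lemma internalEdge_set_eq (hD : IsDominoTiling 𝓓) (hφ : placed φ ∈ rectangles h 𝓓) (p : ℕ × ℕ) :
    {u | InternalEdge (ofDominoes h 𝓓) (placed φ) (φ (node p)) u} =
      (fun q => φ (node q)) '' (innerNbrs p : Set (ℕ × ℕ)) := by
  have hinj : Function.Injective fun q => φ (node q) := φ.injective.comp node_injective
  ext u
  simp only [mem_ofPred_eq, internalEdge_placed_iff hD hφ, mem_image, Finset.mem_coe, mem_innerNbrs]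
  constructor
  · rintro ⟨e, he, huv⟩
    rcases Sym2.eq_iff.1 huv with ⟨h1, rfl⟩ | ⟨h1, rfl⟩
    · exact ⟨e.2, Or.inl (hinj h1 ▸ he), rfl⟩
    · exact ⟨e.1, Or.inr (hinj h1 ▸ he), rfl⟩
  · rintro ⟨q, hq | hq, rfl⟩
    · exact ⟨_, hq, rfl⟩
    · exact ⟨_, hq, Sym2.eq_swap⟩

lemma IsPrescribed.label_inner (hl : IsPrescribed (ofDominoes h 𝓓) (rectangles h 𝓓) c l)
    (hφ : placed φ ∈ rectangles h 𝓓) (hm : Matches c φ) {p q : ℕ × ℕ}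
    (hpq : HasPair innerEdges p q) : l s(φ (node p), φ (node q)) = modelWeight p q := by
  have hw : ∀ e ∈ internalWeights, modelWeight e.1 e.2.1 = e.2.2 ∧
      modelWeight e.2.1 e.1 = e.2.2 := by decide
  rcases hpq with hpq | hpq <;> obtain ⟨e, he, he'⟩ := List.mem_map.1 hpq <;>
    obtain ⟨rfl, rfl⟩ := Prod.mk.inj he'
  · rw [hl.internal φ hφ hm e he, (hw e he).1]
  · rw [Sym2.eq_swap, hl.internal φ hφ hm e he, (hw e he).2]

lemma groupSum_placed (hD : IsDominoTiling 𝓓)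
    (hl : IsPrescribed (ofDominoes h 𝓓) (rectangles h 𝓓) c l)
    (hφ : placed φ ∈ rectangles h 𝓓) (hm : Matches c φ) (p : ℕ × ℕ) :
    groupSum (ofDominoes h 𝓓) l (placed φ) (φ (node p)) =
      ∑ q ∈ innerNbrs p, modelWeight p q := by
  have hinj : Function.Injective fun q => φ (node q) := φ.injective.comp node_injective
  rw [groupSum, internalEdge_set_eq hD hφ, finsum_mem_image hinj.injOn, finsum_mem_coe_finset]
  exact Finset.sum_congr rfl fun q hq => hl.label_inner hφ hm (mem_innerNbrs.1 hq)

/-! ### Existence of the labelling -/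

lemma exists_isPrescribed (hD : IsDominoTiling 𝓓)
    (hc : IsAlternating (ofDominoes h 𝓓) (rectangles h 𝓓) c) :
    ∃ l, IsPrescribed (ofDominoes h 𝓓) (rectangles h 𝓓) c l := by
  classical
  let P (s : Sym2 ℂ) (e : (ℕ × ℕ) × (ℕ × ℕ) × ℕ) : Prop := e ∈ internalWeights ∧
    ∃ φ : ℂ ≃ᵢ ℂ, placed φ ∈ rectangles h 𝓓 ∧ Matches c φ ∧ s = s(φ (node e.1), φ (node e.2.1))
  have hinner {e : (ℕ × ℕ) × (ℕ × ℕ) × ℕ} (he : e ∈ internalWeights) :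
      (e.1, e.2.1) ∈ innerEdges := List.mem_map.2 ⟨e, he, rfl⟩
  -- Interior points of the edge determine its rectangle, the colours determine the placement, and
  -- the placement is injective on nodes, so the prescribed weight is well defined.
  have huniq {s e e'} (hs : P s e) (hs' : P s e') : e.2.2 = e'.2.2 := by
    have hw : ∀ e ∈ internalWeights, ∀ e' ∈ internalWeights,
        e.1 = e'.1 ∧ e.2.1 = e'.2.1 ∨ e.1 = e'.2.1 ∧ e.2.1 = e'.1 → e.2.2 = e'.2.2 := by decide
    obtain ⟨he, φ, hφ, hm, rfl⟩ := hs
    obtain ⟨he', φ', hφ', hm', hs⟩ := hs'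
    obtain ⟨z, hz⟩ := openSegment_nonempty (φ (node e.1)) (φ (node e.2.1))
    have h1 := inner_openSegment_subset φ (hinner he) hz
    rw [(segment_eq_of_sym2_eq hs).2] at hz
    have h2 := inner_openSegment_subset φ' (hinner he') hz
    have hR : placed φ = placed φ' := by
      obtain ⟨d, hd, hdφ⟩ := hφ
      obtain ⟨d', hd', hdφ'⟩ := hφ'
      simp only at hdφ hdφ'
      rw [← hdφ] at h1
      rw [← hdφ'] at h2
      rw [← hdφ, ← hdφ', hD.eq_of_mem_interior hd hd' h1 (interior_subset h2)]
    obtain rfl := (existsUnique_matches hD hc hφ').unique ⟨hR, hm⟩ ⟨rfl, hm'⟩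
    have hinj : Function.Injective fun q => φ (node q) := φ.injective.comp node_injective
    refine hw e he e' he' ?_
    rcases Sym2.eq_iff.1 hs with ⟨k1, k2⟩ | ⟨k1, k2⟩
    · exact Or.inl ⟨hinj k1, hinj k2⟩
    · exact Or.inr ⟨hinj k1, hinj k2⟩
  -- The default 3 is the weight of the external edges, none of which is an internal edge of a
  -- rectangle.
  refine ⟨fun s => if hs : ∃ e, P s e then hs.choose.2.2 else 3, ?_, ?_⟩
  · intro u v huv
    have hno : ¬ ∃ e, P s(u, v) e := by
      rintro ⟨e, he, φ, hφ, hm, hs⟩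
      obtain ⟨d, hd, e', he', hs'⟩ := (externalEdge_iff hD).1 huv
      obtain ⟨z, hz⟩ := openSegment_nonempty u v
      have h1 := hz
      have h2 := openSegment_subset_segment ℝ _ _ hz
      rw [(segment_eq_of_sym2_eq hs).2] at h1
      rw [(segment_eq_of_sym2_eq hs').1] at h2
      have h1 := inner_openSegment_subset φ (hinner he) h1
      have h2 := outer_segment_subset _ he' h2
      obtain ⟨d', hd', hdφ⟩ := hφ
      simp only at hdφ
      rw [← hdφ] at h1
      obtain rfl := hD.eq_of_mem_interior hd' hd h1 (frontier_region_placed_subset _ h2)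
      exact disjoint_left.1 (disjoint_interior_frontier_region _) h1 h2
    simp only [dif_neg hno]
  · intro φ hφ hm e he
    have hs : ∃ e', P s(φ (node e.1), φ (node e.2.1)) e' := ⟨e, he, φ, hφ, hm, rfl⟩
    simp only [dif_pos hs]
    exact huniq hs.choose_spec ⟨he, φ, hφ, hm, rfl⟩

/-! ### External vertices -/

/-- A 1 × 2 rectangle on the lattice contains exactly six lattice points, all on its boundary, and
these are the external nodes. -/
lemma Domino.exists_corner_eq {W : ℤ × ℤ} (hW : gridPoint h W ∈ region (placed (d.place h))) :
    ∃ p ∈ outerNodes, W = d.corner p := by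
  rw [region_placed] at hW
  obtain ⟨w, hw, e⟩ := hW
  simp only at e
  rw [place_div, frame, gridPoint] at e
  have e' := (div_left_inj' sqrt_five_ne_zero).1 (h.injective e)
  obtain ⟨h1, h2, h3, h4⟩ := frame_bounds (d := d) hw
  rw [e'] at h1 h2 h3 h4
  simp at h1 h2 h3 h4
  norm_cast at h1 h2 h3 h4
  obtain ⟨a, b, o⟩ := d
  obtain ⟨x, y⟩ := W
  simp only [outerNodes, blueNodes, redNodes, List.cons_append, List.nil_append, List.mem_cons,
    List.not_mem_nil, or_false, exists_eq_or_imp, exists_eq_left]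
  cases o <;> simp [width, height, corner] at h1 h2 h3 h4 ⊢ <;> omega

lemma Domino.exists_corner_of_covers {x y : ℤ} (hd : d.Covers x y) {W : ℤ × ℤ}
    (hx : W.1 = x ∨ W.1 = x + 1) (hy : W.2 = y ∨ W.2 = y + 1) :
    ∃ p ∈ outerNodes, W = d.corner p := by
  obtain ⟨a, b, o⟩ := d
  obtain ⟨X, Y⟩ := W
  obtain ⟨h1, h2, h3, h4⟩ := hd
  simp only [outerNodes, blueNodes, redNodes, List.cons_append, List.nil_append, List.mem_cons,
    List.not_mem_nil, or_false, exists_eq_or_imp, exists_eq_left]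
  cases o <;> simp [width, height, corner] at h1 h2 h3 h4 hx hy ⊢ <;> omega

lemma Domino.covers_of_corner {p : ℕ × ℕ} (hp : p ∈ outerNodes) :
    ∃ x y : ℤ, d.Covers x y ∧ ((d.corner p).1 = x ∨ (d.corner p).1 = x + 1) ∧
      ((d.corner p).2 = y ∨ (d.corner p).2 = y + 1) := by
  obtain ⟨a, b, o⟩ := d
  simp only [outerNodes, blueNodes, redNodes, List.cons_append, List.nil_append, List.mem_cons,
    List.not_mem_nil, or_false] at hp
  cases o
  · rcases hp with rfl | rfl | rfl | rfl | rfl | rfl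
    · exact ⟨a, b, by simp [Covers, width, height, corner]⟩
    · exact ⟨a, b + 1, by simp [Covers, width, height, corner]; omega⟩
    · exact ⟨a, b, by simp [Covers, width, height, corner]⟩
    · exact ⟨a, b, by simp [Covers, width, height, corner]⟩
    · exact ⟨a, b + 1, by simp [Covers, width, height, corner]; omega⟩
    · exact ⟨a, b, by simp [Covers, width, height, corner]⟩
  · rcases hp with rfl | rfl | rfl | rfl | rfl | rfl
    · exact ⟨a + 1, b, by simp [Covers, width, height, corner]; omega⟩
    · exact ⟨a, b, by simp [Covers, width, height, corner]⟩
    · exact ⟨a, b, by simp [Covers, width, height, corner]; omega⟩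
    · exact ⟨a + 1, b, by simp [Covers, width, height, corner]; omega⟩
    · exact ⟨a, b, by simp [Covers, width, height, corner]⟩
    · exact ⟨a, b, by simp [Covers, width, height, corner]; omega⟩

lemma exists_gridPoint_of_mem_frontier (hD : IsDominoTiling 𝓓) (hd : d ∈ 𝓓)
    (hv : v ∈ vertexSet (ofDominoes h 𝓓)) (hf : v ∈ frontier (region (placed (d.place h)))) :
    ∃ p ∈ outerNodes, v = d.place h (node p) := by
  obtain ⟨d', hd', p, hp, rfl⟩ := mem_vertexSet_ofDominoes.1 hv
  have hr := frontier_region_placed_subset _ hf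
  rcases List.mem_append.1 hp with hp' | hp'
  · have h1 := map_node_mem_interior (d'.place h) hp'
    obtain rfl := hD.eq_of_mem_interior hd' hd h1 hr
    exact absurd hf (disjoint_left.1 (disjoint_interior_frontier_region _) h1)
  · rw [place_node_of_outer hp'] at hr ⊢
    obtain ⟨q, hq, e⟩ := Domino.exists_corner_eq hr
    exact ⟨q, hq, by rw [place_node_of_outer hq, e]⟩

lemma turnNode_mem_outerNodes {p : ℕ × ℕ} (hp : p ∈ outerNodes) :
    turnNode p ∈ outerNodes ∧ turnNode (turnNode p) = p := by
  have h : ∀ p ∈ outerNodes, turnNode p ∈ outerNodes ∧ turnNode (turnNode p) = p := by decide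
  exact h p hp

lemma exists_outerNode_of_mem_frontier (hD : IsDominoTiling 𝓓) (hφ : placed φ ∈ rectangles h 𝓓)
    (hv : v ∈ vertexSet (ofDominoes h 𝓓)) (hf : v ∈ frontier (region (placed φ))) :
    ∃ p ∈ outerNodes, v = φ (node p) := by
  obtain ⟨d, hd, e⟩ := hφ
  simp only at e
  rw [← e] at hf
  obtain ⟨p, hp, rfl⟩ := exists_gridPoint_of_mem_frontier hD hd hv hf
  rcases eq_or_eq_turn_of_placed_eq e with e' | e'
  · exact ⟨p, hp, by rw [e']⟩
  · refine ⟨turnNode p, (turnNode_mem_outerNodes hp).1, ?_⟩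
    rw [e', IsometryEquiv.trans_apply, turn_node (List.mem_append_right _ hp)]

/-- In the placement that respects the colours the sum can be read off from the model, where each of
the six external nodes is checked. -/
lemma groupSum_eq (hD : IsDominoTiling 𝓓)
    (hc : IsAlternating (ofDominoes h 𝓓) (rectangles h 𝓓) c)
    (hl : IsPrescribed (ofDominoes h 𝓓) (rectangles h 𝓓) c l) {R : Set Tri}
    (hR : R ∈ rectangles h 𝓓) (hv : v ∈ vertexSet (ofDominoes h 𝓓))
    (hf : v ∈ frontier (region R)) :
    (c v = Colour.red → groupSum (ofDominoes h 𝓓) l R v = 2) ∧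
      (c v = Colour.blue → groupSum (ofDominoes h 𝓓) l R v = 3) := by
  obtain ⟨φ, ⟨rfl, hm⟩, -⟩ := existsUnique_matches hD hc hR
  obtain ⟨p, hp, rfl⟩ := exists_outerNode_of_mem_frontier hD hR hv hf
  rw [groupSum_placed hD hl hR hm]
  have hb : ∀ p ∈ blueNodes, ∑ q ∈ innerNbrs p, modelWeight p q = 3 := by decide
  have hr : ∀ p ∈ redNodes, ∑ q ∈ innerNbrs p, modelWeight p q = 2 := by decide
  rcases List.mem_append.1 hp with hp | hp
  · rw [hm.1 p hp]
    exact ⟨fun h => by simp at h, fun _ => hb p hp⟩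
  · rw [hm.2 p hp]
    exact ⟨fun _ => hr p hp, fun h => by simp at h⟩


/-! ### External edges at a grid point -/

/-- The domino that covers a unit square. -/
def IsDominoTiling.dom (hD : IsDominoTiling 𝓓) (x y : ℤ) : Domino := (hD x y).choose

lemma IsDominoTiling.dom_mem (hD : IsDominoTiling 𝓓) (x y : ℤ) : hD.dom x y ∈ 𝓓 :=
  (hD x y).choose_spec.1.1

lemma IsDominoTiling.dom_covers (hD : IsDominoTiling 𝓓) (x y : ℤ) : (hD.dom x y).Covers x y :=
  (hD x y).choose_spec.1.2

lemma IsDominoTiling.eq_dom_iff (hD : IsDominoTiling 𝓓) (hd : d ∈ 𝓓) {x y : ℤ} :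
    d = hD.dom x y ↔ d.Covers x y :=
  ⟨fun e => e ▸ hD.dom_covers x y, fun hc => hD.eq_of_covers hd (hD.dom_mem x y) hc
    (hD.dom_covers x y)⟩

/-- The boundary of a union of cells consists of the unit segments that have exactly one of their
two adjacent cells in the union. -/
lemma Domino.exists_horizontal_edge_iff {x y : ℤ} :
    (∃ e ∈ outerEdges, s((x, y), (x + 1, y)) = s(d.corner e.1, d.corner e.2)) ↔
      (d.Covers x y ∧ ¬ d.Covers x (y - 1)) ∨ (d.Covers x (y - 1) ∧ ¬ d.Covers x y) := by
  obtain ⟨a, b, o⟩ := d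
  constructor
  · rintro ⟨e, he, hs⟩
    simp only [outerEdges, List.mem_cons, List.not_mem_nil, or_false] at he
    rcases Sym2.eq_iff.1 hs with ⟨h1, h2⟩ | ⟨h1, h2⟩ <;>
      rcases he with rfl | rfl | rfl | rfl | rfl | rfl <;> cases o <;>
      simp [width, height, corner, Covers] at h1 h2 ⊢ <;> omega
  · intro hc
    cases o <;> simp only [width, height, Covers, cond_true, cond_false] at hc
    · rcases (by omega : x = a ∧ y = b ∨ x = a ∧ y = b + 2) with
        ⟨rfl, rfl⟩ | ⟨rfl, rfl⟩
      · exact ⟨((0, 0), (5, 0)), by decide, by simp [corner]⟩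
      · exact ⟨((0, 10), (5, 10)), by decide, by simp [corner]⟩
    · rcases (by omega : x = a ∧ y = b ∨ x = a + 1 ∧ y = b ∨ x = a ∧ y = b + 1 ∨ x = a + 1 ∧ y = b + 1) with
        ⟨rfl, rfl⟩ | ⟨rfl, rfl⟩ | ⟨rfl, rfl⟩ | ⟨rfl, rfl⟩
      · exact ⟨((0, 10), (0, 5)), by decide, by simp [corner]; omega⟩
      · exact ⟨((0, 0), (0, 5)), by decide, by simp [corner]; omega⟩
      · exact ⟨((5, 5), (5, 10)), by decide, by simp [corner]; omega⟩
      · exact ⟨((5, 5), (5, 0)), by decide, by simp [corner]; omega⟩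

lemma Domino.exists_vertical_edge_iff {x y : ℤ} :
    (∃ e ∈ outerEdges, s((x, y), (x, y + 1)) = s(d.corner e.1, d.corner e.2)) ↔
      (d.Covers x y ∧ ¬ d.Covers (x - 1) y) ∨ (d.Covers (x - 1) y ∧ ¬ d.Covers x y) := by
  obtain ⟨a, b, o⟩ := d
  constructor
  · rintro ⟨e, he, hs⟩
    simp only [outerEdges, List.mem_cons, List.not_mem_nil, or_false] at he
    rcases Sym2.eq_iff.1 hs with ⟨h1, h2⟩ | ⟨h1, h2⟩ <;>
      rcases he with rfl | rfl | rfl | rfl | rfl | rfl <;> cases o <;>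
      simp [width, height, corner, Covers] at h1 h2 ⊢ <;> omega
  · intro hc
    cases o <;> simp only [width, height, Covers, cond_true, cond_false] at hc
    · rcases (by omega : x = a ∧ y = b ∨ x = a ∧ y = b + 1 ∨ x = a + 1 ∧ y = b ∨ x = a + 1 ∧ y = b + 1) with
        ⟨rfl, rfl⟩ | ⟨rfl, rfl⟩ | ⟨rfl, rfl⟩ | ⟨rfl, rfl⟩
      · exact ⟨((0, 0), (0, 5)), by decide, by simp [corner]⟩
      · exact ⟨((0, 10), (0, 5)), by decide, by simp [corner]; omega⟩
      · exact ⟨((5, 5), (5, 0)), by decide, by simp [corner]⟩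
      · exact ⟨((5, 5), (5, 10)), by decide, by simp [corner]; omega⟩
    · rcases (by omega : x = a ∧ y = b ∨ x = a + 2 ∧ y = b) with
        ⟨rfl, rfl⟩ | ⟨rfl, rfl⟩
      · exact ⟨((0, 10), (5, 10)), by decide, by simp [corner]⟩
      · exact ⟨((0, 0), (5, 0)), by decide, by simp [corner]⟩

lemma externalEdge_comm {T : Set Tri} {𝓡 : Set (Set Tri)} :
    ExternalEdge T 𝓡 u v ↔ ExternalEdge T 𝓡 v u := by
  simp only [ExternalEdge, SimpleGraph.adj_comm _ u v, segment_symm ℝ u v]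

lemma externalEdge_gridPoint_iff (hD : IsDominoTiling 𝓓) {W W' : ℤ × ℤ} :
    ExternalEdge (ofDominoes h 𝓓) (rectangles h 𝓓) (gridPoint h W) (gridPoint h W') ↔
      ∃ d ∈ 𝓓, ∃ e ∈ outerEdges, s(W, W') = s(d.corner e.1, d.corner e.2) := by
  rw [externalEdge_iff hD]
  have key (d : Domino) {e : (ℕ × ℕ) × (ℕ × ℕ)} (he : e ∈ outerEdges) :
      s(gridPoint h W, gridPoint h W') = s(d.place h (node e.1), d.place h (node e.2)) ↔
        s(W, W') = s(d.corner e.1, d.corner e.2) := by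
    rw [place_node_of_outer (outer_of_mem_outerEdges he).1,
      place_node_of_outer (outer_of_mem_outerEdges he).2]
    simp only [Sym2.eq_iff, (gridPoint_injective h).eq_iff]
  constructor
  · rintro ⟨d, hd, e, he, hh⟩
    exact ⟨d, hd, e, he, (key d he).1 hh⟩
  · rintro ⟨d, hd, e, he, hh⟩
    exact ⟨d, hd, e, he, (key d he).2 hh⟩

/-- A side shared by two squares is a side of a domino if the squares are in different dominoes. -/
lemma IsDominoTiling.exists_side_iff (hD : IsDominoTiling 𝓓) {x y x' y' : ℤ} :
    (∃ d ∈ 𝓓, (d.Covers x y ∧ ¬ d.Covers x' y') ∨ (d.Covers x' y' ∧ ¬ d.Covers x y)) ↔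
      hD.dom x' y' ≠ hD.dom x y := by
  constructor
  · rintro ⟨d, hd, hh⟩ e
    rw [← hD.eq_dom_iff hd, ← hD.eq_dom_iff hd, e] at hh
    tauto
  · intro hne
    refine ⟨hD.dom x y, hD.dom_mem x y, Or.inl ⟨hD.dom_covers x y, fun hc => hne ?_⟩⟩
    exact ((hD.eq_dom_iff (hD.dom_mem x y)).2 hc).symm

lemma externalEdge_right_iff (hD : IsDominoTiling 𝓓) (x y : ℤ) :
    ExternalEdge (ofDominoes h 𝓓) (rectangles h 𝓓) (gridPoint h (x, y)) (gridPoint h (x + 1, y)) ↔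
      hD.dom x (y - 1) ≠ hD.dom x y := by
  rw [externalEdge_gridPoint_iff hD, ← hD.exists_side_iff]
  simp only [Domino.exists_horizontal_edge_iff]

lemma externalEdge_up_iff (hD : IsDominoTiling 𝓓) (x y : ℤ) :
    ExternalEdge (ofDominoes h 𝓓) (rectangles h 𝓓) (gridPoint h (x, y)) (gridPoint h (x, y + 1)) ↔
      hD.dom (x - 1) y ≠ hD.dom x y := by
  rw [externalEdge_gridPoint_iff hD, ← hD.exists_side_iff]
  simp only [Domino.exists_vertical_edge_iff]

/-- The four neighbours in the grid. -/
def gridNbrs (W : ℤ × ℤ) : Finset (ℤ × ℤ) :=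
  {(W.1 + 1, W.2), (W.1, W.2 + 1), (W.1 - 1, W.2), (W.1, W.2 - 1)}

open Classical in
/-- The neighbours of a grid point along external edges. -/
def externalNbrs (h : ℂ ≃ᵢ ℂ) (𝓓 : Set Domino) (W : ℤ × ℤ) : Finset (ℤ × ℤ) :=
  (gridNbrs W).filter fun W' =>
    ExternalEdge (ofDominoes h 𝓓) (rectangles h 𝓓) (gridPoint h W) (gridPoint h W')

open Classical in
/-- The dominoes around a grid point. -/
def IsDominoTiling.around (hD : IsDominoTiling 𝓓) (W : ℤ × ℤ) : Finset Domino :=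
  {hD.dom W.1 W.2, hD.dom (W.1 - 1) W.2, hD.dom (W.1 - 1) (W.2 - 1), hD.dom W.1 (W.2 - 1)}

lemma externalEdge_set_eq (hD : IsDominoTiling 𝓓) (W : ℤ × ℤ) :
    {u | ExternalEdge (ofDominoes h 𝓓) (rectangles h 𝓓) (gridPoint h W) u} =
      gridPoint h '' (externalNbrs h 𝓓 W : Set (ℤ × ℤ)) := by
  ext u
  simp only [mem_ofPred_eq, mem_image, externalNbrs, Finset.coe_filter]
  constructor
  · intro hu
    obtain ⟨d, hd, e, he, hs⟩ := (externalEdge_iff hD).1 hu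
    obtain ⟨W', rfl⟩ : ∃ W', u = gridPoint h W' := by
      rw [place_node_of_outer (outer_of_mem_outerEdges he).1,
        place_node_of_outer (outer_of_mem_outerEdges he).2] at hs
      rcases Sym2.eq_iff.1 hs with ⟨-, e'⟩ | ⟨-, e'⟩
      · exact ⟨_, e'⟩
      · exact ⟨_, e'⟩
    refine ⟨W', ⟨?_, hu⟩, rfl⟩
    obtain ⟨d, hd, e, he, hs⟩ := (externalEdge_gridPoint_iff hD).1 hu
    have hc := d.corner_edge he
    simp only [gridNbrs, Finset.mem_insert, Finset.mem_singleton]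
    rcases Sym2.eq_iff.1 hs with ⟨e1, e2⟩ | ⟨e1, e2⟩ <;> rw [← e1, ← e2] at hc <;>
      simp only [Prod.ext_iff] <;> omega
  · rintro ⟨W', ⟨-, hW⟩, rfl⟩
    exact hW

/-- A domino is one cell wide. This forces at least two dominoes around each lattice point and
prevents opposite cells from being identified in the count. -/
lemma Domino.not_covers_diagonal {x y : ℤ} :
    ¬ (d.Covers x y ∧ d.Covers (x - 1) (y - 1)) ∧ ¬ (d.Covers (x - 1) y ∧ d.Covers x (y - 1)) := by
  obtain ⟨a, b, o⟩ := d
  cases o <;> simp [Covers, width, height] <;> omega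

-- Read a, b, c, d in cyclic order. As opposite entries differ, equal entries are adjacent, and the
-- number of different entries equals the number of changes around the cycle.
open Classical in
lemma card_four {α : Type*} {a b c d : α} (hac : a ≠ c) (hbd : b ≠ d) :
    ({a, b, c, d} : Finset α).card = (if d ≠ a then 1 else 0) + ((if b ≠ a then 1 else 0) +
      ((if c ≠ b then 1 else 0) + if c ≠ d then 1 else 0)) ∧
    ({a, b, c, d} : Finset α).card ∈ ({2, 3, 4} : Set ℕ) := by
  by_cases h1 : a = b <;> by_cases h2 : b = c <;> by_cases h3 : c = d <;> by_cases h4 : a = d <;>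
    simp_all [Finset.card_insert_of_notMem, eq_comm]

/-- The four grid edges at a lattice point separate cyclically consecutive cells, and each is
external exactly if its two cells are in different dominoes. So external edges count the changes
around the point. -/
lemma card_externalNbrs (hD : IsDominoTiling 𝓓) (W : ℤ × ℤ) :
    (hD.around W).card = (externalNbrs h 𝓓 W).card ∧ (hD.around W).card ∈ ({2, 3, 4} : Set ℕ) := by
  classical
  obtain ⟨x, y⟩ := W
  have h1 : hD.dom x y ≠ hD.dom (x - 1) (y - 1) := fun e =>
    Domino.not_covers_diagonal.1
      ⟨hD.dom_covers x y, (hD.eq_dom_iff (hD.dom_mem x y)).1 e⟩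
  have h2 : hD.dom (x - 1) y ≠ hD.dom x (y - 1) := fun e =>
    Domino.not_covers_diagonal.2
      ⟨hD.dom_covers (x - 1) y, (hD.eq_dom_iff (hD.dom_mem (x - 1) y)).1 e⟩
  obtain ⟨k1, k2⟩ := card_four h1 h2
  have e1 := externalEdge_right_iff (h := h) hD x y
  have e2 := externalEdge_up_iff (h := h) hD x y
  have e3 := externalEdge_right_iff (h := h) hD (x - 1) y
  have e4 := externalEdge_up_iff (h := h) hD x (y - 1)
  rw [sub_add_cancel, externalEdge_comm] at e3 e4
  have e4' := e4.trans ne_comm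
  refine ⟨?_, by simpa only [IsDominoTiling.around] using k2⟩
  have hcard : (externalNbrs h 𝓓 (x, y)).card = (if hD.dom x (y - 1) ≠ hD.dom x y then 1 else 0) +
      ((if hD.dom (x - 1) y ≠ hD.dom x y then 1 else 0) +
      ((if hD.dom (x - 1) (y - 1) ≠ hD.dom (x - 1) y then 1 else 0) +
        if hD.dom (x - 1) (y - 1) ≠ hD.dom x (y - 1) then 1 else 0)) := by
    simp only [← e1, ← e2, ← e3, ← e4]
    rw [externalNbrs, Finset.card_filter, gridNbrs, Finset.sum_insert, Finset.sum_insert,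
      Finset.sum_insert, Finset.sum_singleton]
    · simp
    · simp only [Finset.mem_insert, Finset.mem_singleton, Prod.mk.injEq]
      omega
    · simp only [Finset.mem_insert, Finset.mem_singleton, Prod.mk.injEq]
      omega
  rw [hcard, ← k1]
  rfl

/-- The dominoes over the four cells at a lattice point are those that contribute internal edges
there, including those for which it is the midpoint of a long side. -/
lemma mem_around_iff (hD : IsDominoTiling 𝓓) {W : ℤ × ℤ} :
    d ∈ hD.around W ↔ d ∈ 𝓓 ∧ ∃ p ∈ outerNodes, W = d.corner p := by
  obtain ⟨x, y⟩ := W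
  simp only [IsDominoTiling.around, Finset.mem_insert, Finset.mem_singleton]
  constructor
  · rintro (rfl | rfl | rfl | rfl) <;>
      refine ⟨hD.dom_mem _ _, Domino.exists_corner_of_covers (hD.dom_covers _ _) ?_ ?_⟩ <;> simp
  · rintro ⟨hd, p, hp, e⟩
    obtain ⟨X, Y, hc, h1, h2⟩ := Domino.covers_of_corner (d := d) hp
    rw [← e] at h1 h2
    simp only [hD.eq_dom_iff hd]
    simp only at h1 h2
    rcases h1 with rfl | rfl <;> rcases h2 with rfl | rfl <;> simp [hc]

/-! ### Weighted degrees -/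

lemma neighborSet_gridPoint (hD : IsDominoTiling 𝓓) (W : ℤ × ℤ) :
    (graph (ofDominoes h 𝓓)).neighborSet (gridPoint h W) =
      {u | ExternalEdge (ofDominoes h 𝓓) (rectangles h 𝓓) (gridPoint h W) u} ∪
      ⋃ d ∈ (hD.around W : Set Domino),
        {u | InternalEdge (ofDominoes h 𝓓) (placed (d.place h)) (gridPoint h W) u} := by
  ext u
  simp only [SimpleGraph.mem_neighborSet, mem_union, mem_ofPred_eq, mem_iUnion, exists_prop,
    Finset.mem_coe]
  constructor
  · intro hadj
    obtain ⟨d, hd, e, he, hs⟩ := (graph_adj_iff hD).1 hadj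
    rcases List.mem_append.1 he with hin | hout
    · right
      refine ⟨d, (mem_around_iff hD).2 ⟨hd, ?_⟩, (internalEdge_iff hD hd).2 ⟨e, hin, hs⟩⟩
      apply Domino.exists_corner_eq (h := h)
      rcases Sym2.eq_iff.1 hs with ⟨e1, -⟩ | ⟨e1, -⟩ <;> rw [e1]
      · exact map_node_mem_region _ (nodes_of_mem_edges he).1
      · exact map_node_mem_region _ (nodes_of_mem_edges he).2.1
    · exact Or.inl ((externalEdge_iff hD).2 ⟨d, hd, e, hout, hs⟩)
  · rintro (hu | ⟨d, -, hu⟩)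
    · exact hu.1
    · exact hu.1

lemma finite_externalEdge (hD : IsDominoTiling 𝓓) (W : ℤ × ℤ) :
    {u | ExternalEdge (ofDominoes h 𝓓) (rectangles h 𝓓) (gridPoint h W) u}.Finite := by
  rw [externalEdge_set_eq hD]
  exact (Finset.finite_toSet _).image _

lemma finite_internalEdge (hD : IsDominoTiling 𝓓) (hd : d ∈ 𝓓) (v : ℂ) :
    {u | InternalEdge (ofDominoes h 𝓓) (placed (d.place h)) v u}.Finite := by
  refine ((nodes.toFinset.finite_toSet.image fun p => d.place h (node p))).subset ?_
  intro u hu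
  obtain ⟨e, he, hs⟩ := (internalEdge_iff hD hd).1 hu
  have hn := nodes_of_mem_edges (List.mem_append_left outerEdges he)
  rcases Sym2.eq_iff.1 hs with ⟨-, rfl⟩ | ⟨-, rfl⟩
  · exact ⟨_, List.mem_toFinset.2 hn.2.1, rfl⟩
  · exact ⟨_, List.mem_toFinset.2 hn.1, rfl⟩

lemma finite_biUnion_internalEdge (hD : IsDominoTiling 𝓓) (W : ℤ × ℤ) (v : ℂ) :
    (⋃ d ∈ (hD.around W : Set Domino),
      {u | InternalEdge (ofDominoes h 𝓓) (placed (d.place h)) v u}).Finite :=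
  (Finset.finite_toSet _).biUnion fun _ hd =>
    finite_internalEdge hD ((mem_around_iff hD).1 hd).1 v

/-- With n dominoes and n external edges at the point, the sum is 3n + nk. The edges split into
disjoint groups because open internal edges lie in the interior of their own rectangle. -/
lemma weightedDegree_gridPoint (hD : IsDominoTiling 𝓓)
    (hl : IsPrescribed (ofDominoes h 𝓓) (rectangles h 𝓓) c l) (W : ℤ × ℤ) {k : ℕ}
    (hk : ∀ d ∈ hD.around W,
      groupSum (ofDominoes h 𝓓) l (placed (d.place h)) (gridPoint h W) = k) :
    ∃ n ∈ ({2, 3, 4} : Set ℕ),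
      weightedDegree (graph (ofDominoes h 𝓓)) l (gridPoint h W) = n * (3 + k) := by
  obtain ⟨h1, h2⟩ := card_externalNbrs (h := h) hD W
  refine ⟨_, h2, ?_⟩
  have hmem {d} (hd : d ∈ (hD.around W : Set Domino)) := ((mem_around_iff hD).1 hd).1
  rw [weightedDegree, neighborSet_gridPoint hD, finsum_mem_union ?_ (finite_externalEdge hD W)
    (finite_biUnion_internalEdge hD W _), finsum_mem_biUnion ?_ (Finset.finite_toSet _)
    fun d hd => finite_internalEdge hD (hmem hd) _]
  · have e1 : ∑ᶠ u ∈ {u | ExternalEdge (ofDominoes h 𝓓) (rectangles h 𝓓) (gridPoint h W) u},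
        l s(gridPoint h W, u) = (externalNbrs h 𝓓 W).card * 3 := by
      have hlab : ∀ u ∈ {u | ExternalEdge (ofDominoes h 𝓓) (rectangles h 𝓓) (gridPoint h W) u},
          l s(gridPoint h W, u) = 3 := fun u hu => hl.external _ _ hu
      rw [finsum_mem_congr rfl hlab, externalEdge_set_eq hD,
        finsum_mem_image (gridPoint_injective h).injOn, finsum_mem_coe_finset, Finset.sum_const,
        smul_eq_mul]
    have e2 : ∑ᶠ d ∈ (hD.around W : Set Domino),
        ∑ᶠ u ∈ {u | InternalEdge (ofDominoes h 𝓓) (placed (d.place h)) (gridPoint h W) u},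
          l s(gridPoint h W, u) = (hD.around W).card * k := by
      have hk' := Finset.sum_congr (rfl : hD.around W = hD.around W) hk
      simp only [groupSum] at hk'
      rw [finsum_mem_coe_finset, hk', Finset.sum_const, smul_eq_mul]
    rw [e1, e2, ← h1]
    ring
  · intro d hd d' hd' hne
    refine disjoint_left.2 fun u hu hu' => hne ?_
    obtain ⟨z, hz⟩ := openSegment_nonempty (gridPoint h W) u
    exact hD.eq_of_mem_interior (hmem hd) (hmem hd') (hu.2 hz) (interior_subset (hu'.2 hz))
  · refine disjoint_left.2 fun u hu hu' => ?_
    simp only [mem_iUnion, exists_prop] at hu'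
    obtain ⟨d, hd, hu'⟩ := hu'
    obtain ⟨-, R, ⟨d', hd', rfl⟩, hR⟩ := hu
    obtain ⟨z, hz⟩ := openSegment_nonempty (gridPoint h W) u
    have h3 := hu'.2 hz
    have h4 := hR (openSegment_subset_segment ℝ _ _ hz)
    obtain rfl := hD.eq_of_mem_interior (hmem hd) hd' h3 (frontier_region_placed_subset _ h4)
    exact disjoint_left.1 (disjoint_interior_frontier_region _) h3 h4

lemma weightedDegree_outer (hD : IsDominoTiling 𝓓)
    (hc : IsAlternating (ofDominoes h 𝓓) (rectangles h 𝓓) c)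
    (hl : IsPrescribed (ofDominoes h 𝓓) (rectangles h 𝓓) c l)
    (hv : ExternalVertex (ofDominoes h 𝓓) (rectangles h 𝓓) v) :
    (c v = Colour.red →
      weightedDegree (graph (ofDominoes h 𝓓)) l v ∈ ({10, 15, 20} : Set ℕ)) ∧
    (c v = Colour.blue →
      weightedDegree (graph (ofDominoes h 𝓓)) l v ∈ ({12, 18, 24} : Set ℕ)) := by
  obtain ⟨hv, _, ⟨d, hd, rfl⟩, hf⟩ := hv
  obtain ⟨p, hp, rfl⟩ := exists_gridPoint_of_mem_frontier hD hd hv hf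
  rw [place_node_of_outer hp] at *
  -- The group sum depends only on the colour of the vertex, which is the same seen from every
  -- rectangle around it.
  have key (d') (hd' : d' ∈ hD.around (d.corner p)) :
      (c (gridPoint h (d.corner p)) = Colour.red → groupSum (ofDominoes h 𝓓) l
        (placed (d'.place h)) (gridPoint h (d.corner p)) = 2) ∧
      (c (gridPoint h (d.corner p)) = Colour.blue → groupSum (ofDominoes h 𝓓) l
        (placed (d'.place h)) (gridPoint h (d.corner p)) = 3) := by
    obtain ⟨h1, q, hq, e⟩ := (mem_around_iff hD).1 hd'
    refine groupSum_eq hD hc hl (R := placed (d'.place h)) ⟨d', h1, rfl⟩ hv ?_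
    rw [e, ← place_node_of_outer hq]
    exact map_node_mem_frontier _ hq
  constructor
  · intro hcol
    obtain ⟨n, hn, e⟩ := weightedDegree_gridPoint hD hl _ fun d' hd' => (key d' hd').1 hcol
    rw [e]
    rcases hn with rfl | rfl | rfl <;> simp
  · intro hcol
    obtain ⟨n, hn, e⟩ := weightedDegree_gridPoint hD hl _ fun d' hd' => (key d' hd').2 hcol
    rw [e]
    rcases hn with rfl | rfl | rfl <;> simp

/-- An internal vertex lies in no other rectangle and on no boundary, so every edge at it is
internal to its own rectangle. -/
lemma neighborSet_inner (hD : IsDominoTiling 𝓓) (hφ : placed φ ∈ rectangles h 𝓓) {p : ℕ × ℕ}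
    (hp : p ∈ innerNodes) : (graph (ofDominoes h 𝓓)).neighborSet (φ (node p)) =
      {u | InternalEdge (ofDominoes h 𝓓) (placed φ) (φ (node p)) u} := by
  ext u
  simp only [SimpleGraph.mem_neighborSet, mem_ofPred_eq]
  refine ⟨fun hadj => ?_, fun hu => hu.1⟩
  have hint := map_node_mem_interior φ hp
  obtain ⟨d, hd, hdφ⟩ := hφ
  simp only at hdφ
  rw [← hdφ] at hint ⊢
  obtain ⟨d', hd', e, he, hs⟩ := (graph_adj_iff hD).1 hadj
  have hends : φ (node p) ∈ segment ℝ (d'.place h (node e.1)) (d'.place h (node e.2)) ∧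
      φ (node p) ∈ region (placed (d'.place h)) := by
    rcases Sym2.eq_iff.1 hs with ⟨e1, -⟩ | ⟨e1, -⟩ <;> rw [e1]
    · exact ⟨left_mem_segment ℝ _ _, map_node_mem_region _ (nodes_of_mem_edges he).1⟩
    · exact ⟨right_mem_segment ℝ _ _, map_node_mem_region _ (nodes_of_mem_edges he).2.1⟩
  obtain rfl := hD.eq_of_mem_interior hd hd' hint hends.2
  refine (internalEdge_iff hD hd).2 ⟨e, ?_, hs⟩
  rcases List.mem_append.1 he with hin | hout
  · exact hin
  · exact absurd (outer_segment_subset _ hout hends.1)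
      (disjoint_left.1 (disjoint_interior_frontier_region _) hint)

lemma weightedDegree_inner (hD : IsDominoTiling 𝓓)
    (hl : IsPrescribed (ofDominoes h 𝓓) (rectangles h 𝓓) c l)
    (hφ : placed φ ∈ rectangles h 𝓓) (hm : Matches c φ) {q : (ℕ × ℕ) × ℕ}
    (hq : q ∈ internalDegrees) :
    weightedDegree (graph (ofDominoes h 𝓓)) l (φ (node q.1)) = q.2 := by
  have hs : ∀ q ∈ internalDegrees, ∑ p ∈ innerNbrs q.1, modelWeight q.1 p = q.2 := by decide
  rw [weightedDegree, neighborSet_inner hD hφ (List.mem_map.2 ⟨q, hq, rfl⟩), ← hs q hq,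
    ← groupSum_placed hD hl hφ hm]
  rfl

/-- The possible weighted degrees of the vertices at a node of the model rectangle. -/
def modelDegrees (p : ℕ × ℕ) : List ℕ :=
  ((internalDegrees.filter fun q => q.1 = p).map Prod.snd) ++
    (if p ∈ redNodes then [10, 15, 20] else []) ++ (if p ∈ blueNodes then [12, 18, 24] else [])

lemma mem_vertexSet_of_node (hφ : placed φ ∈ rectangles h 𝓓) {p : ℕ × ℕ} (hp : p ∈ nodes) :
    φ (node p) ∈ vertexSet (ofDominoes h 𝓓) := by
  have h1 := (mem_vertexSet_placed (φ := φ)).2 ⟨p, hp, rfl⟩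
  obtain ⟨d, hd, e⟩ := hφ
  simp only at e
  rw [← e] at h1
  obtain ⟨q, hq, e'⟩ := mem_vertexSet_placed.1 h1
  exact mem_vertexSet_ofDominoes.2 ⟨d, hd, q, hq, e'⟩

lemma weightedDegree_mem (hD : IsDominoTiling 𝓓)
    (hc : IsAlternating (ofDominoes h 𝓓) (rectangles h 𝓓) c)
    (hl : IsPrescribed (ofDominoes h 𝓓) (rectangles h 𝓓) c l)
    (hφ : placed φ ∈ rectangles h 𝓓) (hm : Matches c φ) {p : ℕ × ℕ} (hp : p ∈ nodes) :
    weightedDegree (graph (ofDominoes h 𝓓)) l (φ (node p)) ∈ modelDegrees p := by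
  simp only [modelDegrees, List.mem_append, List.mem_map, List.mem_filter, decide_eq_true_eq]
  rcases List.mem_append.1 hp with hin | hout
  · obtain ⟨q, hq, rfl⟩ := List.mem_map.1 hin
    exact Or.inl (Or.inl ⟨q, ⟨hq, rfl⟩, (weightedDegree_inner hD hl hφ hm hq).symm⟩)
  · have hw := weightedDegree_outer hD hc hl ⟨mem_vertexSet_of_node hφ hp, _, hφ,
      map_node_mem_frontier φ hout⟩
    rcases List.mem_append.1 hout with hb | hr
    · right
      simpa [hb] using hw.2 (hm.1 p hb)
    · left; right
      simpa [hr] using hw.1 (hm.2 p hr)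

lemma isSolution123_ofDominoes (hD : IsDominoTiling 𝓓)
    (hc : IsAlternating (ofDominoes h 𝓓) (rectangles h 𝓓) c)
    (hl : IsPrescribed (ofDominoes h 𝓓) (rectangles h 𝓓) c l) :
    IsSolution123 (graph (ofDominoes h 𝓓)) l where
  locallyFinite := by
    intro v
    by_cases hv : v ∈ vertexSet (ofDominoes h 𝓓)
    · obtain ⟨d, hd, p, hp, rfl⟩ := mem_vertexSet_ofDominoes.1 hv
      rcases List.mem_append.1 hp with hp | hp
      · rw [neighborSet_inner hD ⟨d, hd, rfl⟩ hp]
        exact finite_internalEdge hD hd _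
      · rw [place_node_of_outer hp, neighborSet_gridPoint hD]
        exact (finite_externalEdge hD _).union (finite_biUnion_internalEdge hD _ _)
    · convert Set.finite_empty
      ext u
      simp only [SimpleGraph.mem_neighborSet, mem_empty_iff_false, iff_false]
      exact fun hadj => hv hadj.2.1
  labels := by
    have hw : ∀ e ∈ innerEdges, modelWeight e.1 e.2 = 1 ∨ modelWeight e.1 e.2 = 2 ∨
        modelWeight e.1 e.2 = 3 := by decide
    intro e
    induction e with
    | _ u v =>
      intro huv
      obtain ⟨d, hd, e, he, hs⟩ := (graph_adj_iff hD).1 huv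
      rcases List.mem_append.1 he with hin | hout
      · have hR : placed (d.place h) ∈ rectangles h 𝓓 := ⟨d, hd, rfl⟩
        obtain ⟨φ, ⟨hφ, hm⟩, -⟩ := existsUnique_matches hD hc hR
        rw [← hφ] at hR
        have hi := (internalEdge_iff hD hd).2 ⟨e, hin, hs⟩
        rw [← hφ, internalEdge_placed_iff hD hR] at hi
        obtain ⟨e', he', hs'⟩ := hi
        rw [hs', hl.label_inner hR hm (Or.inl he')]
        exact hw e' he'
      · exact Or.inr (Or.inr (hl.external u v ((externalEdge_iff hD).2 ⟨d, hd, e, hout, hs⟩)))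
  colouring := by
    -- For an external node all three possible values are compared, so the check does not depend on
    -- how many rectangles meet there.
    have hne : ∀ e ∈ edges, ∀ m ∈ modelDegrees e.1, ∀ n ∈ modelDegrees e.2, m ≠ n := by decide
    have hpair {p q : ℕ × ℕ} (hpq : HasPair edges p q) {m n : ℕ} (hm : m ∈ modelDegrees p)
        (hn : n ∈ modelDegrees q) : m ≠ n := by
      rcases hpq with hpq | hpq
      · exact hne _ hpq m hm n hn
      · exact (hne _ hpq n hn m hm).symm
    -- Edges are given through the placement of the domino, degrees through the placement that
    -- respects the colours; the half-turn permutes the edges and reconciles the two.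
    have hturn : ∀ e ∈ edges, HasPair edges (turnNode e.1) (turnNode e.2) ∧
        turnNode e.1 ∈ nodes ∧ turnNode e.2 ∈ nodes := by decide
    have key {d : Domino} (hd : d ∈ 𝓓) {e : (ℕ × ℕ) × (ℕ × ℕ)} (he : e ∈ edges) :
        weightedDegree (graph (ofDominoes h 𝓓)) l (d.place h (node e.1)) ≠
          weightedDegree (graph (ofDominoes h 𝓓)) l (d.place h (node e.2)) := by
      have hR : placed (d.place h) ∈ rectangles h 𝓓 := ⟨d, hd, rfl⟩
      obtain ⟨φ, ⟨hφ, hm⟩, -⟩ := existsUnique_matches hD hc hR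
      rw [← hφ] at hR
      have hdeg {p : ℕ × ℕ} (hp : p ∈ nodes) := weightedDegree_mem hD hc hl hR hm hp
      obtain ⟨h1, h2, -⟩ := nodes_of_mem_edges he
      rcases eq_or_eq_turn_of_placed_eq hφ.symm with e' | e'
      · rw [e']
        exact hpair (Or.inl he) (hdeg h1) (hdeg h2)
      · obtain ⟨k1, k2, k3⟩ := hturn e he
        rw [e', IsometryEquiv.trans_apply, IsometryEquiv.trans_apply, turn_node h1, turn_node h2]
        exact hpair k1 (hdeg k2) (hdeg k3)
    intro u v huv
    obtain ⟨d, hd, e, he, hs⟩ := (graph_adj_iff hD).1 huv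
    rcases Sym2.eq_iff.1 hs with ⟨rfl, rfl⟩ | ⟨rfl, rfl⟩
    · exact key hd he
    · exact (key hd he).symm

end NonPinwheel

end

theorem mainTheorem6 (T : Set NonPinwheel.Tri) (hT : NonPinwheel.IsTiling T) :
    ∃ 𝓡 : Set (Set NonPinwheel.Tri), NonPinwheel.IsRectanglePartition T 𝓡 ∧
      (∃ c : ℂ → NonPinwheel.Colour, NonPinwheel.IsAlternating T 𝓡 c) ∧
      ∀ c : ℂ → NonPinwheel.Colour, NonPinwheel.IsAlternating T 𝓡 c →
        (∀ R ∈ 𝓡, ∃! φ : ℂ ≃ᵢ ℂ, NonPinwheel.placed φ = R ∧ NonPinwheel.Matches c φ) ∧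
        (∃ l : Sym2 ℂ → ℕ, NonPinwheel.IsPrescribed T 𝓡 c l) ∧
        ∀ l : Sym2 ℂ → ℕ, NonPinwheel.IsPrescribed T 𝓡 c l →
          (∀ R ∈ 𝓡, ∀ v ∈ NonPinwheel.vertexSet T, v ∈ frontier (NonPinwheel.region R) →
            (c v = NonPinwheel.Colour.red → NonPinwheel.groupSum T l R v = 2) ∧
            (c v = NonPinwheel.Colour.blue → NonPinwheel.groupSum T l R v = 3)) ∧
          (∀ v, NonPinwheel.ExternalVertex T 𝓡 v →
            (c v = NonPinwheel.Colour.red →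
              NonPinwheel.weightedDegree (NonPinwheel.graph T) l v ∈ ({10, 15, 20} : Set ℕ)) ∧
            (c v = NonPinwheel.Colour.blue →
              NonPinwheel.weightedDegree (NonPinwheel.graph T) l v ∈ ({12, 18, 24} : Set ℕ))) ∧
          (∀ φ : ℂ ≃ᵢ ℂ, NonPinwheel.placed φ ∈ 𝓡 → NonPinwheel.Matches c φ →
            ∀ q ∈ NonPinwheel.internalDegrees,
              NonPinwheel.weightedDegree (NonPinwheel.graph T) l (φ (NonPinwheel.node q.1)) =
                q.2) ∧
          NonPinwheel.IsSolution123 (NonPinwheel.graph T) l := by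
  obtain ⟨h, 𝓓, hD, hT'⟩ := hT.exists_dominoTiling
  obtain rfl : T = NonPinwheel.ofDominoes h 𝓓 := hT'
  refine ⟨NonPinwheel.rectangles h 𝓓, NonPinwheel.isRectanglePartition_rectangles hD,
    NonPinwheel.exists_isAlternating hD, fun c hc => ⟨fun R hR =>
      NonPinwheel.existsUnique_matches hD hc hR, NonPinwheel.exists_isPrescribed hD hc,
      fun l hl => ⟨fun R hR v hv hf => NonPinwheel.groupSum_eq hD hc hl hR hv hf,
        fun v hv => NonPinwheel.weightedDegree_outer hD hc hl hv,
        fun φ hφ hm q hq => NonPinwheel.weightedDegree_inner hD hl hφ hm hq,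
        NonPinwheel.isSolution123_ofDominoes hD hc hl⟩⟩⟩
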